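/- **Theorem 1 (Convergence of BiSVBI).** *Model.* Fix $M,N,K,Q,T_p,T_d\in\mathbb N$, matrices $\Phi_{k,n}\in\mathbb C^{M\times(Q+1)}$ (the sensing matrices at fixed sensing parameters), pilots $u_{t,k,n}\in\mathbb C$, sets $\mathcal K_{t,n}\subseteq\{1,\dots,K\}$ of users active on subcarrier $n$ of data symbol $t$, and observations $y^p_{t,n}\in\mathbb C^M$ ($t\le T_p$), $y^d_{t,n}\in\mathbb C^M$ ($t\le T_d$), stacked into $y$. The latent variables are the channel $\alpha=(\alpha_{k,q})$, the precisions $\rho=(\rho_{k,q})$ and the supports $s=(s_{k,q})$, $1\le k\le K$, $0\le q\le Q$, the data $x=(x_{t,k,n})_{k\in\mathcal K_{t,n}}$ and the noise precision $\gamma$. With $\alpha_k=(\alpha_{k,q})_{0\le q\le Q}$ and independent noise $z\sim\mathcal{CN}(0,\gamma^{-1}I)$, $$y^p_{t,n}=\sum_k u_{t,k,n}\Phi_{k,n}\alpha_k+z^p_{t,n},\qquad y^d_{t,n}=\sum_{k\in\mathcal K_{t,n}}x_{t,k,n}\Phi_{k,n}\alpha_k+z^d_{t,n},$$ that is, $y=A_\alpha(x)\,\alpha+z$;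 and $y^d_{t,n}=\Psi_{t,n}x_{t,n}+z^d_{t,n}$, where $\Psi_{t,n}=\Psi_{t,n}(\alpha)$ has the columns $\Phi_{k,n}\alpha_k$, $k\in\mathcal K_{t,n}$. The prior is $\hat p(v)=\hat p(s)\,p(\rho\mid s)\,p(\alpha\mid\rho)\,p(x)\,p(\gamma)$, $v=(\alpha,x,\rho,s,\gamma)$, where independently $s_{k,q}=1$ with probability $\lambda_{k,q}\in[0,1]$ and $s_{k,q}=0$ otherwise, $\rho_{k,q}\mid s_{k,q}$ has the Gamma law with shape and rate $(a_{k,q},b_{k,q})$ if $s_{k,q}=1$ and $(\bar a_{k,q},\bar b_{k,q})$ if $s_{k,q}=0$, $\alpha_{k,q}\mid\rho_{k,q}\sim\mathcal{CN}(0,1/\rho_{k,q})$, $x_{t,k,n}\sim\mathcal{CN}(0,\sigma^2_{t,k,n})$ with $\sigma^2_{t,k,n}>0$, and $\gamma$ has the Gamma law with shape $c$ and rate $d$; all shapes and rates are positive. *Problem $\mathscr A_{\rm VBI}$.* Minimize $\mathrm{KL}(q\,\|\,\hat p(\cdot\mid y))$ over $q=q(\alpha)q(x)q(\rho)q(s)q(\gamma)$,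 where the factors are probability laws, $q(\alpha)=\mathcal{CN}(\mu_\alpha,\mathrm{Diag}(\sigma_\alpha^2))$ and $q(x)=\mathcal{CN}(\mu_x,\mathrm{Diag}(\sigma_x^2))$ with free means and positive variance vectors. A feasible $q^*$ is a *stationary solution* if each of its five factors minimizes the KL divergence when the other four factors of $q^*$ are kept, the minimization being over all laws for $\rho,s,\gamma$, and over the mean and the variance vector for $\alpha$ and $x$. *Algorithm.* BiSVBI keeps the parameters $\mu_\alpha,\sigma_\alpha^2,\mu_x,\sigma_x^2$, $\check a_{k,q},\check b_{k,q}$ (Gamma law of $\rho_{k,q}$), $\check\lambda_{k,q}$ (probability of $s_{k,q}=1$), $\check c,\check d$ (Gamma law of $\gamma$) of a factorized $q$. Write $\langle\cdot\rangle$ for expectation under the current $q$, so that $\langle\rho_{k,q}\rangle=\check a_{k,q}/\check b_{k,q}$, $\langle\ln\rho_{k,q}\rangle=\psi(\check a_{k,q})-\ln\check b_{k,q}$ with $\psi=(\ln\Gamma)'$, and $\langle\gamma\rangle=\check c/\check d$. One iteration performs, in this order: 1. ($\alpha$) With $W=\mathrm{Diag}\langle\rho\rangle+\langle\gamma\rangle\langle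 A_\alpha^HA_\alpha\rangle$, $b=\langle\gamma\rangle\langle A_\alpha^H\rangle y$ and $\varphi(u)=u^HWu-2\,\mathrm{Re}(u^Hb)$: for a support estimate $\hat{\mathcal S}$ let $\mu^s$ be $W_{\hat{\mathcal S}}^{-1}b_{\hat{\mathcal S}}$ on $\hat{\mathcal S}$ and $0$ off $\hat{\mathcal S}$. Start at the previous $\mu_\alpha$ if $\varphi(\mu^s)\ge\varphi(\mu_\alpha)$, and at $\mu^s$ otherwise, and perform $B_\alpha\ge1$ steps $u\leftarrow u-\epsilon\,(Wu-b)$, where $\epsilon$ is given by the Armijo backtracking rule for $\varphi$ (fixed positive initial step, fixed reduction factor and slope fraction in $(0,1)$). The result is the new $\mu_\alpha$; the new variances are $\sigma_{\alpha,i}^2=1/W_{ii}$. 2. ($\rho$) $\check a_{k,q}=\check\lambda_{k,q}a_{k,q}+(1-\check\lambda_{k,q})\bar a_{k,q}+1$, $\ \check b_{k,q}=\check\lambda_{k,q}b_{k,q}+(1-\check\lambda_{k,q})\bar b_{k,q}+|\mu_{\alpha,k,q}|^2+\sigma^2_{\alpha,k,q}$. 3. ($s$) $\check\lambda_{k,q}=\dfrac{\lambda_{k,q}C_{k,q}}{\lambda_{k,q}C_{k,q}+(1-\lambda_{k,q})\bar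 C_{k,q}}$, where $C_{k,q}=\frac{b_{k,q}^{a_{k,q}}}{\Gamma(a_{k,q})}\exp\big((a_{k,q}-1)\langle\ln\rho_{k,q}\rangle-b_{k,q}\langle\rho_{k,q}\rangle\big)$ and $\bar C_{k,q}$ is the same expression in $\bar a_{k,q},\bar b_{k,q}$. 4. ($x$) For all $t,n$, with $W_{t,n}=\mathrm{Diag}(1/\sigma^2_{t,k,n})_{k\in\mathcal K_{t,n}}+\langle\gamma\rangle\langle\Psi_{t,n}^H\Psi_{t,n}\rangle$: $\ \mu_{x,t,n}=W_{t,n}^{-1}\langle\gamma\rangle\langle\Psi_{t,n}^H\rangle y^d_{t,n}$ and $\sigma^2_{x,t,n}$ is the vector of the reciprocals of the diagonal elements of $W_{t,n}$. 5. ($\gamma$) $\check c=c+(T_p+T_d)MN$, $\ \check d=d+\langle\|y-A_\alpha\alpha\|^2\rangle$. *Claim.* Let the initial parameters be arbitrary admissible ones (positive variances, shapes and rates, probabilities in $[0,1]$), and let the support estimates $\hat{\mathcal S}$ used in the iterations be arbitrary (for instance, obtained by thresholding $|\mu_{\alpha,k,q}|^2$ of the previous iteration). Then the KL divergence objective of $\mathscr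 A_{\rm VBI}$ is non-increasing along the iterations, and for every limit $\xi^*$ of a convergent subsequence of the parameter vectors of the iterates, the corresponding $q^*$ is a stationary solution of $\mathscr A_{\rm VBI}$. -/

import Mathlib

open MeasureTheory ProbabilityTheory Matrix Filter Topology

noncomputable section

namespace BiSVBI

/-! ### Densities -/

/-- The density at `z` of the circularly symmetric complex Gaussian `CN(mu, v)` on `ℂ`, with
respect to the Lebesgue measure of `ℂ`. -/
def cnPDF (mu : ℂ) (v : ℝ) (z : ℂ) : ℝ :=
  (Real.pi * v)⁻¹ * Real.exp (-(‖z - mu‖ ^ 2 / v))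

/-- The law `CN(mu, v)` on `ℂ`. -/
def cnMeasure (mu : ℂ) (v : ℝ) : Measure ℂ :=
  volume.withDensity fun z => ENNReal.ofReal (cnPDF mu v z)

/-- The law `CN(mu, Diag(v))` of a complex Gaussian vector with diagonal covariance. -/
def cnVec {ι : Type} [Fintype ι] (mu : ι → ℂ) (v : ι → ℝ) : Measure (ι → ℂ) :=
  Measure.pi fun i => cnMeasure (mu i) (v i)

/-- The Bernoulli law with success probability `l`. -/
def bernoulliMeasure (l : ℝ) : Measure Bool :=
  ENNReal.ofReal l • Measure.dirac true + ENNReal.ofReal (1 - l) • Measure.dirac false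

/-- The logarithmic derivative `ψ` of the Gamma function on the reals. -/
def psi (x : ℝ) : ℝ := deriv (fun t => Real.log (Real.Gamma t)) x

/-- The entrywise expectation of a random matrix. -/
def expect {Ω m n : Type} [MeasurableSpace Ω] (P : Measure Ω) (F : Ω → Matrix m n ℂ) :
    Matrix m n ℂ :=
  Matrix.of fun i j => ∫ ω, F ω i j ∂P

/-! ### The bilinear observation model -/

/-- The index set of the channel coefficients `α_{k,q}` (user `k`, path `q`, where `q = 0` is the
line-of-sight path and `q = 1, …, Q` are the grid positions). -/
abbrev PathIdx (K Q : ℕ) : Type := Fin K × Fin (Q + 1)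

/-- The index set of the scalar observations: (pilot or data symbol, subcarrier, antenna). -/
abbrev ObsIdx (M N Tp Td : ℕ) : Type := (Fin Tp ⊕ Fin Td) × Fin N × Fin M

/-- The data of the inference problem, for fixed sensing parameters: `M` antennas, `N` subcarriers,
`K` users, `Q` grid positions, `Tp` pilot symbols and `Td` data symbols. -/
structure Model (M N K Q Tp Td : ℕ) where
  /-- The pilots `u_{t,k,n}` (zero on the subcarriers where user `k` sends no pilot). -/
  pilot : Fin Tp → Fin K → Fin N → ℂ
  /-- The set of the users that transmit data on subcarrier `n` of data symbol `t`. -/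
  users : Fin Td → Fin N → Finset (Fin K)
  /-- The sensing matrices `Φ_{k,n}`. -/
  Phi : Fin K → Fin N → Matrix (Fin M) (Fin (Q + 1)) ℂ
  /-- The received pilot and data signals. -/
  y : ObsIdx M N Tp Td → ℂ
  /-- The prior variances (transmit powers) of the data symbols. -/
  power : Fin Td → Fin N → Fin K → ℝ
  power_pos : ∀ t n, ∀ k ∈ users t n, 0 < power t n k
  /-- Shape and rate of the Gamma prior of the precision `ρ_{k,q}` when `s_{k,q} = 1`. -/
  a : PathIdx K Q → ℝ
  b : PathIdx K Q → ℝ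
  /-- Shape and rate of the Gamma prior of the precision `ρ_{k,q}` when `s_{k,q} = 0`. -/
  abar : PathIdx K Q → ℝ
  bbar : PathIdx K Q → ℝ
  a_pos : ∀ i, 0 < a i
  b_pos : ∀ i, 0 < b i
  abar_pos : ∀ i, 0 < abar i
  bbar_pos : ∀ i, 0 < bbar i
  /-- The prior probability of `s_{k,q} = 1`. -/
  lam : PathIdx K Q → ℝ
  lam_mem : ∀ i, lam i ∈ Set.Icc (0 : ℝ) 1
  /-- Shape and rate of the Gamma prior of the noise precision `γ`. -/
  c : ℝ
  d : ℝ
  c_pos : 0 < c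
  d_pos : 0 < d

variable {M N K Q Tp Td : ℕ}

namespace Model

/-- The index set of the data symbols: a slot `(t, n)` and a user that is active on it. -/
abbrev DataIdx (mdl : Model M N K Q Tp Td) : Type :=
  Σ τ : Fin Td × Fin N, {k : Fin K // k ∈ mdl.users τ.1 τ.2}

/-- The prior variance of a data symbol. -/
def dataVar (mdl : Model M N K Q Tp Td) (j : mdl.DataIdx) : ℝ :=
  mdl.power j.1.1 j.1.2 j.2.1

/-- The matrix `A_α`, the vertical stack of the `U_t Φ` and of the `X_t Φ`; it depends on the data
`x` through the `X_t`. -/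
def A (mdl : Model M N K Q Tp Td) (x : mdl.DataIdx → ℂ) :
    Matrix (ObsIdx M N Tp Td) (PathIdx K Q) ℂ :=
  Matrix.of fun o i =>
    match o with
    | (Sum.inl t, n, m) => mdl.pilot t i.1 n * mdl.Phi i.1 n m i.2
    | (Sum.inr t, n, m) =>
        if h : i.1 ∈ mdl.users t n then x ⟨(t, n), ⟨i.1, h⟩⟩ * mdl.Phi i.1 n m i.2 else 0

/-- The matrix `Ψ_n` on data symbol `t`: its columns are the channel vectors `Φ_{k,n} α_k` of the
active users `k`. -/
def Psi (mdl : Model M N K Q Tp Td) (τ : Fin Td × Fin N) (α : PathIdx K Q → ℂ) :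
    Matrix (Fin M) {k : Fin K // k ∈ mdl.users τ.1 τ.2} ℂ :=
  Matrix.of fun m k => (mdl.Phi k.1 τ.2 *ᵥ fun q => α (k.1, q)) m

/-- The squared residual `‖y - A_α α‖²`. -/
def residual (mdl : Model M N K Q Tp Td) (α : PathIdx K Q → ℂ) (x : mdl.DataIdx → ℂ) : ℝ :=
  ∑ o, ‖mdl.y o - (mdl.A x *ᵥ α) o‖ ^ 2

/-- The space of the latent variables `v = (α, x, ρ, s, γ)`. -/
abbrev Latent (mdl : Model M N K Q Tp Td) : Type :=
  (PathIdx K Q → ℂ) × (mdl.DataIdx → ℂ) × (PathIdx K Q → ℝ) × (PathIdx K Q → Bool) × ℝ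

/-- The reference measure `dv`: Lebesgue measure in `α`, `x`, `ρ`, `γ`, counting measure in `s`. -/
def refMeasure (mdl : Model M N K Q Tp Td) : Measure mdl.Latent :=
  (volume : Measure (PathIdx K Q → ℂ)).prod
    ((volume : Measure (mdl.DataIdx → ℂ)).prod
      ((volume : Measure (PathIdx K Q → ℝ)).prod
        ((Measure.count : Measure (PathIdx K Q → Bool)).prod (volume : Measure ℝ))))

/-- The joint density of `v` and `y`, at the observed `y`:
`p(s) p(ρ ∣ s) p(α ∣ ρ) p(x) p(γ) p(y ∣ α, x, γ)`. -/
def jointPDF (mdl : Model M N K Q Tp Td) : mdl.Latent → ℝ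
  | (α, x, ρ, s, γ) =>
      (∏ i, if s i then mdl.lam i else 1 - mdl.lam i) *
      (∏ i, if s i then gammaPDFReal (mdl.a i) (mdl.b i) (ρ i)
        else gammaPDFReal (mdl.abar i) (mdl.bbar i) (ρ i)) *
      (∏ i, cnPDF 0 (1 / ρ i) (α i)) *
      (∏ j, cnPDF 0 (mdl.dataVar j) (x j)) *
      gammaPDFReal mdl.c mdl.d γ *
      ∏ o, cnPDF ((mdl.A x *ᵥ α) o) (1 / γ) (mdl.y o)

/-- The measure with density `p(v, y)`. -/
def jointMeasure (mdl : Model M N K Q Tp Td) : Measure mdl.Latent :=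
  mdl.refMeasure.withDensity fun v => ENNReal.ofReal (mdl.jointPDF v)

/-- The posterior `p(v ∣ y) = p(v, y) / p(y)`. -/
def posterior (mdl : Model M N K Q Tp Td) : Measure mdl.Latent :=
  (mdl.jointMeasure Set.univ)⁻¹ • mdl.jointMeasure

/-! ### The variational problem -/

/-- The five factors of a factorized variational posterior. -/
structure Factors (mdl : Model M N K Q Tp Td) where
  qα : Measure (PathIdx K Q → ℂ)
  qx : Measure (mdl.DataIdx → ℂ)
  qρ : Measure (PathIdx K Q → ℝ)
  qs : Measure (PathIdx K Q → Bool)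
  qγ : Measure ℝ

/-- The Kullback-Leibler divergence of the product of the factors from the posterior. -/
def kld (mdl : Model M N K Q Tp Td) (q : mdl.Factors) : ENNReal :=
  InformationTheory.klDiv (q.qα.prod (q.qx.prod (q.qρ.prod (q.qs.prod q.qγ)))) mdl.posterior

/-- The constraints of the variational problem: all factors are probability laws, and those of `α`
and of `x` are complex Gaussians with a diagonal covariance matrix. -/
structure IsFeasible (mdl : Model M N K Q Tp Td) (q : mdl.Factors) : Prop where
  gaussian_α : ∃ (mu : PathIdx K Q → ℂ) (v : PathIdx K Q → ℝ), (∀ i, 0 < v i) ∧ q.qα = cnVec mu v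
  gaussian_x : ∃ (mu : mdl.DataIdx → ℂ) (v : mdl.DataIdx → ℝ), (∀ j, 0 < v j) ∧ q.qx = cnVec mu v
  prob_ρ : IsProbabilityMeasure q.qρ
  prob_s : IsProbabilityMeasure q.qs
  prob_γ : IsProbabilityMeasure q.qγ

/-- A stationary solution of the variational problem: a feasible point at which each factor
minimizes the divergence when the other four are kept; `ρ`, `s`, `γ` range over all laws, `α` and
`x` over the means and the variance vectors. -/
structure IsStationary (mdl : Model M N K Q Tp Td) (q : mdl.Factors) : Prop where
  feasible : mdl.IsFeasible q
  min_α : ∀ (mu : PathIdx K Q → ℂ) (v : PathIdx K Q → ℝ), (∀ i, 0 < v i) →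
    mdl.kld q ≤ mdl.kld { q with qα := cnVec mu v }
  min_x : ∀ (mu : mdl.DataIdx → ℂ) (v : mdl.DataIdx → ℝ), (∀ j, 0 < v j) →
    mdl.kld q ≤ mdl.kld { q with qx := cnVec mu v }
  min_ρ : ∀ r : Measure (PathIdx K Q → ℝ), IsProbabilityMeasure r →
    mdl.kld q ≤ mdl.kld { q with qρ := r }
  min_s : ∀ r : Measure (PathIdx K Q → Bool), IsProbabilityMeasure r →
    mdl.kld q ≤ mdl.kld { q with qs := r }
  min_γ : ∀ r : Measure ℝ, IsProbabilityMeasure r →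
    mdl.kld q ≤ mdl.kld { q with qγ := r }

/-! ### The parameters of the variational posterior -/

/-- The parameters: means and variances of `α` and `x`, shapes and rates of the Gamma laws of the
`ρ_{k,q}`, the probabilities of `s_{k,q} = 1`, shape and rate of the Gamma law of `γ`. -/
@[ext]
structure Params (mdl : Model M N K Q Tp Td) where
  muα : PathIdx K Q → ℂ
  varα : PathIdx K Q → ℝ
  mux : mdl.DataIdx → ℂ
  varx : mdl.DataIdx → ℝ
  shapeρ : PathIdx K Q → ℝ
  rateρ : PathIdx K Q → ℝ
  probs : PathIdx K Q → ℝ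
  shapeγ : ℝ
  rateγ : ℝ

namespace Params

variable {mdl : Model M N K Q Tp Td}

/-- The parameters as a tuple. -/
def toTuple (θ : mdl.Params) :
    (PathIdx K Q → ℂ) × (PathIdx K Q → ℝ) × (mdl.DataIdx → ℂ) × (mdl.DataIdx → ℝ) ×
      (PathIdx K Q → ℝ) × (PathIdx K Q → ℝ) × (PathIdx K Q → ℝ) × ℝ × ℝ :=
  (θ.muα, θ.varα, θ.mux, θ.varx, θ.shapeρ, θ.rateρ, θ.probs, θ.shapeγ, θ.rateγ)

/-- The Euclidean topology: convergence of all parameters. -/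
instance : TopologicalSpace mdl.Params :=
  TopologicalSpace.induced toTuple inferInstance

/-- The parameters describe probability densities. -/
structure Valid (θ : mdl.Params) : Prop where
  varα_pos : ∀ i, 0 < θ.varα i
  varx_pos : ∀ j, 0 < θ.varx j
  shapeρ_pos : ∀ i, 0 < θ.shapeρ i
  rateρ_pos : ∀ i, 0 < θ.rateρ i
  probs_mem : ∀ i, θ.probs i ∈ Set.Icc (0 : ℝ) 1
  shapeγ_pos : 0 < θ.shapeγ
  rateγ_pos : 0 < θ.rateγ

/-- The variational posterior with these parameters. -/
def toFactors (θ : mdl.Params) : mdl.Factors where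
  qα := cnVec θ.muα θ.varα
  qx := cnVec θ.mux θ.varx
  qρ := Measure.pi fun i => gammaMeasure (θ.shapeρ i) (θ.rateρ i)
  qs := Measure.pi fun i => bernoulliMeasure (θ.probs i)
  qγ := gammaMeasure θ.shapeγ θ.rateγ

/-- The mean `⟨ρ_{k,q}⟩`. -/
def meanρ (θ : mdl.Params) (i : PathIdx K Q) : ℝ := θ.shapeρ i / θ.rateρ i

/-- The mean `⟨ln ρ_{k,q}⟩`. -/
def meanLogρ (θ : mdl.Params) (i : PathIdx K Q) : ℝ := psi (θ.shapeρ i) - Real.log (θ.rateρ i)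

/-- The mean `⟨γ⟩`. -/
def meanγ (θ : mdl.Params) : ℝ := θ.shapeγ / θ.rateγ

/-! ### The update of the channel factor -/

/-- The matrix `W_α = Diag⟨ρ⟩ + ⟨γ⟩ ⟨A_αᴴ A_α⟩`. -/
def Wα (θ : mdl.Params) : Matrix (PathIdx K Q) (PathIdx K Q) ℂ :=
  Matrix.diagonal (fun i => (θ.meanρ i : ℂ)) +
    (θ.meanγ : ℂ) • expect θ.toFactors.qx fun x => (mdl.A x)ᴴ * mdl.A x

/-- The vector `b_α = ⟨γ⟩ ⟨A_αᴴ⟩ y`. -/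
def bα (θ : mdl.Params) : PathIdx K Q → ℂ :=
  (θ.meanγ : ℂ) • ((expect θ.toFactors.qx fun x => (mdl.A x)ᴴ) *ᵥ mdl.y)

end Params

end Model

/-- The quadratic objective `uᴴ W u - 2 Re(uᴴ b)`. -/
def quadObj {ι : Type} [Fintype ι] (W : Matrix ι ι ℂ) (b u : ι → ℂ) : ℝ :=
  (star u ⬝ᵥ (W *ᵥ u)).re - 2 * (star u ⬝ᵥ b).re

/-- The gradient `W u - b` of the quadratic objective (derivative in the conjugate of `u`, hence
half the gradient with respect to the real and imaginary parts). -/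
def quadGrad {ι : Type} [Fintype ι] (W : Matrix ι ι ℂ) (b u : ι → ℂ) : ι → ℂ :=
  W *ᵥ u - b

/-- The subspace constrained matrix inverse: `W_S⁻¹ b_S` on the support `S`, zero elsewhere. -/
def subspaceSol {ι : Type} [DecidableEq ι] (W : Matrix ι ι ℂ) (b : ι → ℂ) (S : Finset ι) : ι → ℂ :=
  fun i => if h : i ∈ S then
    ((W.submatrix (fun j : {j // j ∈ S} => j.1) (fun j : {j // j ∈ S} => j.1))⁻¹ *ᵥ
      fun j : {j // j ∈ S} => b j.1) ⟨i, h⟩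
  else 0

/-- The robust choice of the starting point: the previous posterior mean `u`, unless the subspace
constrained solution has a strictly smaller objective. -/
def robustInit {ι : Type} [Fintype ι] [DecidableEq ι] (W : Matrix ι ι ℂ) (b : ι → ℂ)
    (S : Finset ι) (u : ι → ℂ) : ι → ℂ :=
  if quadObj W b u ≤ quadObj W b (subspaceSol W b S) then u else subspaceSol W b S

/-- The constants of the Armijo rule: initial step, reduction factor, slope fraction. -/
structure ArmijoRule where
  init : ℝ
  shrink : ℝ
  slope : ℝ
  init_pos : 0 < init
  shrink_mem : shrink ∈ Set.Ioo (0 : ℝ) 1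
  slope_mem : slope ∈ Set.Ioo (0 : ℝ) 1

/-- The step size `init * shrink ^ m` of the Armijo rule at `u`: `m` is the first exponent at which
the decrease of the objective along `-g`, `g = W u - b`, is at least the fraction `slope` of the
decrease predicted by its directional derivative `-2‖g‖²`. -/
def ArmijoRule.step {ι : Type} [Fintype ι] (arm : ArmijoRule) (W : Matrix ι ι ℂ) (b u : ι → ℂ) :
    ℝ :=
  arm.init * arm.shrink ^ sInf {m : ℕ |
    quadObj W b (u - (arm.init * arm.shrink ^ m) • quadGrad W b u) ≤
      quadObj W b u -
        arm.slope * (arm.init * arm.shrink ^ m) * (2 * ∑ i, ‖quadGrad W b u i‖ ^ 2)}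

/-- One gradient step with the Armijo step size. -/
def gradStep {ι : Type} [Fintype ι] (arm : ArmijoRule) (W : Matrix ι ι ℂ) (b u : ι → ℂ) : ι → ℂ :=
  u - arm.step W b u • quadGrad W b u

namespace Model

namespace Params

variable {mdl : Model M N K Q Tp Td}

/-- Update of the factor of `α`, for the support estimate `S`: `B` Armijo gradient steps from the
robust starting point for the mean, the exact optimum for the variances. -/
def updateα (arm : ArmijoRule) (B : ℕ) (S : Finset (PathIdx K Q)) (θ : mdl.Params) : mdl.Params :=
  { θ with
    muα := (gradStep arm θ.Wα θ.bα)^[B] (robustInit θ.Wα θ.bα S θ.muα)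
    varα := fun i => (θ.Wα i i).re⁻¹ }

/-! ### The updates of the other factors -/

/-- Update of the factor of `ρ`. -/
def updateρ (θ : mdl.Params) : mdl.Params :=
  { θ with
    shapeρ := fun i => θ.probs i * mdl.a i + (1 - θ.probs i) * mdl.abar i + 1
    rateρ := fun i => θ.probs i * mdl.b i + (1 - θ.probs i) * mdl.bbar i +
      (‖θ.muα i‖ ^ 2 + θ.varα i) }

/-- The exponential of the mean under the law of `ρ_{k,q}` of the logarithm of the density of the
Gamma law with shape `a` and rate `b`. -/
def gammaWeight (θ : mdl.Params) (a b : ℝ) (i : PathIdx K Q) : ℝ :=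
  b ^ a / Real.Gamma a * Real.exp ((a - 1) * θ.meanLogρ i - b * θ.meanρ i)

/-- Update of the factor of `s`. -/
def updateS (θ : mdl.Params) : mdl.Params :=
  { θ with
    probs := fun i =>
      mdl.lam i * θ.gammaWeight (mdl.a i) (mdl.b i) i /
        (mdl.lam i * θ.gammaWeight (mdl.a i) (mdl.b i) i +
          (1 - mdl.lam i) * θ.gammaWeight (mdl.abar i) (mdl.bbar i) i) }

/-- The matrix `W_{x,t,n} = Diag(1 / σ²) + ⟨γ⟩ ⟨Ψ_nᴴ Ψ_n⟩`, where `σ²` are the prior variances. -/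
def Wx (θ : mdl.Params) (τ : Fin Td × Fin N) :
    Matrix {k : Fin K // k ∈ mdl.users τ.1 τ.2} {k : Fin K // k ∈ mdl.users τ.1 τ.2} ℂ :=
  Matrix.diagonal (fun k => ((mdl.dataVar ⟨τ, k⟩)⁻¹ : ℂ)) +
    (θ.meanγ : ℂ) • expect θ.toFactors.qα fun α => (mdl.Psi τ α)ᴴ * mdl.Psi τ α

/-- The vector `b_{x,t,n} = ⟨γ⟩ ⟨Ψ_nᴴ⟩ y_{t,n}`. -/
def bx (θ : mdl.Params) (τ : Fin Td × Fin N) : {k : Fin K // k ∈ mdl.users τ.1 τ.2} → ℂ :=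
  (θ.meanγ : ℂ) • ((expect θ.toFactors.qα fun α => (mdl.Psi τ α)ᴴ) *ᵥ
    fun m => mdl.y (Sum.inr τ.1, τ.2, m))

/-- Update of the factor of `x`. -/
def updateX (θ : mdl.Params) : mdl.Params :=
  { θ with
    mux := fun j => ((θ.Wx j.1)⁻¹ *ᵥ θ.bx j.1) j.2
    varx := fun j => (θ.Wx j.1 j.2 j.2).re⁻¹ }

/-- Update of the factor of `γ`. -/
def updateγ (θ : mdl.Params) : mdl.Params :=
  { θ with
    shapeγ := mdl.c + ((Tp + Td) * M * N : ℕ)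
    rateγ := mdl.d +
      ∫ w, mdl.residual w.1 w.2 ∂(θ.toFactors.qα.prod θ.toFactors.qx) }

/-- One iteration of BiSVBI: the factors of `α`, `ρ`, `s`, `x`, `γ` are updated in this order. -/
def iteration (arm : ArmijoRule) (B : ℕ) (S : Finset (PathIdx K Q)) (θ : mdl.Params) : mdl.Params :=
  (θ.updateα arm B S).updateρ.updateS.updateX.updateγ

end Params

/-- The iterates of BiSVBI with initial parameters `θ₀`, where `S t` is the support estimate used in
iteration `t + 1`. The sequence `S` is arbitrary, so that every way of forming the support estimates
is covered, in particular `S t = {i : ‖muα i‖ ^ 2 > ε}` with the posterior mean `muα` after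
iteration `t` (or after some earlier iteration) and any threshold `ε`. -/
def iterates (mdl : Model M N K Q Tp Td) (arm : ArmijoRule) (B : ℕ)
    (S : ℕ → Finset (PathIdx K Q)) (θ₀ : mdl.Params) : ℕ → mdl.Params
  | 0 => θ₀
  | t + 1 => (mdl.iterates arm B S θ₀ t).iteration arm B (S t)

end Model

end BiSVBI

end

noncomputable section

namespace BiSVBI

variable {M N K Q Tp Td : ℕ}

/-! ### Product densities -/

/-! BiSVBI is block coordinate descent on the divergence, exact in the blocks `ρ`, `s`, `x`, `γ` and
inexact in the mean of `α`. For valid parameters that charge no support of prior probability zero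
(`Compatible`), the divergence equals an explicit function `obj` of the parameters plus the constant
`ln p(y)` (`Valid.kld_eq`); without compatibility it is infinite (`Valid.compatible_of_kld_ne_top`).
The evidence `p(y)` is shown to be finite and positive, so that the posterior is a probability law.

Descent. The updates of `ρ`, `s`, `γ` minimize over all laws: after the update, the log density
ratio averaged over the other factors is constant in the updated block, so replacing the new factor
`r₀` by `r` adds exactly `KL(r ‖ r₀) ≥ 0` (`klDiv_prod_le_of_average_const`). As a function of the
Gaussian factor of `α`, and of that of `x` slot by slot, `obj` is a quadratic form in the mean plus
the terms `-ln v_i + W_ii v_i` in the variances (`Valid.obj_eq_gaussObj_α`,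
`Valid.obj_eq_gaussObj_x`). Mean and variances decouple, and the step in `x` is exact. In the step
in `α`, the starting point is no worse than the previous mean, and one Armijo step gains a multiple
of the squared gradient, which controls the suboptimality. Hence the decrease of the step bounds, up
to a constant depending only on curvature bounds, both the suboptimality of the previous mean and
the squared distance to the new one, whatever the support estimate
(`ArmijoRule.exists_descent_const`).

Limits. From the first iteration on, the iterates are compatible and `obj` is antitone. A limit `θ`
of a subsequence is again valid: shapes and rates are bounded below by the updates, and the
variances cannot vanish because `obj` is bounded above, contains minus the logarithms of the
variances, and is otherwise continuous up to vanishing variances (`isUpdated_of_tendsto`). So `obj`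
converges to its value at `θ`, and the decrease per iteration tends to zero.

The update map itself has no useful continuity, as supports are arbitrary and Armijo exponents jump.
Instead, the vanishing decrease forces the parameters after the step in `α` to converge to `θ` as
well, with optimal mean and variances of `α` in the limit (`tendsto_updateα`). For `x` and `ρ`, a
fixed competitor improves those parameters by at most the decrease of the iteration, hence it does
not improve `θ`. For `x` this uses that the gain from changing `x` is unaffected by the steps in `ρ`
and `s` in between (`Valid.obj_updateS_sub_withx`). For `s` and `γ`, the fixed-point equations pass
to the limit. -/

lemma pi_withDensity_ofReal {ι : Type} [Fintype ι] {E : ι → Type*} [∀ i, MeasurableSpace (E i)]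
    (μ : ∀ i, Measure (E i)) [∀ i, SigmaFinite (μ i)] (f : ∀ i, E i → ℝ)
    (hf : ∀ i, Integrable (f i) (μ i)) (h0 : ∀ i x, 0 ≤ f i x) :
    Measure.pi (fun i => (μ i).withDensity fun x => ENNReal.ofReal (f i x)) =
      (Measure.pi μ).withDensity fun x => ENNReal.ofReal (∏ i, f i (x i)) := by
  refine Measure.pi_eq fun s hs => ?_
  rw [withDensity_apply _ (MeasurableSet.univ_pi hs), Measure.restrict_pi_pi]
  rw [← ofReal_integral_eq_lintegral_ofReal, integral_fintype_prod_eq_prod,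
    ENNReal.ofReal_prod_of_nonneg]
  · refine Finset.prod_congr rfl fun i _ => ?_
    rw [withDensity_apply _ (hs i), ofReal_integral_eq_lintegral_ofReal (hf i).integrableOn
      (ae_of_all _ (h0 i))]
  · exact fun i _ => integral_nonneg (h0 i)
  · exact Integrable.fintype_prod_dep fun i => (hf i).integrableOn
  · exact ae_of_all _ fun x => Finset.prod_nonneg fun i _ => h0 i _

/-! ### Complex Gaussian laws -/

lemma cnPDF_nonneg {v : ℝ} (hv : 0 ≤ v) (mu z : ℂ) : 0 ≤ cnPDF mu v z := by
  unfold cnPDF; have := Real.pi_pos; positivity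

lemma cnPDF_pos {v : ℝ} (hv : 0 < v) (mu z : ℂ) : 0 < cnPDF mu v z := by
  unfold cnPDF; have := Real.pi_pos; positivity

/-- The squared modulus splits into real and imaginary parts, and `π v` is the product of the
normalizations of two real Gaussians of variance `v / 2`. Total mass and moments of the complex law
are inherited from `gaussianReal` in this way. -/
lemma cnMeasure_eq_map (mu : ℂ) {v : ℝ} (hv : 0 < v) :
    cnMeasure mu v = ((gaussianReal mu.re (v / 2).toNNReal).prod
      (gaussianReal mu.im (v / 2).toNNReal)).map Complex.measurableEquivRealProd.symm := by
  have hv2 : (v / 2).toNNReal ≠ 0 := by simpa using half_pos hv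
  have hc : ((v / 2).toNNReal : ℝ) = v / 2 := Real.coe_toNNReal _ (half_pos hv).le
  rw [gaussianReal_of_var_ne_zero _ hv2, gaussianReal_of_var_ne_zero _ hv2,
    prod_withDensity (measurable_gaussianPDF _ _) (measurable_gaussianPDF _ _)]
  ext s hs
  rw [Measure.map_apply (MeasurableEquiv.measurable _) hs, cnMeasure, withDensity_apply _ hs,
    withDensity_apply _ (hs.preimage (MeasurableEquiv.measurable _))]
  rw [← (Complex.volume_preserving_equiv_real_prod.symm).setLIntegral_comp_preimage_emb
    (MeasurableEquiv.measurableEmbedding _)]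
  refine setLIntegral_congr_fun (hs.preimage (MeasurableEquiv.measurable _)) fun p _ => ?_
  simp only [gaussianPDF, gaussianPDFReal, hc]
  rw [← ENNReal.ofReal_mul (by positivity)]
  congr 1
  simp only [cnPDF, Complex.measurableEquivRealProd_symm_apply]
  have h1 : √(2 * Real.pi * (v / 2)) ^ 2 = Real.pi * v := by
    rw [Real.sq_sqrt (by have := Real.pi_pos; positivity)]; ring
  rw [Complex.sq_norm, Complex.normSq_apply]
  simp only [Complex.sub_re, Complex.sub_im]
  change _ = (√(2 * Real.pi * (v / 2)))⁻¹ * Real.exp (-(p.1 - mu.re) ^ 2 / (2 * (v / 2))) *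
    ((√(2 * Real.pi * (v / 2)))⁻¹ * Real.exp (-(p.2 - mu.im) ^ 2 / (2 * (v / 2))))
  rw [← h1, mul_mul_mul_comm, ← Real.exp_add, sq (√_), mul_inv]
  congr 2
  field_simp
  ring

lemma isProbabilityMeasure_cnMeasure (mu : ℂ) {v : ℝ} (hv : 0 < v) :
    IsProbabilityMeasure (cnMeasure mu v) := by
  rw [cnMeasure_eq_map mu hv]
  exact Measure.isProbabilityMeasure_map (MeasurableEquiv.measurable _).aemeasurable

lemma measurable_cnPDF (mu : ℂ) (v : ℝ) : Measurable (cnPDF mu v) := by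
  unfold cnPDF; fun_prop

lemma integrable_cnPDF (mu : ℂ) {v : ℝ} (hv : 0 < v) : Integrable (cnPDF mu v) := by
  have := isProbabilityMeasure_cnMeasure mu hv
  refine ⟨(measurable_cnPDF mu v).aestronglyMeasurable, ?_⟩
  rw [hasFiniteIntegral_iff_ofReal (ae_of_all _ (cnPDF_nonneg hv.le mu))]
  have h := measure_univ (μ := cnMeasure mu v)
  rw [cnMeasure, withDensity_apply _ MeasurableSet.univ, setLIntegral_univ] at h
  rw [h]; exact ENNReal.one_lt_top

lemma cnMeasure_re (mu : ℂ) {v : ℝ} (hv : 0 < v) :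
    MeasurePreserving Complex.re (cnMeasure mu v) (gaussianReal mu.re (v / 2).toNNReal) := by
  refine ⟨Complex.measurable_re, ?_⟩
  rw [cnMeasure_eq_map mu hv, Measure.map_map Complex.measurable_re (MeasurableEquiv.measurable _)]
  exact measurePreserving_fst.map_eq

lemma cnMeasure_im (mu : ℂ) {v : ℝ} (hv : 0 < v) :
    MeasurePreserving Complex.im (cnMeasure mu v) (gaussianReal mu.im (v / 2).toNNReal) := by
  refine ⟨Complex.measurable_im, ?_⟩
  rw [cnMeasure_eq_map mu hv, Measure.map_map Complex.measurable_im (MeasurableEquiv.measurable _)]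
  exact measurePreserving_snd.map_eq

lemma memLp_re_cnMeasure (mu : ℂ) {v : ℝ} (hv : 0 < v) : MemLp Complex.re 2 (cnMeasure mu v) :=
  (memLp_id_gaussianReal' 2 (by simp)).comp_measurePreserving (cnMeasure_re mu hv)

lemma memLp_im_cnMeasure (mu : ℂ) {v : ℝ} (hv : 0 < v) : MemLp Complex.im 2 (cnMeasure mu v) :=
  (memLp_id_gaussianReal' 2 (by simp)).comp_measurePreserving (cnMeasure_im mu hv)

lemma memLp_cnMeasure (mu : ℂ) {v : ℝ} (hv : 0 < v) :
    MemLp (fun z : ℂ => z) 2 (cnMeasure mu v) := by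
  have h1 := (memLp_re_cnMeasure mu hv).ofReal (K := ℂ)
  have h2 := ((memLp_im_cnMeasure mu hv).ofReal (K := ℂ)).mul_const Complex.I
  convert h1.add h2 using 1
  ext z
  simp [Complex.re_add_im]

lemma integral_gaussianReal_sq (m : ℝ) (v : NNReal) : ∫ x, x ^ 2 ∂gaussianReal m v = v + m ^ 2 := by
  have h := variance_eq_sub (memLp_id_gaussianReal' (μ := m) (v := v) 2 (by simp))
  rw [variance_id_gaussianReal] at h
  simp only [Pi.pow_apply, id_eq, integral_id_gaussianReal] at h
  linarith

lemma integral_id_cnMeasure (mu : ℂ) {v : ℝ} (hv : 0 < v) : ∫ z, z ∂cnMeasure mu v = mu := by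
  have := isProbabilityMeasure_cnMeasure mu hv
  have hi := (memLp_cnMeasure mu hv).integrable one_le_two
  apply Complex.ext
  · have h1 : (∫ z, z ∂cnMeasure mu v).re = ∫ z, z.re ∂cnMeasure mu v := by
      simpa using (integral_re hi).symm
    rw [h1, ← integral_id_gaussianReal (μ := mu.re) (v := (v / 2).toNNReal),
      ← (cnMeasure_re mu hv).map_eq, integral_map Complex.measurable_re.aemeasurable
      (by fun_prop)]
  · have h1 : (∫ z, z ∂cnMeasure mu v).im = ∫ z, z.im ∂cnMeasure mu v := by
      simpa using (integral_im hi).symm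
    rw [h1, ← integral_id_gaussianReal (μ := mu.im) (v := (v / 2).toNNReal),
      ← (cnMeasure_im mu hv).map_eq, integral_map Complex.measurable_im.aemeasurable
      (by fun_prop)]

lemma integral_sq_norm_cnMeasure (mu : ℂ) {v : ℝ} (hv : 0 < v) :
    ∫ z, ‖z‖ ^ 2 ∂cnMeasure mu v = ‖mu‖ ^ 2 + v := by
  have hc : ((v / 2).toNNReal : ℝ) = v / 2 := Real.coe_toNNReal _ (half_pos hv).le
  have h1 : ∫ z, z.re ^ 2 ∂cnMeasure mu v = v / 2 + mu.re ^ 2 := by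
    have := integral_gaussianReal_sq mu.re (v / 2).toNNReal
    rw [← (cnMeasure_re mu hv).map_eq, integral_map Complex.measurable_re.aemeasurable
      (by fun_prop), hc] at this
    exact this
  have h2 : ∫ z, z.im ^ 2 ∂cnMeasure mu v = v / 2 + mu.im ^ 2 := by
    have := integral_gaussianReal_sq mu.im (v / 2).toNNReal
    rw [← (cnMeasure_im mu hv).map_eq, integral_map Complex.measurable_im.aemeasurable
      (by fun_prop), hc] at this
    exact this
  have : ∀ z : ℂ, ‖z‖ ^ 2 = z.re ^ 2 + z.im ^ 2 := fun z => by
    rw [Complex.sq_norm, Complex.normSq_apply]; ring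
  simp_rw [this]
  rw [integral_add (memLp_re_cnMeasure mu hv).integrable_sq (memLp_im_cnMeasure mu hv).integrable_sq,
    h1, h2]
  ring

/-! ### Complex Gaussian vectors -/

section cnVec

variable {ι : Type} [Fintype ι] (mu : ι → ℂ) {v : ι → ℝ}

lemma isProbabilityMeasure_cnVec (hv : ∀ i, 0 < v i) : IsProbabilityMeasure (cnVec mu v) := by
  have := fun i => isProbabilityMeasure_cnMeasure (mu i) (hv i)
  unfold cnVec
  infer_instance

lemma cnVec_eval (hv : ∀ i, 0 < v i) (i : ι) :
    MeasurePreserving (fun u : ι → ℂ => u i) (cnVec mu v) (cnMeasure (mu i) (v i)) := by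
  have := fun i => isProbabilityMeasure_cnMeasure (mu i) (hv i)
  exact measurePreserving_eval (fun i => cnMeasure (mu i) (v i)) i

lemma memLp_eval_cnVec (hv : ∀ i, 0 < v i) (i : ι) :
    MemLp (fun u : ι → ℂ => u i) 2 (cnVec mu v) :=
  (memLp_cnMeasure (mu i) (hv i)).comp_measurePreserving (cnVec_eval mu hv i)

lemma integral_eval_cnVec (hv : ∀ i, 0 < v i) (i : ι) : ∫ u, u i ∂cnVec mu v = mu i := by
  have h := integral_id_cnMeasure (mu i) (hv i)
  rwa [← (cnVec_eval mu hv i).map_eq, integral_map (cnVec_eval mu hv i).measurable.aemeasurable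
    (by fun_prop)] at h

lemma integral_sq_norm_eval_cnVec (hv : ∀ i, 0 < v i) (i : ι) :
    ∫ u, ‖u i‖ ^ 2 ∂cnVec mu v = ‖mu i‖ ^ 2 + v i := by
  have h := integral_sq_norm_cnMeasure (mu i) (hv i)
  rwa [← (cnVec_eval mu hv i).map_eq, integral_map (cnVec_eval mu hv i).measurable.aemeasurable
    (by fun_prop)] at h

lemma integral_star_mul_eval_cnVec [DecidableEq ι] (hv : ∀ i, 0 < v i) (i j : ι) :
    ∫ u, star (u i) * u j ∂cnVec mu v = star (mu i) * mu j + if i = j then (v i : ℂ) else 0 := by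
  have := fun i => isProbabilityMeasure_cnMeasure (mu i) (hv i)
  split_ifs with hij
  · subst hij
    have h : ∀ z : ℂ, star z * z = ((‖z‖ ^ 2 : ℝ) : ℂ) := fun z => by
      rw [Complex.star_def, Complex.conj_mul']; norm_cast
    simp_rw [h]
    rw [integral_complex_ofReal, integral_sq_norm_eval_cnVec mu hv]
    push_cast; rfl
  · have hI : iIndepFun (fun i (u : ι → ℂ) => u i) (cnVec mu v) :=
      iIndepFun_pi (X := fun _ z => z) fun _ => aemeasurable_id
    have h2 := (hI.indepFun hij).integral_fun_comp_mul_comp (f := fun z => star z) (g := fun z => z)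
      (measurable_pi_apply i).aemeasurable (measurable_pi_apply j).aemeasurable
      (by fun_prop) (by fun_prop)
    rw [h2, integral_eval_cnVec mu hv j, add_zero]
    congr 1
    rw [← integral_eval_cnVec mu hv i]
    simpa using integral_conj (f := fun u : ι → ℂ => u i) (μ := cnVec mu v)

lemma integrable_star_mul_eval_cnVec (hv : ∀ i, 0 < v i) (i j : ι) :
    Integrable (fun u : ι → ℂ => star (u i) * u j) (cnVec mu v) :=
  (memLp_eval_cnVec mu hv i).star.integrable_mul (memLp_eval_cnVec mu hv j)

lemma cnVec_eq_withDensity (hv : ∀ i, 0 < v i) :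
    cnVec mu v = (volume : Measure (ι → ℂ)).withDensity
      fun u => ENNReal.ofReal (∏ i, cnPDF (mu i) (v i) (u i)) := by
  unfold cnVec cnMeasure
  rw [pi_withDensity_ofReal (fun _ => volume) _ (fun i => integrable_cnPDF _ (hv i))
    fun i x => cnPDF_nonneg (hv i).le _ _]
  rfl

end cnVec

/-! ### Gamma and Bernoulli laws -/

lemma integrable_gammaPDFReal {a r : ℝ} (ha : 0 < a) (hr : 0 < r) :
    Integrable (gammaPDFReal a r) := by
  refine ⟨(measurable_gammaPDFReal a r).aestronglyMeasurable, ?_⟩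
  rw [hasFiniteIntegral_iff_ofReal (ae_of_all _ (gammaPDFReal_nonneg ha hr))]
  have h := lintegral_gammaPDF_eq_one ha hr
  unfold gammaPDF at h
  rw [h]; exact ENNReal.one_lt_top

lemma ae_pos_gammaMeasure (a r : ℝ) :
    ∀ᵐ x ∂gammaMeasure a r, 0 < x := by
  unfold gammaMeasure
  rw [ae_withDensity_iff (by unfold gammaPDF; fun_prop)]
  filter_upwards [Measure.ae_ne volume (0 : ℝ)] with x hx h
  by_contra hneg
  exact h (gammaPDF_of_neg (lt_of_le_of_ne (not_lt.mp hneg) hx))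

lemma gammaMeasure_eq_withDensity (a r : ℝ) :
    gammaMeasure a r = volume.withDensity fun x => ENNReal.ofReal (gammaPDFReal a r x) := rfl

lemma integral_gammaPDFReal {a r : ℝ} (ha : 0 < a) (hr : 0 < r) : ∫ x, gammaPDFReal a r x = 1 := by
  rw [integral_eq_lintegral_of_nonneg_ae (ae_of_all _ (gammaPDFReal_nonneg ha hr))
    (measurable_gammaPDFReal a r).aestronglyMeasurable]
  have h := lintegral_gammaPDF_eq_one ha hr
  unfold gammaPDF at h
  rw [h]; simp

/-- Exponential tilting by `x ^ t` only shifts the shape. This single identity yields the mean of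
`x`, the polynomial moments and, through the moment generating function of `log`, the mean of `ln
x`. The point zero is excluded because `Real.log 0 = 0` is a default value. -/
lemma gammaPDFReal_mul_rpow {a r t : ℝ} (ha : 0 < a) (hr : 0 < r) (hat : 0 < a + t) :
    ∀ᵐ x : ℝ, gammaPDFReal a r x * Real.exp (t * Real.log x) =
      Real.Gamma (a + t) / (Real.Gamma a * r ^ t) * gammaPDFReal (a + t) r x := by
  filter_upwards [Measure.ae_ne volume (0 : ℝ)] with x hx
  unfold gammaPDFReal
  split_ifs with h
  · have hx0 : 0 < x := lt_of_le_of_ne h hx.symm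
    have h1 := Real.Gamma_pos_of_pos ha
    have h2 := Real.Gamma_pos_of_pos hat
    rw [mul_comm t, ← Real.rpow_def_of_pos hx0, Real.rpow_add hr,
      show a + t - 1 = (a - 1) + t by ring, Real.rpow_add hx0]
    field_simp
  · simp

lemma integrable_gammaMeasure_iff {a r : ℝ} (ha : 0 < a) (hr : 0 < r) {f : ℝ → ℝ} :
    Integrable f (gammaMeasure a r) ↔ Integrable fun x => gammaPDFReal a r x * f x := by
  rw [gammaMeasure_eq_withDensity, integrable_withDensity_iff_integrable_smul' (by fun_prop)
    (by simp)]
  simp [ENNReal.toReal_ofReal (gammaPDFReal_nonneg ha hr _)]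

lemma integral_gammaMeasure {a r : ℝ} (ha : 0 < a) (hr : 0 < r) (f : ℝ → ℝ) :
    ∫ x, f x ∂gammaMeasure a r = ∫ x, gammaPDFReal a r x * f x := by
  rw [gammaMeasure_eq_withDensity, integral_withDensity_eq_integral_toReal_smul (by fun_prop)
    (by simp)]
  simp [ENNReal.toReal_ofReal (gammaPDFReal_nonneg ha hr _)]

lemma integrable_exp_mul_log_gammaMeasure {a r t : ℝ} (ha : 0 < a) (hr : 0 < r) (hat : 0 < a + t) :
    Integrable (fun x => Real.exp (t * Real.log x)) (gammaMeasure a r) := by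
  rw [integrable_gammaMeasure_iff ha hr, integrable_congr (gammaPDFReal_mul_rpow ha hr hat)]
  exact (integrable_gammaPDFReal hat hr).const_mul _

lemma mgf_log_gammaMeasure {a r t : ℝ} (ha : 0 < a) (hr : 0 < r) (hat : 0 < a + t) :
    mgf Real.log (gammaMeasure a r) t = Real.Gamma (a + t) / (Real.Gamma a * r ^ t) := by
  rw [mgf, integral_gammaMeasure ha hr, integral_congr_ae (gammaPDFReal_mul_rpow ha hr hat),
    integral_const_mul, integral_gammaPDFReal hat hr, mul_one]

lemma zero_mem_interior_integrableExpSet_log {a r : ℝ} (ha : 0 < a) (hr : 0 < r) :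
    0 ∈ interior (integrableExpSet Real.log (gammaMeasure a r)) := by
  rw [mem_interior]
  refine ⟨Set.Ioi (-a), fun t ht => ?_, isOpen_Ioi, by simpa⟩
  exact integrable_exp_mul_log_gammaMeasure ha hr (by simpa [neg_lt_iff_pos_add'] using ht)

lemma integrable_log_gammaMeasure {a r : ℝ} (ha : 0 < a) (hr : 0 < r) :
    Integrable Real.log (gammaMeasure a r) :=
  integrable_of_mem_interior_integrableExpSet (zero_mem_interior_integrableExpSet_log ha hr)

lemma differentiableAt_Gamma_of_pos {a : ℝ} (ha : 0 < a) : DifferentiableAt ℝ Real.Gamma a :=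
  Real.differentiableAt_Gamma fun m => by
    have : (0 : ℝ) ≤ m := m.cast_nonneg
    linarith

lemma psi_eq {a : ℝ} (ha : 0 < a) : psi a = deriv Real.Gamma a / Real.Gamma a :=
  deriv.log (differentiableAt_Gamma_of_pos ha) (Real.Gamma_pos_of_pos ha).ne'

/-- The mean of `ln x` is the derivative at zero of its moment generating function `Γ(a + t) / (Γ(a)
r ^ t)`. -/
lemma integral_log_gammaMeasure {a r : ℝ} (ha : 0 < a) (hr : 0 < r) :
    ∫ x, Real.log x ∂gammaMeasure a r = psi a - Real.log r := by
  rw [← deriv_mgf_zero (zero_mem_interior_integrableExpSet_log ha hr)]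
  have h1 : mgf Real.log (gammaMeasure a r) =ᶠ[𝓝 0]
      fun t => Real.Gamma (a + t) / (Real.Gamma a * r ^ t) := by
    filter_upwards [isOpen_Ioi.mem_nhds (show (0 : ℝ) ∈ Set.Ioi (-a) by simpa)] with t ht
    exact mgf_log_gammaMeasure ha hr (by simpa [neg_lt_iff_pos_add'] using ht)
  rw [h1.deriv_eq, psi_eq ha]
  have hG := Real.Gamma_pos_of_pos ha
  have h2 : HasDerivAt (fun t : ℝ => Real.Gamma (a + t)) (deriv Real.Gamma a) 0 := by
    have := (differentiableAt_Gamma_of_pos ha).hasDerivAt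
    exact HasDerivAt.comp_const_add a 0 (by simpa using this)
  have h3 : HasDerivAt (fun t : ℝ => Real.Gamma a * r ^ t)
      (Real.Gamma a * (Real.log r)) 0 := by
    have := (Real.hasStrictDerivAt_const_rpow hr 0).hasDerivAt
    simpa using this.const_mul (Real.Gamma a)
  rw [(h2.fun_div h3 (by simp [hG.ne'])).deriv]
  simp only [add_zero, Real.rpow_zero, mul_one]
  field_simp

lemma integrable_id_gammaMeasure {a r : ℝ} (ha : 0 < a) (hr : 0 < r) :
    Integrable (fun x => x) (gammaMeasure a r) := by
  refine (integrable_exp_mul_log_gammaMeasure (t := 1) ha hr (by positivity)).congr ?_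
  filter_upwards [ae_pos_gammaMeasure a r] with x hx
  rw [one_mul, Real.exp_log hx]

/-- The mean of `x = exp (ln x)` is the moment generating function of `log` at `t = 1`. -/
lemma integral_id_gammaMeasure {a r : ℝ} (ha : 0 < a) (hr : 0 < r) :
    ∫ x, x ∂gammaMeasure a r = a / r := by
  have h := mgf_log_gammaMeasure (t := 1) ha hr (by positivity)
  rw [Real.Gamma_add_one ha.ne', Real.rpow_one] at h
  have hG := Real.Gamma_pos_of_pos ha
  have h2 : ∫ x, x ∂gammaMeasure a r = mgf Real.log (gammaMeasure a r) 1 := by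
    rw [mgf]
    refine integral_congr_ae ?_
    filter_upwards [ae_pos_gammaMeasure a r] with x hx
    rw [one_mul, Real.exp_log hx]
  rw [h2, h]
  field_simp

lemma gammaPDFReal_eq_exp {a r x : ℝ} (ha : 0 < a) (hr : 0 < r) (hx : 0 < x) :
    Real.log (gammaPDFReal a r x) =
      a * Real.log r - Real.log (Real.Gamma a) + (a - 1) * Real.log x - r * x := by
  have hG := Real.Gamma_pos_of_pos ha
  rw [gammaPDFReal, if_pos hx.le, Real.log_mul (by positivity) (by positivity),
    Real.log_mul (by positivity) (by positivity), Real.log_div (by positivity) hG.ne',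
    Real.log_rpow hr, Real.log_rpow hx, Real.log_exp]
  ring

lemma isProbabilityMeasure_bernoulliMeasure {l : ℝ} (hl : l ∈ Set.Icc (0 : ℝ) 1) :
    IsProbabilityMeasure (bernoulliMeasure l) := by
  constructor
  simp only [bernoulliMeasure, Measure.add_apply, Measure.smul_apply, measure_univ, smul_eq_mul,
    mul_one]
  rw [← ENNReal.ofReal_add hl.1 (by linarith [hl.2])]
  simp

lemma bernoulliMeasure_eq_withDensity (l : ℝ) :
    bernoulliMeasure l =
      Measure.count.withDensity fun s => ENNReal.ofReal (if s then l else 1 - l) := by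
  refine Measure.ext_of_singleton fun s => ?_
  rw [withDensity_apply _ (measurableSet_singleton s)]
  cases s <;> simp [bernoulliMeasure]

lemma integral_bernoulliMeasure {l : ℝ} (hl : l ∈ Set.Icc (0 : ℝ) 1) (f : Bool → ℝ) :
    ∫ s, f s ∂bernoulliMeasure l = l * f true + (1 - l) * f false := by
  have := isProbabilityMeasure_bernoulliMeasure hl
  rw [integral_fintype (by exact Integrable.of_finite)]
  simp [bernoulliMeasure, Measure.real, ENNReal.toReal_ofReal hl.1,
    ENNReal.toReal_ofReal (sub_nonneg.mpr hl.2)]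

lemma pi_count {ι : Type} [Fintype ι] {E : ι → Type*} [∀ i, Fintype (E i)]
    [∀ i, MeasurableSpace (E i)] [∀ i, MeasurableSingletonClass (E i)] :
    Measure.pi (fun i => (Measure.count : Measure (E i))) = Measure.count := by
  classical
  refine Measure.ext_of_singleton fun x => ?_
  rw [Measure.pi_singleton]
  simp

/-! ### Kullback-Leibler divergences of laws with densities -/

section KL

open InformationTheory

variable {Ω : Type*} [MeasurableSpace Ω]

/-- If `Q` and `J` have the densities `f` and `g` with respect to `ν`, then `Q` has the density
`f / g` with respect to `J`, as soon as `g` is positive `Q`-almost everywhere. -/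
lemma withDensity_eq_withDensity_div {ν : Measure Ω} {f g : Ω → ℝ} (hf : Measurable f)
    (hg : Measurable g) (hpos : ∀ᵐ v ∂ν.withDensity fun v => ENNReal.ofReal (f v), 0 < g v) :
    ν.withDensity (fun v => ENNReal.ofReal (f v)) =
      (ν.withDensity fun v => ENNReal.ofReal (g v)).withDensity
        fun v => ENNReal.ofReal (f v / g v) := by
  rw [← withDensity_mul _ (by fun_prop) (by fun_prop)]
  refine withDensity_congr_ae ?_
  rw [ae_withDensity_iff (by fun_prop)] at hpos
  filter_upwards [hpos] with v hv
  simp only [Pi.mul_apply]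
  by_cases h0 : f v ≤ 0
  -- If both values are nonpositive the quotient may be positive, but then the factor
  -- `ENNReal.ofReal (g v)` vanishes.
  · rcases le_or_gt (g v) 0 with hg0 | hg0
    · simp [ENNReal.ofReal_of_nonpos h0, ENNReal.ofReal_of_nonpos hg0]
    · simp [ENNReal.ofReal_of_nonpos h0, ENNReal.ofReal_of_nonpos
        (div_nonpos_of_nonpos_of_nonneg h0 hg0.le)]
  · have hg0 := hv (by simpa using h0)
    rw [← ENNReal.ofReal_mul hg0.le, mul_div_cancel₀ _ hg0.ne']

/-- The normalization of a finite measure `J` is a probability measure. -/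
lemma isProbabilityMeasure_normalized {J : Measure Ω} [IsFiniteMeasure J]
    (hJ : J Set.univ ≠ 0) : IsProbabilityMeasure ((J Set.univ)⁻¹ • J) := by
  constructor
  simp [ENNReal.inv_mul_cancel hJ (measure_ne_top J _)]

/-- A density with respect to `J` gives one with respect to the normalization of `J`. -/
lemma exists_withDensity_normalized {J Q : Measure Ω} [IsFiniteMeasure J]
    (hJ : J Set.univ ≠ 0) {f ell : Ω → ℝ} (hf : Measurable f)
    (hQ : Q = J.withDensity fun v => ENNReal.ofReal (f v))
    (hlog : ∀ᵐ v ∂Q, Real.log (f v) = ell v) :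
    ∃ F : Ω → ENNReal, Measurable F ∧ Q = ((J Set.univ)⁻¹ • J).withDensity F ∧
      ∀ᵐ v ∂Q, Real.log (F v).toReal = ell v + Real.log (J.real Set.univ) := by
  have hJt : J Set.univ ≠ ⊤ := measure_ne_top J _
  refine ⟨fun v => J Set.univ * ENNReal.ofReal (f v), by fun_prop, ?_, ?_⟩
  · rw [withDensity_smul_measure]
    conv_rhs => rw [show (fun v => J Set.univ * ENNReal.ofReal (f v)) =
      (J Set.univ) • fun v => ENNReal.ofReal (f v) from rfl]
    rw [withDensity_smul _ (by fun_prop), smul_smul, ENNReal.inv_mul_cancel hJ hJt, one_smul, hQ]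
  · have hpos : ∀ᵐ v ∂Q, 0 < f v := by
      rw [hQ, ae_withDensity_iff (by fun_prop)]
      exact ae_of_all _ fun v hv => by simpa using hv
    filter_upwards [hlog, hpos] with v hl hp
    rw [ENNReal.toReal_mul, ENNReal.toReal_ofReal hp.le, Real.log_mul _ hp.ne', hl, add_comm,
      Measure.real]
    exact ENNReal.toReal_ne_zero.mpr ⟨hJ, hJt⟩

/-- The divergence of two probability laws, from the logarithm of the density. -/
lemma klDiv_eq_of_withDensity {P Q : Measure Ω} [IsProbabilityMeasure P] [IsProbabilityMeasure Q]
    {F : Ω → ENNReal} (hF : Measurable F) (hQ : Q = P.withDensity F) {ell : Ω → ℝ} {c : ℝ}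
    (hlog : ∀ᵐ v ∂Q, Real.log (F v).toReal = ell v + c) (hint : Integrable ell Q) :
    klDiv Q P = ENNReal.ofReal (∫ v, ell v ∂Q + c) ∧ 0 ≤ ∫ v, ell v ∂Q + c := by
  have hac : Q ≪ P := by rw [hQ]; exact withDensity_absolutelyContinuous _ _
  have hllr : llr Q P =ᵐ[Q] fun v => ell v + c := by
    have h1 : Q.rnDeriv P =ᵐ[Q] F := by
      refine hac.ae_eq ?_
      conv_lhs => rw [hQ]
      exact Measure.rnDeriv_withDensity _ hF
    filter_upwards [h1, hlog] with v hv hl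
    rw [llr, hv, hl]
  have hi : Integrable (llr Q P) Q := (hint.add (integrable_const _)).congr hllr.symm
  have hval : ∫ v, llr Q P v ∂Q = ∫ v, ell v ∂Q + c := by
    rw [integral_congr_ae hllr, integral_add hint (integrable_const _)]; simp
  have h0 := integral_llr_add_sub_measure_univ_nonneg hac hi
  rw [klDiv_of_ac_of_integrable hac hi, hval]
  -- The nonnegativity is returned together with the value, because inequalities between
  -- `ENNReal.ofReal` values can be inverted only for nonnegative numbers.
  rw [hval] at h0
  simp only [probReal_univ, add_sub_cancel_right] at h0 ⊢
  exact ⟨trivial, h0⟩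

/-- One block of coordinate ascent: if `Q = r₀ ⊗ κ` and the average over `κ` of the logarithm of its
density with respect to `P` is constant, then `r₀` minimizes the divergence of `r ⊗ κ` from `P`. -/
lemma klDiv_prod_le_of_average_const {X Z : Type*} [MeasurableSpace X] [MeasurableSpace Z]
    {P : Measure Ω} [IsProbabilityMeasure P] {r₀ r : Measure X} [IsProbabilityMeasure r₀]
    [IsProbabilityMeasure r] {κ : Measure Z} [IsProbabilityMeasure κ]
    {mk : X × Z → Ω} (hmk : Measurable mk) {pr : Ω → X} (hpr : Measurable pr)
    (hprmk : ∀ p, pr (mk p) = p.1) {f : Ω → ENNReal} (hf : Measurable f)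
    (hQ : (r₀.prod κ).map mk = P.withDensity f) {ell : Ω → ℝ} {c C : ℝ}
    (hlog : ∀ᵐ v ∂(r₀.prod κ).map mk, Real.log (f v).toReal = ell v + c)
    (hav : ∀ᵐ x ∂r₀, ∫ z, ell (mk (x, z)) ∂κ + c = C)
    (hkl : klDiv ((r₀.prod κ).map mk) P = ENNReal.ofReal C) (hP : P.map pr ≪ r₀) :
    klDiv ((r₀.prod κ).map mk) P ≤ klDiv ((r.prod κ).map mk) P := by
  by_cases htop : klDiv ((r.prod κ).map mk) P = ⊤
  · rw [htop]; exact le_top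
  obtain ⟨hac, hint⟩ := klDiv_ne_top_iff.mp htop
  have hprob : IsProbabilityMeasure ((r.prod κ).map mk) :=
    Measure.isProbabilityMeasure_map hmk.aemeasurable
  -- Finite divergence gives `r ⊗ κ ≪ P`; projecting to `X` puts `r` below the marginal of `P`,
  -- hence below `r₀`.
  have hrr : r ≪ r₀ := by
    have h1 : ((r.prod κ).map mk).map pr = r := by
      rw [Measure.map_map hpr hmk, show pr ∘ mk = Prod.fst from funext hprmk]
      exact measurePreserving_fst.map_eq
    rw [← h1]
    exact (hac.map hpr).trans hP
  set D := r.rnDeriv r₀ with hD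
  have hDm : Measurable D := Measure.measurable_rnDeriv _ _
  have hDp : Measurable fun v => D (pr v) := hDm.comp hpr
  have hfD : Measurable fun v => f v * D (pr v) := hf.mul hDp
  have hrD : r = r₀.withDensity D := (Measure.withDensity_rnDeriv_eq _ _ hrr).symm
  have hQr : (r.prod κ).map mk = ((r₀.prod κ).map mk).withDensity fun v => D (pr v) := by
    conv_lhs => rw [hrD, prod_withDensity_left hDm]
    ext s hs
    rw [Measure.map_apply hmk hs, withDensity_apply _ hs, withDensity_apply _ (hs.preimage hmk),
      setLIntegral_map hs hDp hmk]
    simp [hprmk]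
  -- The density with respect to `P` is multiplied by `dr/dr₀`, so the log densities add.
  have hQrP : (r.prod κ).map mk = P.withDensity fun v => f v * D (pr v) := by
    rw [hQr, hQ, ← withDensity_mul _ hf hDp]
    rfl
  have hQQ : (r.prod κ).map mk ≪ (r₀.prod κ).map mk := by
    rw [hQr]; exact withDensity_absolutelyContinuous _ _
  have hllr : llr ((r.prod κ).map mk) P =ᵐ[(r.prod κ).map mk]
      fun v => ell v + c + Real.log (D (pr v)).toReal := by
    have h1 : ((r.prod κ).map mk).rnDeriv P =ᵐ[P] fun v => f v * D (pr v) := by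
      conv_lhs => rw [hQrP]
      exact Measure.rnDeriv_withDensity _ hfD
    have h2 : ∀ᵐ v ∂(r.prod κ).map mk, f v * D (pr v) ≠ 0 := by
      rw [hQrP, ae_withDensity_iff hfD]
      exact ae_of_all _ fun v hv => hv
    have h3 : ∀ᵐ v ∂(r.prod κ).map mk, ((r.prod κ).map mk).rnDeriv P v < ⊤ :=
      hac.ae_le (Measure.rnDeriv_lt_top _ _)
    filter_upwards [hac.ae_eq h1, h2, h3, hQQ.ae_le hlog] with v hv1 hv2 hv3 hv4
    rw [llr, hv1, ENNReal.toReal_mul, Real.log_mul, hv4]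
    · rw [hv1] at hv3
      exact ENNReal.toReal_ne_zero.mpr ⟨left_ne_zero_of_mul hv2,
        (ENNReal.lt_top_of_mul_ne_top_left hv3.ne (right_ne_zero_of_mul hv2)).ne⟩
    · rw [hv1] at hv3
      exact ENNReal.toReal_ne_zero.mpr ⟨right_ne_zero_of_mul hv2,
        (ENNReal.lt_top_of_mul_ne_top_right hv3.ne (left_ne_zero_of_mul hv2)).ne⟩
  have hi2 : Integrable (fun p : X × Z => ell (mk p) + c + Real.log (D p.1).toReal) (r.prod κ) := by
    have h := (integrable_map_measure (hint.congr hllr).aestronglyMeasurable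
      hmk.aemeasurable).mp (hint.congr hllr)
    exact h.congr (ae_of_all _ fun p => by simp [hprmk])
  have hval : ∫ v, llr ((r.prod κ).map mk) P v ∂(r.prod κ).map mk =
      ∫ p, (ell (mk p) + c + Real.log (D p.1).toReal) ∂(r.prod κ) := by
    rw [integral_congr_ae hllr, integral_map hmk.aemeasurable
      (hint.congr hllr).aestronglyMeasurable]
    simp [hprmk]
  -- Only the sum of the three terms is known to be integrable. By Fubini almost every slice of it
  -- is integrable, and in a slice two of the terms are constants, so the integral over `κ` may be
  -- split.
  have hin : (fun x => ∫ z, (ell (mk (x, z)) + c + Real.log (D x).toReal) ∂κ) =ᵐ[r]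
      fun x => C + llr r r₀ x := by
    filter_upwards [hi2.prod_right_ae, hrr.ae_le hav] with x hx hx2
    have h1 : Integrable (fun z => ell (mk (x, z))) κ := by
      have := hx.sub (integrable_const (c + Real.log (D x).toReal))
      refine this.congr (ae_of_all _ fun z => ?_)
      simp only [Pi.sub_apply]; ring
    simp_rw [add_assoc]
    rw [integral_add h1 (integrable_const _), integral_const, ← hx2, llr]
    simp only [probReal_univ, smul_eq_mul, one_mul]
    ring
  have hi3 : Integrable (llr r r₀) r := by
    have := (hi2.integral_prod_left.congr hin).sub (integrable_const C)
    refine this.congr (ae_of_all _ fun z => ?_)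
    simp
  rw [hkl, klDiv_of_ac_of_integrable hac hint, hval, integral_prod _ hi2, integral_congr_ae hin,
    integral_add (integrable_const _) hi3]
  -- The divergence of the competitor is `C + KL(r ‖ r₀)`.
  have h0 := integral_llr_add_sub_measure_univ_nonneg hrr hi3
  simp only [probReal_univ, add_sub_cancel_right, integral_const, smul_eq_mul, one_mul] at h0 ⊢
  exact ENNReal.ofReal_le_ofReal (by linarith)

end KL

lemma _root_.MeasureTheory.MeasurePreserving.integral_comp_of_aestronglyMeasurable {Ω Ω' E : Type*}
    [MeasurableSpace Ω] [MeasurableSpace Ω'] [NormedAddCommGroup E] [NormedSpace ℝ E]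
    {μ : Measure Ω} {ν : Measure Ω'} {g : Ω → Ω'}
    (hg : MeasurePreserving g μ ν) {f : Ω' → E} (hf : AEStronglyMeasurable f ν) :
    ∫ v, f (g v) ∂μ = ∫ w, f w ∂ν := by
  rw [← hg.map_eq, integral_map hg.measurable.aemeasurable (hg.map_eq.symm ▸ hf)]

/-- The logarithm of the density at `ρ` of the Gamma law with shape `a` and rate `b` as a function of
`l = ln ρ` and `m = ρ`. -/
def gammaLog (a b l m : ℝ) : ℝ := a * Real.log b - Real.log (Real.Gamma a) + (a - 1) * l - b * m

namespace Model

variable {mdl : Model M N K Q Tp Td}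

/-! ### Measurability of the model -/

lemma continuous_A (mdl : Model M N K Q Tp Td) : Continuous mdl.A := by
  refine continuous_pi fun o => continuous_pi fun i => ?_
  rcases o with ⟨t | t, n, m⟩
  · exact continuous_const
  · by_cases h : i.1 ∈ mdl.users t n
    · simp only [A, Matrix.of_apply, h, dite_true]
      fun_prop
    · simp only [A, Matrix.of_apply, h, dite_false]
      fun_prop

lemma continuous_A_mulVec (mdl : Model M N K Q Tp Td) (o : ObsIdx M N Tp Td) :
    Continuous fun p : (PathIdx K Q → ℂ) × (mdl.DataIdx → ℂ) => (mdl.A p.2 *ᵥ p.1) o := by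
  have h := mdl.continuous_A
  have : Continuous fun p : (PathIdx K Q → ℂ) × (mdl.DataIdx → ℂ) => mdl.A p.2 *ᵥ p.1 :=
    (h.comp continuous_snd).matrix_mulVec continuous_fst
  exact (continuous_apply o).comp this

lemma residual_nonneg (mdl : Model M N K Q Tp Td) (α : PathIdx K Q → ℂ) (x : mdl.DataIdx → ℂ) :
    0 ≤ mdl.residual α x := Finset.sum_nonneg fun _ _ => by positivity

lemma measurable_jointPDF (mdl : Model M N K Q Tp Td) : Measurable mdl.jointPDF := by
  have h1 : ∀ o, Measurable fun v : mdl.Latent => (mdl.A v.2.1 *ᵥ v.1) o := by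
    intro o
    have hp : Measurable fun v : mdl.Latent => (v.1, v.2.1) :=
      measurable_fst.prodMk (measurable_fst.comp measurable_snd)
    have h := (mdl.continuous_A_mulVec o).measurable.comp hp
    exact h
  have h2 : ∀ i, Measurable fun v : mdl.Latent => v.2.2.2.1 i := fun i => by fun_prop
  have h3 : mdl.jointPDF = fun v : mdl.Latent =>
      (∏ i, if v.2.2.2.1 i then mdl.lam i else 1 - mdl.lam i) *
      (∏ i, if v.2.2.2.1 i then gammaPDFReal (mdl.a i) (mdl.b i) (v.2.2.1 i)
        else gammaPDFReal (mdl.abar i) (mdl.bbar i) (v.2.2.1 i)) *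
      (∏ i, cnPDF 0 (1 / v.2.2.1 i) (v.1 i)) *
      (∏ j, cnPDF 0 (mdl.dataVar j) (v.2.1 j)) *
      gammaPDFReal mdl.c mdl.d v.2.2.2.2 *
      ∏ o, cnPDF ((mdl.A v.2.1 *ᵥ v.1) o) (1 / v.2.2.2.2) (mdl.y o) := by
    funext ⟨α, x, ρ, s, γ⟩
    rw [jointPDF]
  rw [h3]
  have h4 : ∀ i, MeasurableSet {v : mdl.Latent | v.2.2.2.1 i = true} := fun i =>
    (measurableSet_singleton true).preimage (h2 i)
  have h5 : Measurable fun v : mdl.Latent =>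
      ∏ i, if v.2.2.2.1 i then mdl.lam i else 1 - mdl.lam i :=
    Finset.measurable_fun_prod _ fun i _ => Measurable.ite (h4 i) measurable_const measurable_const
  have h6 : Measurable fun v : mdl.Latent =>
      ∏ i, if v.2.2.2.1 i then gammaPDFReal (mdl.a i) (mdl.b i) (v.2.2.1 i)
        else gammaPDFReal (mdl.abar i) (mdl.bbar i) (v.2.2.1 i) :=
    Finset.measurable_fun_prod _ fun i _ => Measurable.ite (h4 i) ((measurable_gammaPDFReal _ _).comp (by fun_prop)) ((measurable_gammaPDFReal _ _).comp (by fun_prop))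
  have h7 : Measurable fun v : mdl.Latent => ∏ i, cnPDF 0 (1 / v.2.2.1 i) (v.1 i) := by
    unfold cnPDF; fun_prop
  have h8 : Measurable fun v : mdl.Latent => ∏ j, cnPDF 0 (mdl.dataVar j) (v.2.1 j) := by
    unfold cnPDF; fun_prop
  have h9 : Measurable fun v : mdl.Latent => gammaPDFReal mdl.c mdl.d v.2.2.2.2 :=
    (measurable_gammaPDFReal _ _).comp (by fun_prop)
  have h10 : Measurable fun v : mdl.Latent =>
      ∏ o, cnPDF ((mdl.A v.2.1 *ᵥ v.1) o) (1 / v.2.2.2.2) (mdl.y o) := by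
    unfold cnPDF
    refine Finset.measurable_fun_prod _ fun o _ => ?_
    have := h1 o
    have h11 : Measurable fun v : mdl.Latent => v.2.2.2.2 := by fun_prop
    exact ((measurable_const.mul (measurable_const.div h11)).inv).mul
      (((((measurable_const.sub this).norm).pow_const 2).div (measurable_const.div h11)).neg.exp)
  exact ((((h5.mul h6).mul h7).mul h8).mul h9).mul h10

/-! ### The logarithm of the density ratio -/

/-- The number of scalar observations. -/
abbrev numObs (_mdl : Model M N K Q Tp Td) : ℕ := (Tp + Td) * M * N

lemma card_obsIdx (mdl : Model M N K Q Tp Td) :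
    Fintype.card (ObsIdx M N Tp Td) = mdl.numObs := by
  simp [ObsIdx, numObs]; ring

namespace Params

/-- The terms of `ellRatio` that involve only `α`. -/
def ellα (θ : mdl.Params) (α : PathIdx K Q → ℂ) : ℝ :=
  ∑ i, (-Real.log (θ.varα i) - ‖α i - θ.muα i‖ ^ 2 / θ.varα i)

/-- The terms of `ellRatio` that involve only `x`. -/
def ellx (θ : mdl.Params) (x : mdl.DataIdx → ℂ) : ℝ :=
  ∑ j, (Real.log (mdl.dataVar j) - Real.log (θ.varx j) + ‖x j‖ ^ 2 / mdl.dataVar j -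
    ‖x j - θ.mux j‖ ^ 2 / θ.varx j)

/-- The terms of `ellRatio` that involve only `ρ`. -/
def ellρ (θ : mdl.Params) (ρ : PathIdx K Q → ℝ) : ℝ :=
  ∑ i, (gammaLog (θ.shapeρ i) (θ.rateρ i) (Real.log (ρ i)) (ρ i) - Real.log (ρ i))

/-- The terms of `ellRatio` that involve only `s`. -/
def ells (θ : mdl.Params) (s : PathIdx K Q → Bool) : ℝ :=
  ∑ i, if s i then Real.log (θ.probs i) - Real.log (mdl.lam i)
    else Real.log (1 - θ.probs i) - Real.log (1 - mdl.lam i)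

/-- The terms of `ellRatio` that involve only `γ`. -/
def ellγ (θ : mdl.Params) (γ : ℝ) : ℝ :=
  gammaLog θ.shapeγ θ.rateγ (Real.log γ) γ - gammaLog mdl.c mdl.d (Real.log γ) γ -
    mdl.numObs * (Real.log γ - Real.log Real.pi)

/-- The logarithm of the ratio of the density of the variational posterior to the joint density
`p(v, y)`, on the set where both are positive. -/
def ellRatio (θ : mdl.Params) (v : mdl.Latent) : ℝ :=
  θ.ellα v.1 + θ.ellx v.2.1 + θ.ellρ v.2.2.1 + θ.ells v.2.2.2.1 + θ.ellγ v.2.2.2.2 -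
    ∑ i, ((if v.2.2.2.1 i then 1 else 0) *
        gammaLog (mdl.a i) (mdl.b i) (Real.log (v.2.2.1 i)) (v.2.2.1 i) +
      (1 - (if v.2.2.2.1 i then 1 else 0)) *
        gammaLog (mdl.abar i) (mdl.bbar i) (Real.log (v.2.2.1 i)) (v.2.2.1 i)) +
    ∑ i, v.2.2.1 i * ‖v.1 i‖ ^ 2 + v.2.2.2.2 * mdl.residual v.1 v.2.1

/-- The density of the variational posterior. -/
def pdf (θ : mdl.Params) (v : mdl.Latent) : ℝ :=
  (∏ i, cnPDF (θ.muα i) (θ.varα i) (v.1 i)) *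
  ((∏ j, cnPDF (θ.mux j) (θ.varx j) (v.2.1 j)) *
  ((∏ i, gammaPDFReal (θ.shapeρ i) (θ.rateρ i) (v.2.2.1 i)) *
  ((∏ i, if v.2.2.2.1 i then θ.probs i else 1 - θ.probs i) *
  gammaPDFReal θ.shapeγ θ.rateγ v.2.2.2.2)))

/-- The variational posterior charges only supports of positive prior probability. -/
def Compatible (θ : mdl.Params) : Prop :=
  ∀ i, (mdl.lam i = 0 → θ.probs i = 0) ∧ (mdl.lam i = 1 → θ.probs i = 1)

end Params

namespace Factors

/-- The product of the five factors. -/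
def prod (q : mdl.Factors) : Measure mdl.Latent :=
  q.qα.prod (q.qx.prod (q.qρ.prod (q.qs.prod q.qγ)))

lemma kld_eq (q : mdl.Factors) : mdl.kld q = InformationTheory.klDiv q.prod mdl.posterior := rfl

/-- The factors are probability laws. -/
structure IsProb (q : mdl.Factors) : Prop where
  α : IsProbabilityMeasure q.qα
  x : IsProbabilityMeasure q.qx
  ρ : IsProbabilityMeasure q.qρ
  s : IsProbabilityMeasure q.qs
  γ : IsProbabilityMeasure q.qγ

/-- The factors are probability laws with the moments that occur in the divergence. -/
structure HasMoments (q : mdl.Factors) : Prop extends q.IsProb where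
  memLp_α : ∀ i, MemLp (fun α => α i) 2 q.qα
  memLp_x : ∀ j, MemLp (fun x => x j) 2 q.qx
  int_ρ : ∀ i, Integrable (fun ρ => ρ i) q.qρ
  int_log_ρ : ∀ i, Integrable (fun ρ => Real.log (ρ i)) q.qρ
  int_γ : Integrable (fun γ => γ) q.qγ
  int_log_γ : Integrable Real.log q.qγ

section Projections

variable {q : mdl.Factors}

lemma IsProb.prod (h : q.IsProb) : IsProbabilityMeasure q.prod := by
  have := h.α; have := h.x; have := h.ρ; have := h.s; have := h.γ
  unfold Factors.prod; infer_instance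

lemma IsProb.proj_α (h : q.IsProb) : MeasurePreserving (fun v : mdl.Latent => v.1) q.prod q.qα := by
  have := h.α; have := h.x; have := h.ρ; have := h.s; have := h.γ
  exact measurePreserving_fst

lemma IsProb.proj_x (h : q.IsProb) :
    MeasurePreserving (fun v : mdl.Latent => v.2.1) q.prod q.qx := by
  have := h.α; have := h.x; have := h.ρ; have := h.s; have := h.γ
  exact measurePreserving_fst.comp measurePreserving_snd

lemma IsProb.proj_ρ (h : q.IsProb) :
    MeasurePreserving (fun v : mdl.Latent => v.2.2.1) q.prod q.qρ := by
  have := h.α; have := h.x; have := h.ρ; have := h.s; have := h.γ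
  exact measurePreserving_fst.comp (measurePreserving_snd.comp measurePreserving_snd)

lemma IsProb.proj_s (h : q.IsProb) :
    MeasurePreserving (fun v : mdl.Latent => v.2.2.2.1) q.prod q.qs := by
  have := h.α; have := h.x; have := h.ρ; have := h.s; have := h.γ
  exact measurePreserving_fst.comp
    (measurePreserving_snd.comp (measurePreserving_snd.comp measurePreserving_snd))

lemma IsProb.proj_γ (h : q.IsProb) :
    MeasurePreserving (fun v : mdl.Latent => v.2.2.2.2) q.prod q.qγ := by
  have := h.α; have := h.x; have := h.ρ; have := h.s; have := h.γ
  exact measurePreserving_snd.comp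
    (measurePreserving_snd.comp (measurePreserving_snd.comp measurePreserving_snd))

/-- The log density ratio couples `s` with `ρ`, `ρ` with `α`, and `γ` with the pair `(α, x)`. The
marginals on these groups are again product laws, so the expectations of the coupling terms factor.
-/
lemma IsProb.proj_sρ (h : q.IsProb) :
    MeasurePreserving (fun v : mdl.Latent => (v.2.2.2.1, v.2.2.1)) q.prod (q.qs.prod q.qρ) := by
  have := h.α; have := h.x; have := h.ρ; have := h.s; have := h.γ
  exact Measure.measurePreserving_swap.comp (((MeasurePreserving.id q.qρ).prod
    (measurePreserving_fst (μ := q.qs) (ν := q.qγ))).comp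
    (measurePreserving_snd.comp measurePreserving_snd))

lemma IsProb.proj_ρα (h : q.IsProb) :
    MeasurePreserving (fun v : mdl.Latent => (v.2.2.1, v.1)) q.prod (q.qρ.prod q.qα) := by
  have := h.α; have := h.x; have := h.ρ; have := h.s; have := h.γ
  exact Measure.measurePreserving_swap.comp ((MeasurePreserving.id q.qα).prod
    (measurePreserving_fst.comp measurePreserving_snd))

lemma IsProb.proj_γαx (h : q.IsProb) :
    MeasurePreserving (fun v : mdl.Latent => (v.2.2.2.2, (v.1, v.2.1))) q.prod
      (q.qγ.prod (q.qα.prod q.qx)) := by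
  have := h.α; have := h.x; have := h.ρ; have := h.s; have := h.γ
  exact Measure.measurePreserving_swap.comp ((measurePreserving_prodAssoc q.qα q.qx q.qγ).symm.comp
    ((MeasurePreserving.id q.qα).prod ((MeasurePreserving.id q.qx).prod
      (measurePreserving_snd.comp measurePreserving_snd))))

end Projections

end Factors

end Model

lemma log_cnPDF (mu z : ℂ) {v : ℝ} (hv : 0 < v) :
    Real.log (cnPDF mu v z) = -Real.log Real.pi - Real.log v - ‖z - mu‖ ^ 2 / v := by
  have := Real.pi_pos
  rw [cnPDF, Real.log_mul (by positivity) (by positivity), Real.log_inv,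
    Real.log_mul this.ne' hv.ne', Real.log_exp]
  ring

lemma log_cnPDF_one_div (mu z : ℂ) {r : ℝ} (hr : 0 < r) :
    Real.log (cnPDF mu (1 / r) z) = -Real.log Real.pi + Real.log r - r * ‖z - mu‖ ^ 2 := by
  rw [log_cnPDF mu z (by positivity), one_div, Real.log_inv]
  field_simp
  ring

lemma ae_bernoulliMeasure_pos {l : ℝ} (hl : l ∈ Set.Icc (0 : ℝ) 1) :
    ∀ᵐ s ∂bernoulliMeasure l, 0 < if s then l else 1 - l := by
  have := hl
  rw [bernoulliMeasure_eq_withDensity, ae_withDensity_iff (by exact Measurable.of_discrete)]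
  exact ae_of_all _ fun s hs => by simpa using hs

namespace Model

variable {mdl : Model M N K Q Tp Td}

lemma dataVar_pos (mdl : Model M N K Q Tp Td) (j : mdl.DataIdx) : 0 < mdl.dataVar j :=
  mdl.power_pos _ _ _ j.2.2

namespace Params

variable {θ : mdl.Params}

lemma Valid.isProb (h : θ.Valid) : θ.toFactors.IsProb where
  α := isProbabilityMeasure_cnVec _ h.varα_pos
  x := isProbabilityMeasure_cnVec _ h.varx_pos
  ρ := by
    have := fun i => isProbabilityMeasure_gammaMeasure (h.shapeρ_pos i) (h.rateρ_pos i)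
    exact Measure.pi.instIsProbabilityMeasure _
  s := by
    have := fun i => isProbabilityMeasure_bernoulliMeasure (h.probs_mem i)
    exact Measure.pi.instIsProbabilityMeasure _
  γ := isProbabilityMeasure_gammaMeasure h.shapeγ_pos h.rateγ_pos

lemma Valid.evalρ (h : θ.Valid) (i : PathIdx K Q) :
    MeasurePreserving (fun ρ => ρ i) θ.toFactors.qρ
      (gammaMeasure (θ.shapeρ i) (θ.rateρ i)) := by
  have := fun i => isProbabilityMeasure_gammaMeasure (h.shapeρ_pos i) (h.rateρ_pos i)
  exact measurePreserving_eval (fun i => gammaMeasure (θ.shapeρ i) (θ.rateρ i)) i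

lemma Valid.evals (h : θ.Valid) (i : PathIdx K Q) :
    MeasurePreserving (fun s => s i) θ.toFactors.qs (bernoulliMeasure (θ.probs i)) := by
  have := fun i => isProbabilityMeasure_bernoulliMeasure (h.probs_mem i)
  exact measurePreserving_eval (fun i => bernoulliMeasure (θ.probs i)) i

lemma Valid.hasMoments (h : θ.Valid) : θ.toFactors.HasMoments where
  toIsProb := h.isProb
  memLp_α := memLp_eval_cnVec _ h.varα_pos
  memLp_x := memLp_eval_cnVec _ h.varx_pos
  int_ρ i := ((h.evalρ i).integrable_comp (by fun_prop)).mpr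
    (integrable_id_gammaMeasure (h.shapeρ_pos i) (h.rateρ_pos i))
  int_log_ρ i := ((h.evalρ i).integrable_comp (by fun_prop)).mpr
    (integrable_log_gammaMeasure (h.shapeρ_pos i) (h.rateρ_pos i))
  int_γ := integrable_id_gammaMeasure h.shapeγ_pos h.rateγ_pos
  int_log_γ := integrable_log_gammaMeasure h.shapeγ_pos h.rateγ_pos

lemma Valid.ae_ρ_pos (h : θ.Valid) : ∀ᵐ ρ ∂θ.toFactors.qρ, ∀ i, 0 < ρ i :=
  ae_all_iff.mpr fun i => (h.evalρ i).quasiMeasurePreserving.ae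
    (ae_pos_gammaMeasure (θ.shapeρ i) (θ.rateρ i))

lemma Valid.ae_s_pos (h : θ.Valid) :
    ∀ᵐ s ∂θ.toFactors.qs, ∀ i, 0 < if s i then θ.probs i else 1 - θ.probs i :=
  ae_all_iff.mpr fun i => (h.evals i).quasiMeasurePreserving.ae
    (ae_bernoulliMeasure_pos (h.probs_mem i))

lemma Valid.ae_pos (h : θ.Valid) : ∀ᵐ v ∂θ.toFactors.prod, (∀ i, 0 < v.2.2.1 i) ∧
    (∀ i, 0 < if v.2.2.2.1 i then θ.probs i else 1 - θ.probs i) ∧ 0 < v.2.2.2.2 := by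
  filter_upwards [h.isProb.proj_ρ.quasiMeasurePreserving.ae h.ae_ρ_pos,
    h.isProb.proj_s.quasiMeasurePreserving.ae h.ae_s_pos,
    h.isProb.proj_γ.quasiMeasurePreserving.ae (ae_pos_gammaMeasure θ.shapeγ θ.rateγ)]
    with v h1 h2 h3
  exact ⟨h1, h2, h3⟩

lemma measurable_pdf (θ : mdl.Params) : Measurable θ.pdf := by
  have h4 : ∀ i, MeasurableSet {v : mdl.Latent | v.2.2.2.1 i = true} := fun i =>
    (measurableSet_singleton true).preimage (by fun_prop)
  have h5 : Measurable fun v : mdl.Latent =>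
      ∏ i, if v.2.2.2.1 i then θ.probs i else 1 - θ.probs i :=
    Finset.measurable_fun_prod _ fun i _ => Measurable.ite (h4 i) measurable_const measurable_const
  have h6 : Measurable fun v : mdl.Latent =>
      ∏ i, gammaPDFReal (θ.shapeρ i) (θ.rateρ i) (v.2.2.1 i) :=
    Finset.measurable_fun_prod _ fun i _ => (measurable_gammaPDFReal _ _).comp (by fun_prop)
  have h7 : Measurable fun v : mdl.Latent => ∏ i, cnPDF (θ.muα i) (θ.varα i) (v.1 i) := by
    unfold cnPDF; fun_prop
  have h8 : Measurable fun v : mdl.Latent => ∏ j, cnPDF (θ.mux j) (θ.varx j) (v.2.1 j) := by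
    unfold cnPDF; fun_prop
  have h9 : Measurable fun v : mdl.Latent => gammaPDFReal θ.shapeγ θ.rateγ v.2.2.2.2 :=
    (measurable_gammaPDFReal _ _).comp (by fun_prop)
  exact h7.mul (h8.mul (h6.mul (h5.mul h9)))

lemma Valid.qρ_eq_withDensity (h : θ.Valid) : θ.toFactors.qρ = volume.withDensity fun ρ =>
    ENNReal.ofReal (∏ i, gammaPDFReal (θ.shapeρ i) (θ.rateρ i) (ρ i)) :=
  pi_withDensity_ofReal (fun _ => volume) _
    (fun i => integrable_gammaPDFReal (h.shapeρ_pos i) (h.rateρ_pos i))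
    fun i => gammaPDFReal_nonneg (h.shapeρ_pos i) (h.rateρ_pos i)

lemma Valid.probs_nonneg (h : θ.Valid) (i : PathIdx K Q) (s : Bool) :
    0 ≤ if s then θ.probs i else 1 - θ.probs i := by
  have := h.probs_mem i
  split_ifs
  · exact this.1
  · linarith [this.2]

lemma Valid.qs_eq_withDensity (h : θ.Valid) : θ.toFactors.qs = Measure.count.withDensity fun s =>
    ENNReal.ofReal (∏ i, if s i then θ.probs i else 1 - θ.probs i) := by
  have h1 := pi_withDensity_ofReal (fun _ : PathIdx K Q => (Measure.count : Measure Bool))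
    (fun i s => if s then θ.probs i else 1 - θ.probs i) (fun i => Integrable.of_finite)
    (fun i s => h.probs_nonneg i s)
  rw [pi_count] at h1
  simp only [toFactors, bernoulliMeasure_eq_withDensity]
  exact h1

lemma Valid.prod_eq_withDensity (h : θ.Valid) :
    θ.toFactors.prod = mdl.refMeasure.withDensity fun v => ENNReal.ofReal (θ.pdf v) := by
  have hs : Measurable fun s : PathIdx K Q → Bool =>
      ENNReal.ofReal (∏ i, if s i then θ.probs i else 1 - θ.probs i) := Measurable.of_discrete
  have hρ : Measurable fun ρ : PathIdx K Q → ℝ =>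
      ENNReal.ofReal (∏ i, gammaPDFReal (θ.shapeρ i) (θ.rateρ i) (ρ i)) := by
    refine ENNReal.measurable_ofReal.comp (Finset.measurable_fun_prod _ fun i _ => ?_)
    exact (measurable_gammaPDFReal _ _).comp (by fun_prop)
  have hγ : Measurable fun γ : ℝ => ENNReal.ofReal (gammaPDFReal θ.shapeγ θ.rateγ γ) := by fun_prop
  have hx : Measurable fun x : mdl.DataIdx → ℂ =>
      ENNReal.ofReal (∏ j, cnPDF (θ.mux j) (θ.varx j) (x j)) := by unfold cnPDF; fun_prop
  have hα : Measurable fun α : PathIdx K Q → ℂ =>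
      ENNReal.ofReal (∏ j, cnPDF (θ.muα j) (θ.varα j) (α j)) := by unfold cnPDF; fun_prop
  have h1 := (hs.comp measurable_fst).mul (hγ.comp measurable_snd)
  have h2 := (hρ.comp measurable_fst).mul (h1.comp measurable_snd)
  have h3 := (hx.comp measurable_fst).mul (h2.comp measurable_snd)
  have e1 : θ.toFactors.qα = _ := cnVec_eq_withDensity θ.muα h.varα_pos
  have e2 : θ.toFactors.qx = _ := cnVec_eq_withDensity θ.mux h.varx_pos
  have e3 : θ.toFactors.qγ = _ := gammaMeasure_eq_withDensity θ.shapeγ θ.rateγ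
  rw [Factors.prod, e1, e2, h.qρ_eq_withDensity, h.qs_eq_withDensity, e3,
    prod_withDensity hs hγ, prod_withDensity hρ ?_, prod_withDensity hx ?_,
    prod_withDensity hα ?_, refMeasure]
  rotate_left
  · exact h3
  · exact h2
  · exact h1
  congr 1
  funext v
  have n1 := Finset.prod_nonneg fun i (_ : i ∈ Finset.univ) => cnPDF_nonneg (h.varα_pos i).le
    (θ.muα i) (v.1 i)
  have n2 := Finset.prod_nonneg fun i (_ : i ∈ Finset.univ) => cnPDF_nonneg (h.varx_pos i).le
    (θ.mux i) (v.2.1 i)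
  have n3 := Finset.prod_nonneg fun i (_ : i ∈ Finset.univ) => gammaPDFReal_nonneg
    (h.shapeρ_pos i) (h.rateρ_pos i) (v.2.2.1 i)
  have n4 := Finset.prod_nonneg fun i (_ : i ∈ Finset.univ) => h.probs_nonneg i (v.2.2.2.1 i)
  rw [pdf, ENNReal.ofReal_mul n1, ENNReal.ofReal_mul n2, ENNReal.ofReal_mul n3,
    ENNReal.ofReal_mul n4]

lemma Compatible.lam_pos (hc : θ.Compatible) (i : PathIdx K Q) (s : Bool)
    (hs : 0 < if s then θ.probs i else 1 - θ.probs i) :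
    0 < if s then mdl.lam i else 1 - mdl.lam i := by
  have hl := mdl.lam_mem i
  have h := hc i
  cases s
  · simp only [Bool.false_eq_true, if_false] at hs ⊢
    rcases hl.2.lt_or_eq with h1 | h1
    · linarith
    · linarith [h.2 h1]
  · simp only [if_true] at hs ⊢
    rcases hl.1.lt_or_eq with h1 | h1
    · exact h1
    · linarith [h.1 h1.symm]

lemma jointPDF_pos {v : mdl.Latent} (hρ : ∀ i, 0 < v.2.2.1 i)
    (hs : ∀ i, 0 < if v.2.2.2.1 i then mdl.lam i else 1 - mdl.lam i) (hγ : 0 < v.2.2.2.2) :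
    0 < mdl.jointPDF v := by
  obtain ⟨α, x, ρ, s, γ⟩ := v
  simp only at hρ hs hγ
  rw [jointPDF]
  refine mul_pos (mul_pos (mul_pos (mul_pos (mul_pos ?_ ?_) ?_) ?_) ?_) ?_
  · exact Finset.prod_pos fun i _ => hs i
  · refine Finset.prod_pos fun i _ => ?_
    split_ifs
    · exact gammaPDFReal_pos (mdl.a_pos i) (mdl.b_pos i) (hρ i)
    · exact gammaPDFReal_pos (mdl.abar_pos i) (mdl.bbar_pos i) (hρ i)
  · exact Finset.prod_pos fun i _ => cnPDF_pos (one_div_pos.mpr (hρ i)) _ _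
  · exact Finset.prod_pos fun i _ => cnPDF_pos (mdl.dataVar_pos i) _ _
  · exact gammaPDFReal_pos mdl.c_pos mdl.d_pos hγ
  · exact Finset.prod_pos fun i _ => cnPDF_pos (one_div_pos.mpr hγ) _ _

lemma log_jointPDF {v : mdl.Latent} (hρ : ∀ i, 0 < v.2.2.1 i)
    (hs : ∀ i, 0 < if v.2.2.2.1 i then mdl.lam i else 1 - mdl.lam i) (hγ : 0 < v.2.2.2.2) :
    Real.log (mdl.jointPDF v) =
      (∑ i, if v.2.2.2.1 i then Real.log (mdl.lam i) else Real.log (1 - mdl.lam i)) +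
      (∑ i, ((if v.2.2.2.1 i then 1 else 0) *
        gammaLog (mdl.a i) (mdl.b i) (Real.log (v.2.2.1 i)) (v.2.2.1 i) +
      (1 - (if v.2.2.2.1 i then 1 else 0)) *
        gammaLog (mdl.abar i) (mdl.bbar i) (Real.log (v.2.2.1 i)) (v.2.2.1 i))) +
      (∑ i, (-Real.log Real.pi + Real.log (v.2.2.1 i) - v.2.2.1 i * ‖v.1 i‖ ^ 2)) +
      (∑ j, (-Real.log Real.pi - Real.log (mdl.dataVar j) - ‖v.2.1 j‖ ^ 2 / mdl.dataVar j)) +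
      gammaLog mdl.c mdl.d (Real.log v.2.2.2.2) v.2.2.2.2 +
      (mdl.numObs * (Real.log v.2.2.2.2 - Real.log Real.pi) -
        v.2.2.2.2 * mdl.residual v.1 v.2.1) := by
  have hpos := jointPDF_pos hρ hs hγ
  obtain ⟨α, x, ρ, s, γ⟩ := v
  simp only at hρ hs hγ
  rw [jointPDF] at hpos ⊢
  -- The nonvanishing of each factor, needed to split the logarithm, is read off from the positivity
  -- of the whole product.
  have p5 := left_ne_zero_of_mul hpos.ne'
  have p4 := left_ne_zero_of_mul p5
  have p3 := left_ne_zero_of_mul p4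
  have p2 := left_ne_zero_of_mul p3
  rw [Real.log_mul p5 (right_ne_zero_of_mul hpos.ne'), Real.log_mul p4 (right_ne_zero_of_mul p5),
    Real.log_mul p3 (right_ne_zero_of_mul p4), Real.log_mul p2 (right_ne_zero_of_mul p3),
    Real.log_mul (left_ne_zero_of_mul p2) (right_ne_zero_of_mul p2),
    Real.log_prod (fun i _ => (hs i).ne'),
    Real.log_prod (fun i _ => Finset.prod_ne_zero_iff.mp (right_ne_zero_of_mul p2) i
      (Finset.mem_univ i)),
    Real.log_prod (fun i _ => (cnPDF_pos (one_div_pos.mpr (hρ i)) _ _).ne'),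
    Real.log_prod (fun i _ => (cnPDF_pos (mdl.dataVar_pos i) _ _).ne'),
    Real.log_prod (fun i _ => (cnPDF_pos (one_div_pos.mpr hγ) _ _).ne')]
  congr 1
  · congr 1
    · congr 1
      · congr 1
        · congr 1
          · refine Finset.sum_congr rfl fun i _ => ?_
            split_ifs <;> rfl
          · refine Finset.sum_congr rfl fun i _ => ?_
            split_ifs
            · rw [gammaPDFReal_eq_exp (mdl.a_pos i) (mdl.b_pos i) (hρ i), gammaLog]; ring
            · rw [gammaPDFReal_eq_exp (mdl.abar_pos i) (mdl.bbar_pos i) (hρ i)]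
              simp only [gammaLog]; ring
        · refine Finset.sum_congr rfl fun i _ => ?_
          rw [log_cnPDF_one_div _ _ (hρ i), sub_zero]
      · refine Finset.sum_congr rfl fun i _ => ?_
        rw [log_cnPDF _ _ (mdl.dataVar_pos i), sub_zero]
    · exact gammaPDFReal_eq_exp mdl.c_pos mdl.d_pos hγ
  · simp_rw [log_cnPDF_one_div _ _ hγ]
    rw [Finset.sum_sub_distrib, ← Finset.mul_sum, Finset.sum_const, Finset.card_univ,
      card_obsIdx, residual, nsmul_eq_mul]
    ring

lemma Valid.log_pdf (h : θ.Valid) {v : mdl.Latent} (hρ : ∀ i, 0 < v.2.2.1 i)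
    (hs : ∀ i, 0 < if v.2.2.2.1 i then θ.probs i else 1 - θ.probs i) (hγ : 0 < v.2.2.2.2) :
    0 < θ.pdf v ∧ Real.log (θ.pdf v) =
      (∑ i, (-Real.log Real.pi - Real.log (θ.varα i) - ‖v.1 i - θ.muα i‖ ^ 2 / θ.varα i)) +
      ((∑ j, (-Real.log Real.pi - Real.log (θ.varx j) - ‖v.2.1 j - θ.mux j‖ ^ 2 / θ.varx j)) +
      ((∑ i, gammaLog (θ.shapeρ i) (θ.rateρ i) (Real.log (v.2.2.1 i)) (v.2.2.1 i)) +
      ((∑ i, if v.2.2.2.1 i then Real.log (θ.probs i) else Real.log (1 - θ.probs i)) +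
      gammaLog θ.shapeγ θ.rateγ (Real.log v.2.2.2.2) v.2.2.2.2))) := by
  have n1 := Finset.prod_pos fun i (_ : i ∈ Finset.univ) => cnPDF_pos (h.varα_pos i)
    (θ.muα i) (v.1 i)
  have n2 := Finset.prod_pos fun i (_ : i ∈ Finset.univ) => cnPDF_pos (h.varx_pos i)
    (θ.mux i) (v.2.1 i)
  have n3 := Finset.prod_pos fun i (_ : i ∈ Finset.univ) => gammaPDFReal_pos
    (h.shapeρ_pos i) (h.rateρ_pos i) (hρ i)
  have n4 := Finset.prod_pos fun i (_ : i ∈ Finset.univ) => hs i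
  have n5 := gammaPDFReal_pos h.shapeγ_pos h.rateγ_pos hγ
  refine ⟨mul_pos n1 (mul_pos n2 (mul_pos n3 (mul_pos n4 n5))), ?_⟩
  rw [pdf, Real.log_mul n1.ne' (by positivity), Real.log_mul n2.ne' (by positivity),
    Real.log_mul n3.ne' (by positivity), Real.log_mul n4.ne' n5.ne',
    Real.log_prod (fun i _ => (cnPDF_pos (h.varα_pos i) _ _).ne'),
    Real.log_prod (fun i _ => (cnPDF_pos (h.varx_pos i) _ _).ne'),
    Real.log_prod (fun i _ => (gammaPDFReal_pos (h.shapeρ_pos i) (h.rateρ_pos i) (hρ i)).ne'),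
    Real.log_prod (fun i _ => (hs i).ne')]
  congr 1
  · exact Finset.sum_congr rfl fun i _ => log_cnPDF _ _ (h.varα_pos i)
  congr 1
  · exact Finset.sum_congr rfl fun i _ => log_cnPDF _ _ (h.varx_pos i)
  congr 1
  · exact Finset.sum_congr rfl fun i _ =>
      gammaPDFReal_eq_exp (h.shapeρ_pos i) (h.rateρ_pos i) (hρ i)
  congr 1
  · refine Finset.sum_congr rfl fun i _ => ?_
    split_ifs <;> rfl
  · exact gammaPDFReal_eq_exp h.shapeγ_pos h.rateγ_pos hγ

/-- The terms `ln π` of `α` and `x` cancel between the variational law and the prior. The term `ln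
ρ_i` of `p(α ∣ ρ)` is booked in `ellρ`, and the powers of `γ` from the likelihood are booked in
`ellγ`. -/
lemma Valid.log_pdf_div_jointPDF (h : θ.Valid) (hc : θ.Compatible) {v : mdl.Latent}
    (hρ : ∀ i, 0 < v.2.2.1 i)
    (hs : ∀ i, 0 < if v.2.2.2.1 i then θ.probs i else 1 - θ.probs i) (hγ : 0 < v.2.2.2.2) :
    Real.log (θ.pdf v / mdl.jointPDF v) = θ.ellRatio v := by
  have hs' := fun i => hc.lam_pos i _ (hs i)
  obtain ⟨h1, h2⟩ := h.log_pdf hρ hs hγ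
  rw [Real.log_div h1.ne' (jointPDF_pos hρ hs' hγ).ne', h2, log_jointPDF hρ hs' hγ]
  have e : ∀ i, (if v.2.2.2.1 i then Real.log (θ.probs i) - Real.log (mdl.lam i)
      else Real.log (1 - θ.probs i) - Real.log (1 - mdl.lam i)) =
      (if v.2.2.2.1 i then Real.log (θ.probs i) else Real.log (1 - θ.probs i)) -
      (if v.2.2.2.1 i then Real.log (mdl.lam i) else Real.log (1 - mdl.lam i)) := fun i => by
    split_ifs <;> rfl
  simp only [ellRatio, ellα, ellx, ellρ, ells, ellγ, e]
  simp only [Finset.sum_add_distrib, Finset.sum_sub_distrib, Finset.sum_neg_distrib]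
  ring

end Params

end Model

/-! ### Integrable functions together with the value of the integral -/

/-- `f` is integrable and has the integral `c`. -/
def HasMean {Ω E : Type*} [MeasurableSpace Ω] [NormedAddCommGroup E] [NormedSpace ℝ E]
    (f : Ω → E) (μ : Measure Ω) (c : E) : Prop :=
  Integrable f μ ∧ ∫ v, f v ∂μ = c

namespace HasMean

variable {Ω Ω' E 𝕜 ι : Type*} [MeasurableSpace Ω] [MeasurableSpace Ω'] [NormedAddCommGroup E]
  [NormedSpace ℝ E] [RCLike 𝕜] {μ : Measure Ω} {ν : Measure Ω'}

lemma _root_.MeasureTheory.Integrable.hasMean {f : Ω → E} (h : Integrable f μ) :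
    HasMean f μ (∫ v, f v ∂μ) := ⟨h, rfl⟩

lemma const [CompleteSpace E] [IsProbabilityMeasure μ] (c : E) : HasMean (fun _ => c) μ c :=
  ⟨integrable_const c, by simp⟩

lemma add {f g : Ω → E} {c d : E} (hf : HasMean f μ c) (hg : HasMean g μ d) :
    HasMean (fun v => f v + g v) μ (c + d) :=
  ⟨hf.1.add hg.1, by rw [integral_add hf.1 hg.1, hf.2, hg.2]⟩

lemma sub {f g : Ω → E} {c d : E} (hf : HasMean f μ c) (hg : HasMean g μ d) :
    HasMean (fun v => f v - g v) μ (c - d) :=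
  ⟨hf.1.sub hg.1, by rw [integral_sub hf.1 hg.1, hf.2, hg.2]⟩

lemma sum [Fintype ι] {f : ι → Ω → E} {c : ι → E} (hf : ∀ i, HasMean (f i) μ (c i)) :
    HasMean (fun v => ∑ i, f i v) μ (∑ i, c i) :=
  ⟨integrable_finsetSum _ fun i _ => (hf i).1, by
    rw [integral_finsetSum _ fun i _ => (hf i).1]
    exact Finset.sum_congr rfl fun i _ => (hf i).2⟩

lemma const_mul {f : Ω → 𝕜} {c : 𝕜} (hf : HasMean f μ c) (a : 𝕜) :
    HasMean (fun v => a * f v) μ (a * c) :=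
  ⟨hf.1.const_mul a, by rw [integral_const_mul, hf.2]⟩

lemma mul_const {f : Ω → 𝕜} {c : 𝕜} (hf : HasMean f μ c) (a : 𝕜) :
    HasMean (fun v => f v * a) μ (c * a) :=
  ⟨hf.1.mul_const a, by rw [integral_mul_const, hf.2]⟩

lemma div_const {f : Ω → 𝕜} {c : 𝕜} (hf : HasMean f μ c) (a : 𝕜) :
    HasMean (fun v => f v / a) μ (c / a) := by
  simp only [div_eq_mul_inv]; exact hf.mul_const _

lemma re {f : Ω → ℂ} {c : ℂ} (hf : HasMean f μ c) : HasMean (fun v => (f v).re) μ c.re :=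
  ⟨hf.1.re, by rw [← hf.2]; exact integral_re hf.1⟩

lemma star {f : Ω → ℂ} {c : ℂ} (hf : HasMean f μ c) :
    HasMean (fun v => Star.star (f v)) μ (Star.star c) :=
  ⟨(LinearIsometryEquiv.integrable_comp_iff Complex.conjLIE).mpr hf.1, by
    rw [← hf.2]; exact integral_conj⟩

lemma prod_mul [SFinite μ] [SFinite ν] {f : Ω → 𝕜} {g : Ω' → 𝕜} {c d : 𝕜}
    (hf : HasMean f μ c) (hg : HasMean g ν d) :
    HasMean (fun p : Ω × Ω' => f p.1 * g p.2) (μ.prod ν) (c * d) :=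
  ⟨hf.1.mul_prod hg.1, by rw [integral_prod_mul, hf.2, hg.2]⟩

lemma comp {f : Ω' → E} {c : E} (hf : HasMean f ν c) {g : Ω → Ω'} (hg : MeasurePreserving g μ ν) :
    HasMean (fun v => f (g v)) μ c :=
  ⟨(hg.integrable_comp hf.1.aestronglyMeasurable).mpr hf.1, by
    rw [hg.integral_comp_of_aestronglyMeasurable hf.1.aestronglyMeasurable, hf.2]⟩

lemma congr {f g : Ω → E} {c d : E} (hf : HasMean f μ c) (h : ∀ v, g v = f v) (hcd : d = c) :
    HasMean g μ d := by
  rw [funext h, hcd]; exact hf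

end HasMean

/-! ### Expected squared residuals of bilinear models -/

lemma integrable_conjTranspose_mul {Ω m n : Type} [MeasurableSpace Ω] [Fintype m] {P : Measure Ω}
    {G : Ω → Matrix m n ℂ} (hG : ∀ i j, MemLp (fun ω => G ω i j) 2 P) (i j : n) :
    Integrable (fun ω => ((G ω)ᴴ * G ω) i j) P := by
  simp only [Matrix.mul_apply, Matrix.conjTranspose_apply]
  exact integrable_finsetSum _ fun o _ => (hG o i).star.integrable_mul (hG o j)

section Bilinear

variable {Ω Ω' m n : Type} [MeasurableSpace Ω] [MeasurableSpace Ω'] [Fintype n]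
  {P : Measure Ω} {P' : Measure Ω'} [IsProbabilityMeasure P] [IsProbabilityMeasure P']
  {G : Ω → Matrix m n ℂ} {U : Ω' → n → ℂ}

/-- A product of two square integrable functions of independent variables is square integrable,
since its squared norm is a product of integrable functions of separate variables; no fourth moments
are needed. -/
lemma integrable_sq_norm_sub_mulVec (hG : ∀ i j, MemLp (fun ω => G ω i j) 2 P)
    (hU : ∀ i, MemLp (fun ω => U ω i) 2 P') (y : m → ℂ) (o : m) :
    Integrable (fun p : Ω' × Ω => ‖y o - (G p.2 *ᵥ U p.1) o‖ ^ 2) (P'.prod P) := by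
  have h1 : ∀ i, MemLp (fun p : Ω' × Ω => G p.2 o i * U p.1 i) 2 (P'.prod P) := by
    intro i
    have hm : AEStronglyMeasurable (fun p : Ω' × Ω => G p.2 o i * U p.1 i) (P'.prod P) :=
      (hG o i).aestronglyMeasurable.comp_snd.mul (hU i).aestronglyMeasurable.comp_fst
    rw [memLp_two_iff_integrable_sq_norm hm]
    have := Integrable.mul_prod (((memLp_two_iff_integrable_sq_norm
      (hU i).aestronglyMeasurable).mp (hU i))) (((memLp_two_iff_integrable_sq_norm
      (hG o i).aestronglyMeasurable).mp (hG o i)))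
    refine this.congr (ae_of_all _ fun p => ?_)
    simp only [norm_mul]; ring
  have h2 : MemLp (fun p : Ω' × Ω => y o - (G p.2 *ᵥ U p.1) o) 2 (P'.prod P) := by
    refine (memLp_const (y o)).sub ?_
    simp only [Matrix.mulVec, dotProduct]
    exact memLp_finsetSum _ fun i _ => h1 i
  exact (memLp_two_iff_integrable_sq_norm h2.aestronglyMeasurable).mp h2

variable [Fintype m]

lemma sum_sq_norm_sub_mulVec (y : m → ℂ) (G : Matrix m n ℂ) (u : n → ℂ) :
    ∑ o, ‖y o - (G *ᵥ u) o‖ ^ 2 = ∑ o, ‖y o‖ ^ 2 - 2 * (star u ⬝ᵥ (Gᴴ *ᵥ y)).re +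
      (star u ⬝ᵥ ((Gᴴ * G) *ᵥ u)).re := by
  have h1 : star u ⬝ᵥ (Gᴴ *ᵥ y) = ∑ o, star ((G *ᵥ u) o) * y o := by
    rw [Matrix.dotProduct_mulVec, ← Matrix.star_mulVec]; rfl
  have h2 : star u ⬝ᵥ ((Gᴴ * G) *ᵥ u) = ∑ o, star ((G *ᵥ u) o) * (G *ᵥ u) o := by
    rw [← Matrix.mulVec_mulVec, Matrix.dotProduct_mulVec, ← Matrix.star_mulVec]; rfl
  rw [h1, h2, Complex.re_sum, Complex.re_sum, Finset.mul_sum, ← Finset.sum_sub_distrib,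
    ← Finset.sum_add_distrib]
  refine Finset.sum_congr rfl fun o _ => ?_
  generalize (G *ᵥ u) o = w
  simp only [Complex.sq_norm, Complex.normSq_apply, Complex.sub_re, Complex.sub_im,
    Complex.star_def, Complex.mul_re, Complex.conj_re, Complex.conj_im]
  ring

/-- The expected squared residual when the random matrix `G` and the random vector `U` are
independent, and `U` has the mean `mu` and the covariance matrix `Diag v`. -/
lemma integral_sum_sq_norm_sub_mulVec [DecidableEq n]
    (hG : ∀ i j, MemLp (fun ω => G ω i j) 2 P)
    (hU : ∀ i, MemLp (fun ω => U ω i) 2 P') {mu : n → ℂ} {v : n → ℝ}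
    (hmu : ∀ i, ∫ ω, U ω i ∂P' = mu i)
    (hv : ∀ i j, ∫ ω, star (U ω i) * U ω j ∂P' =
      star (mu i) * mu j + if i = j then (v i : ℂ) else 0) (y : m → ℂ) :
    ∫ p, ∑ o, ‖y o - (G p.2 *ᵥ U p.1) o‖ ^ 2 ∂(P'.prod P) =
      ∑ o, ‖y o‖ ^ 2 - 2 * (star mu ⬝ᵥ ((expect P fun ω => (G ω)ᴴ) *ᵥ y)).re +
        (star mu ⬝ᵥ ((expect P fun ω => (G ω)ᴴ * G ω) *ᵥ mu)).re +
        ∑ i, v i * (expect P (fun ω => (G ω)ᴴ * G ω) i i).re := by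
  have g1 : ∀ i, HasMean (fun ω => ((G ω)ᴴ *ᵥ y) i) P
      (((expect P fun ω => (G ω)ᴴ) *ᵥ y) i) := fun i =>
    HasMean.sum fun o => (((hG o i).star.integrable one_le_two).hasMean).mul_const (y o)
  have g2 : ∀ i j, HasMean (fun ω => ((G ω)ᴴ * G ω) i j) P
      (expect P (fun ω => (G ω)ᴴ * G ω) i j) := fun i j =>
    (integrable_conjTranspose_mul hG i j).hasMean
  have u1 : ∀ i, HasMean (fun ω => star (U ω i)) P' (star (mu i)) := fun i =>
    HasMean.star ⟨(hU i).integrable one_le_two, hmu i⟩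
  have u2 : ∀ i j, HasMean (fun ω => star (U ω i) * U ω j) P'
      (star (mu i) * mu j + if i = j then (v i : ℂ) else 0) := fun i j =>
    ⟨(hU i).star.integrable_mul (hU j), hv i j⟩
  have m1 : HasMean (fun p : Ω' × Ω => star (U p.1) ⬝ᵥ ((G p.2)ᴴ *ᵥ y)) (P'.prod P)
      (star mu ⬝ᵥ ((expect P fun ω => (G ω)ᴴ) *ᵥ y)) :=
    HasMean.sum fun i => (u1 i).prod_mul (g1 i)
  -- The second moment of `U` is a rank-one matrix plus `Diag v`: the former gives the quadratic
  -- form at `mu`, the latter the weighted diagonal of the expected Gram matrix.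
  have m2 : HasMean (fun p : Ω' × Ω => star (U p.1) ⬝ᵥ (((G p.2)ᴴ * G p.2) *ᵥ U p.1)) (P'.prod P)
      (star mu ⬝ᵥ ((expect P fun ω => (G ω)ᴴ * G ω) *ᵥ mu) +
        ∑ i, (v i : ℂ) * expect P (fun ω => (G ω)ᴴ * G ω) i i) := by
    refine (HasMean.sum fun i => HasMean.sum fun j => (u2 i j).prod_mul (g2 i j)).congr ?_ ?_
    · intro p
      simp only [Matrix.mulVec, dotProduct, Finset.mul_sum, Pi.star_apply]
      exact Finset.sum_congr rfl fun i _ => Finset.sum_congr rfl fun j _ => by ring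
    · simp_rw [add_mul, Finset.sum_add_distrib]
      congr 1
      · simp only [Matrix.mulVec, dotProduct, Finset.mul_sum, Pi.star_apply]
        exact Finset.sum_congr rfl fun i _ => Finset.sum_congr rfl fun j _ => by ring
      · refine Finset.sum_congr rfl fun i _ => ?_
        simp
  have key := ((HasMean.const (∑ o, ‖y o‖ ^ 2)).sub (m1.re.const_mul 2)).add m2.re
  simp_rw [sum_sq_norm_sub_mulVec]
  refine key.2.trans ?_
  simp only [Complex.add_re, Complex.re_sum, Complex.re_ofReal_mul]
  ring

end Bilinear

/-! ### Moments of the factors and the expectation of the log density ratio. -/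

namespace Model

variable {mdl : Model M N K Q Tp Td}

lemma memLp_A {q : Measure (mdl.DataIdx → ℂ)} [IsProbabilityMeasure q]
    (hq : ∀ j, MemLp (fun x => x j) 2 q) (o : ObsIdx M N Tp Td) (i : PathIdx K Q) :
    MemLp (fun x => mdl.A x o i) 2 q := by
  rcases o with ⟨t | t, n, m⟩
  · exact memLp_const _
  · by_cases h : i.1 ∈ mdl.users t n
    · simp only [A, Matrix.of_apply, h, dite_true]
      exact (hq _).mul_const _
    · simp only [A, Matrix.of_apply, h, dite_false]
      exact memLp_const _

lemma memLp_Psi {q : Measure (PathIdx K Q → ℂ)} (hq : ∀ j, MemLp (fun α => α j) 2 q)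
    (τ : Fin Td × Fin N) (m : Fin M) (k : {k : Fin K // k ∈ mdl.users τ.1 τ.2}) :
    MemLp (fun α => mdl.Psi τ α m k) 2 q := by
  simp only [Psi, Matrix.of_apply, Matrix.mulVec, dotProduct]
  exact memLp_finsetSum _ fun i _ => (hq _).const_mul _

namespace Factors.HasMoments

variable {q : mdl.Factors}

lemma integrable_residual (h : q.HasMoments) :
    Integrable (fun p => mdl.residual p.1 p.2) (q.qα.prod q.qx) := by
  have := h.α; have := h.x
  exact integrable_finsetSum _ fun o _ =>
    integrable_sq_norm_sub_mulVec (U := id) (memLp_A h.memLp_x) h.memLp_α mdl.y o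

lemma integrable_sq_norm_α (h : q.HasMoments) (i : PathIdx K Q) :
    Integrable (fun α => ‖α i‖ ^ 2) q.qα :=
  (memLp_two_iff_integrable_sq_norm (h.memLp_α i).aestronglyMeasurable).mp (h.memLp_α i)

lemma hasMean_gammaLog (h : q.HasMoments) (a b : ℝ) (i : PathIdx K Q) :
    HasMean (fun ρ => gammaLog a b (Real.log (ρ i)) (ρ i)) q.qρ
      (gammaLog a b (∫ ρ, Real.log (ρ i) ∂q.qρ) (∫ ρ, ρ i ∂q.qρ)) := by
  have := h.ρ
  exact ((HasMean.const _).add ((h.int_log_ρ i).hasMean.const_mul _)).sub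
    ((h.int_ρ i).hasMean.const_mul _)

lemma hasMean_gammaLog_γ (h : q.HasMoments) (a b : ℝ) :
    HasMean (fun γ => gammaLog a b (Real.log γ) γ) q.qγ
      (gammaLog a b (∫ γ, Real.log γ ∂q.qγ) (∫ γ, γ ∂q.qγ)) := by
  have := h.γ
  exact ((HasMean.const _).add (h.int_log_γ.hasMean.const_mul _)).sub
    (h.int_γ.hasMean.const_mul _)

lemma integrable_ellα (h : q.HasMoments) (θ : mdl.Params) : Integrable θ.ellα q.qα := by
  have := h.α
  refine integrable_finsetSum _ fun i _ => (integrable_const _).sub (Integrable.div_const ?_ _)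
  have := (h.memLp_α i).sub (memLp_const (θ.muα i))
  exact (memLp_two_iff_integrable_sq_norm this.aestronglyMeasurable).mp this

lemma integrable_ellx (h : q.HasMoments) (θ : mdl.Params) : Integrable θ.ellx q.qx := by
  have := h.x
  refine integrable_finsetSum _ fun i _ => ((integrable_const _).add
    (Integrable.div_const ?_ _)).sub (Integrable.div_const ?_ _)
  · exact (memLp_two_iff_integrable_sq_norm (h.memLp_x i).aestronglyMeasurable).mp (h.memLp_x i)
  · have := (h.memLp_x i).sub (memLp_const (θ.mux i))
    exact (memLp_two_iff_integrable_sq_norm this.aestronglyMeasurable).mp this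

lemma integrable_ellρ (h : q.HasMoments) (θ : mdl.Params) : Integrable θ.ellρ q.qρ :=
  integrable_finsetSum _ fun i _ => (h.hasMean_gammaLog _ _ i).1.sub (h.int_log_ρ i)

lemma integrable_s (h : q.HasMoments) (f : (PathIdx K Q → Bool) → ℝ) : Integrable f q.qs := by
  have := h.s
  exact Integrable.of_finite

lemma integrable_ellγ (h : q.HasMoments) (θ : mdl.Params) : Integrable θ.ellγ q.qγ := by
  have := h.γ
  exact ((h.hasMean_gammaLog_γ _ _).1.sub (h.hasMean_gammaLog_γ _ _).1).sub
    ((h.int_log_γ.sub (integrable_const _)).const_mul _)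

end Factors.HasMoments

/-- The probability of `s i = true`. -/
def Factors.activity (q : mdl.Factors) (i : PathIdx K Q) : ℝ := ∫ s, (if s i then 1 else 0) ∂q.qs

/-- The expectation of `ellRatio` under a product law, in terms of the moments of the factors. -/
def Params.meanEll (θ : mdl.Params) (q : mdl.Factors) : ℝ :=
  ∫ α, θ.ellα α ∂q.qα + ∫ x, θ.ellx x ∂q.qx + ∫ ρ, θ.ellρ ρ ∂q.qρ + ∫ s, θ.ells s ∂q.qs +
    ∫ γ, θ.ellγ γ ∂q.qγ -
    ∑ i, (q.activity i *
        gammaLog (mdl.a i) (mdl.b i) (∫ ρ, Real.log (ρ i) ∂q.qρ) (∫ ρ, ρ i ∂q.qρ) +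
      (1 - q.activity i) *
        gammaLog (mdl.abar i) (mdl.bbar i) (∫ ρ, Real.log (ρ i) ∂q.qρ) (∫ ρ, ρ i ∂q.qρ)) +
    ∑ i, (∫ ρ, ρ i ∂q.qρ) * ∫ α, ‖α i‖ ^ 2 ∂q.qα +
    (∫ γ, γ ∂q.qγ) * ∫ p, mdl.residual p.1 p.2 ∂(q.qα.prod q.qx)

/-- The factors in `q` need not be those of `θ`. This generality allows one factor to be replaced by
a Dirac mass, which evaluates the average of the log ratio over the remaining factors at a fixed
value of one block. -/
lemma Factors.HasMoments.hasMean_ellRatio {q : mdl.Factors} (h : q.HasMoments) (θ : mdl.Params) :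
    HasMean θ.ellRatio q.prod (θ.meanEll q) := by
  have := h.α; have := h.x; have := h.ρ; have := h.s; have := h.γ
  have hp := h.toIsProb
  have act : ∀ i, HasMean (fun s : PathIdx K Q → Bool => if s i then (1 : ℝ) else 0) q.qs
      (q.activity i) := fun i => (h.integrable_s _).hasMean
  have d1 := fun i => (((act i).prod_mul (h.hasMean_gammaLog (mdl.a i) (mdl.b i) i)).comp
    hp.proj_sρ).add ((((HasMean.const (1 : ℝ)).sub (act i)).prod_mul
    (h.hasMean_gammaLog (mdl.abar i) (mdl.bbar i) i)).comp hp.proj_sρ)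
  have d2 := fun i => ((h.int_ρ i).hasMean.prod_mul (h.integrable_sq_norm_α i).hasMean).comp
    hp.proj_ρα
  have d3 := (h.int_γ.hasMean.prod_mul h.integrable_residual.hasMean).comp hp.proj_γαx
  have d4 := (((((h.integrable_ellα θ).hasMean.comp hp.proj_α).add
    ((h.integrable_ellx θ).hasMean.comp hp.proj_x)).add
    ((h.integrable_ellρ θ).hasMean.comp hp.proj_ρ)).add
    ((h.integrable_s θ.ells).hasMean.comp hp.proj_s)).add
    ((h.integrable_ellγ θ).hasMean.comp hp.proj_γ)
  exact ((d4.sub (HasMean.sum d1)).add (HasMean.sum d2)).add d3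

end Model

lemma hasMean_sq_norm_cnVec {ι : Type} [Fintype ι] (mu : ι → ℂ) {v : ι → ℝ} (hv : ∀ i, 0 < v i)
    (i : ι) : HasMean (fun u : ι → ℂ => ‖u i‖ ^ 2) (cnVec mu v) (‖mu i‖ ^ 2 + v i) :=
  ⟨(memLp_two_iff_integrable_sq_norm (memLp_eval_cnVec mu hv i).aestronglyMeasurable).mp
    (memLp_eval_cnVec mu hv i), integral_sq_norm_eval_cnVec mu hv i⟩

lemma hasMean_sq_norm_sub_cnVec {ι : Type} [Fintype ι] (mu : ι → ℂ) {v : ι → ℝ}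
    (hv : ∀ i, 0 < v i) (i : ι) :
    HasMean (fun u : ι → ℂ => ‖u i - mu i‖ ^ 2) (cnVec mu v) (v i) := by
  have := isProbabilityMeasure_cnVec mu hv
  have h1 : HasMean (fun u : ι → ℂ => u i) (cnVec mu v) (mu i) :=
    ⟨(memLp_eval_cnVec mu hv i).integrable one_le_two, integral_eval_cnVec mu hv i⟩
  refine (((hasMean_sq_norm_cnVec mu hv i).sub ((h1.const_mul (star (mu i))).re.const_mul 2)).add
    (HasMean.const (‖mu i‖ ^ 2))).congr (fun u => ?_) ?_
  · simp only [Complex.sq_norm, Complex.normSq_apply, Complex.sub_re, Complex.sub_im,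
      Complex.star_def, Complex.mul_re, Complex.conj_re, Complex.conj_im]
    ring
  · simp only [Complex.sq_norm, Complex.normSq_apply,
      Complex.star_def, Complex.mul_re, Complex.conj_re, Complex.conj_im]
    ring

/-! ### The divergence objective in closed form. -/

namespace Model

variable {mdl : Model M N K Q Tp Td}

namespace Params

variable {θ : mdl.Params}

/-- The mean `⟨ln γ⟩`. -/
def meanLogγ (θ : mdl.Params) : ℝ := psi θ.shapeγ - Real.log θ.rateγ

/-- The expected squared residual. -/
def meanResidual (θ : mdl.Params) : ℝ :=
  ∫ p, mdl.residual p.1 p.2 ∂(θ.toFactors.qα.prod θ.toFactors.qx)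

/-- The terms of the objective that involve only the law of `ρ`. -/
def objρ (θ : mdl.Params) : ℝ :=
  ∑ i, (gammaLog (θ.shapeρ i) (θ.rateρ i) (θ.meanLogρ i) (θ.meanρ i) - θ.meanLogρ i)

/-- The terms of the objective that involve only the law of `s`. -/
def objs (θ : mdl.Params) : ℝ :=
  ∑ i, (θ.probs i * (Real.log (θ.probs i) - Real.log (mdl.lam i)) +
    (1 - θ.probs i) * (Real.log (1 - θ.probs i) - Real.log (1 - mdl.lam i)))

/-- The terms of the objective that couple `ρ` and `s`. -/
def objsρ (θ : mdl.Params) : ℝ :=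
  ∑ i, (θ.probs i * gammaLog (mdl.a i) (mdl.b i) (θ.meanLogρ i) (θ.meanρ i) +
    (1 - θ.probs i) * gammaLog (mdl.abar i) (mdl.bbar i) (θ.meanLogρ i) (θ.meanρ i))

/-- The terms of the objective that involve only the law of `γ`. -/
def objγ (θ : mdl.Params) : ℝ :=
  gammaLog θ.shapeγ θ.rateγ θ.meanLogγ θ.meanγ - gammaLog mdl.c mdl.d θ.meanLogγ θ.meanγ -
    mdl.numObs * (θ.meanLogγ - Real.log Real.pi)

/-- The Kullback-Leibler objective up to the constant `ln p(y)`. -/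
def obj (θ : mdl.Params) : ℝ :=
  ∑ i, (-Real.log (θ.varα i) - 1) +
    ∑ j, (Real.log (mdl.dataVar j) - Real.log (θ.varx j) +
      (‖θ.mux j‖ ^ 2 + θ.varx j) / mdl.dataVar j - 1) +
    θ.objρ + θ.objs + θ.objγ - θ.objsρ +
    ∑ i, θ.meanρ i * (‖θ.muα i‖ ^ 2 + θ.varα i) + θ.meanγ * θ.meanResidual

lemma Valid.integral_ρ (h : θ.Valid) (i : PathIdx K Q) :
    ∫ ρ, ρ i ∂θ.toFactors.qρ = θ.meanρ i := by
  rw [(h.evalρ i).integral_comp_of_aestronglyMeasurable (f := fun x : ℝ => x) (by fun_prop),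
    integral_id_gammaMeasure (h.shapeρ_pos i) (h.rateρ_pos i), meanρ]

lemma Valid.integral_log_ρ (h : θ.Valid) (i : PathIdx K Q) :
    ∫ ρ, Real.log (ρ i) ∂θ.toFactors.qρ = θ.meanLogρ i := by
  rw [(h.evalρ i).integral_comp_of_aestronglyMeasurable (f := Real.log) (by fun_prop),
    integral_log_gammaMeasure (h.shapeρ_pos i) (h.rateρ_pos i), meanLogρ]

lemma Valid.integral_γ (h : θ.Valid) : ∫ γ, γ ∂θ.toFactors.qγ = θ.meanγ :=
  integral_id_gammaMeasure h.shapeγ_pos h.rateγ_pos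

lemma Valid.integral_log_γ (h : θ.Valid) : ∫ γ, Real.log γ ∂θ.toFactors.qγ = θ.meanLogγ :=
  integral_log_gammaMeasure h.shapeγ_pos h.rateγ_pos

lemma Valid.hasMean_s (h : θ.Valid) (i : PathIdx K Q) (f : Bool → ℝ) :
    HasMean (fun s : PathIdx K Q → Bool => f (s i)) θ.toFactors.qs
      (θ.probs i * f true + (1 - θ.probs i) * f false) := by
  have := isProbabilityMeasure_bernoulliMeasure (h.probs_mem i)
  have h1 : HasMean f (bernoulliMeasure (θ.probs i)) _ :=
    ⟨Integrable.of_finite, integral_bernoulliMeasure (h.probs_mem i) f⟩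
  exact h1.comp (h.evals i)

lemma Valid.activity_eq (h : θ.Valid) (i : PathIdx K Q) : θ.toFactors.activity i = θ.probs i := by
  have := (h.hasMean_s i fun s => if s then 1 else 0).2
  rw [Factors.activity, this]; simp

lemma Valid.integral_sq_norm_α (h : θ.Valid) (i : PathIdx K Q) :
    ∫ α, ‖α i‖ ^ 2 ∂θ.toFactors.qα = ‖θ.muα i‖ ^ 2 + θ.varα i :=
  integral_sq_norm_eval_cnVec _ h.varα_pos i

lemma Valid.integral_ellρ (h : θ.Valid) : ∫ ρ, θ.ellρ ρ ∂θ.toFactors.qρ = θ.objρ := by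
  refine (HasMean.sum fun i => (h.hasMoments.hasMean_gammaLog _ _ i).sub
    (h.hasMoments.int_log_ρ i).hasMean).2.trans ?_
  simp_rw [h.integral_log_ρ, h.integral_ρ]
  rfl

lemma Valid.integral_ells (h : θ.Valid) : ∫ s, θ.ells s ∂θ.toFactors.qs = θ.objs := by
  refine (HasMean.sum fun i => h.hasMean_s i fun s => if s then
    Real.log (θ.probs i) - Real.log (mdl.lam i)
    else Real.log (1 - θ.probs i) - Real.log (1 - mdl.lam i)).2.trans ?_
  simp [objs]

lemma Valid.integral_ellγ (h : θ.Valid) : ∫ γ, θ.ellγ γ ∂θ.toFactors.qγ = θ.objγ := by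
  have := h.isProb.γ
  have hm := h.hasMoments
  refine (((hm.hasMean_gammaLog_γ _ _).sub (hm.hasMean_gammaLog_γ _ _)).sub
    ((hm.int_log_γ.hasMean.sub (HasMean.const _)).const_mul _)).2.trans ?_
  rw [h.integral_log_γ, h.integral_γ]
  rfl

lemma Valid.meanEll_self (h : θ.Valid) : θ.meanEll θ.toFactors = θ.obj := by
  have := isProbabilityMeasure_cnVec θ.muα h.varα_pos
  have := isProbabilityMeasure_cnVec θ.mux h.varx_pos
  have e1 : ∫ α, θ.ellα α ∂θ.toFactors.qα = ∑ i, (-Real.log (θ.varα i) - 1) := by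
    refine (HasMean.sum fun i => (HasMean.const _).sub
      ((hasMean_sq_norm_sub_cnVec θ.muα h.varα_pos i).div_const (θ.varα i))).2.trans ?_
    exact Finset.sum_congr rfl fun i _ => by rw [div_self (h.varα_pos i).ne']
  have e2 : ∫ x, θ.ellx x ∂θ.toFactors.qx = ∑ j, (Real.log (mdl.dataVar j) - Real.log (θ.varx j) +
      (‖θ.mux j‖ ^ 2 + θ.varx j) / mdl.dataVar j - 1) := by
    refine (HasMean.sum fun j => ((HasMean.const _).add
      ((hasMean_sq_norm_cnVec θ.mux h.varx_pos j).div_const (mdl.dataVar j))).sub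
      ((hasMean_sq_norm_sub_cnVec θ.mux h.varx_pos j).div_const (θ.varx j))).2.trans ?_
    exact Finset.sum_congr rfl fun i _ => by rw [div_self (h.varx_pos i).ne']
  rw [meanEll, e1, e2, h.integral_ellρ, h.integral_ells, h.integral_ellγ, obj, h.integral_γ]
  simp_rw [h.integral_log_ρ, h.integral_ρ, h.activity_eq, h.integral_sq_norm_α]
  rfl

lemma Valid.hasMean_ellRatio (h : θ.Valid) : HasMean θ.ellRatio θ.toFactors.prod θ.obj := by
  have := h.hasMoments.hasMean_ellRatio θ
  rwa [h.meanEll_self] at this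

/-! ### The divergence at valid parameters -/

lemma measurable_pdf_div (θ : mdl.Params) : Measurable fun v => θ.pdf v / mdl.jointPDF v :=
  θ.measurable_pdf.div mdl.measurable_jointPDF

lemma Valid.prod_eq_withDensity_jointMeasure (h : θ.Valid) (hc : θ.Compatible) :
    θ.toFactors.prod =
      mdl.jointMeasure.withDensity fun v => ENNReal.ofReal (θ.pdf v / mdl.jointPDF v) := by
  rw [h.prod_eq_withDensity, jointMeasure]
  refine withDensity_eq_withDensity_div θ.measurable_pdf mdl.measurable_jointPDF ?_
  rw [← h.prod_eq_withDensity]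
  filter_upwards [h.ae_pos] with v hv
  exact jointPDF_pos hv.1 (fun i => hc.lam_pos i _ (hv.2.1 i)) hv.2.2

lemma Valid.ae_log_eq (h : θ.Valid) (hc : θ.Compatible) :
    ∀ᵐ v ∂θ.toFactors.prod, Real.log (θ.pdf v / mdl.jointPDF v) = θ.ellRatio v := by
  filter_upwards [h.ae_pos] with v hv
  exact h.log_pdf_div_jointPDF hc hv.1 hv.2.1 hv.2.2

/-- The logarithm `ln p(y)` of the evidence. -/
def _root_.BiSVBI.Model.logEvidence (mdl : Model M N K Q Tp Td) : ℝ :=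
  Real.log (mdl.jointMeasure.real Set.univ)

lemma Valid.exists_density [IsFiniteMeasure mdl.jointMeasure]
    (hJ : mdl.jointMeasure Set.univ ≠ 0) (h : θ.Valid) (hc : θ.Compatible) :
    ∃ F : mdl.Latent → ENNReal, Measurable F ∧ θ.toFactors.prod = mdl.posterior.withDensity F ∧
      ∀ᵐ v ∂θ.toFactors.prod, Real.log (F v).toReal = θ.ellRatio v + mdl.logEvidence :=
  exists_withDensity_normalized hJ θ.measurable_pdf_div (h.prod_eq_withDensity_jointMeasure hc)
    (h.ae_log_eq hc)

/-- The log density with respect to the posterior is `ellRatio` plus `ln p(y)`, and `obj` is the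
mean of `ellRatio`. -/
lemma Valid.kld_eq [IsFiniteMeasure mdl.jointMeasure]
    (hJ : mdl.jointMeasure Set.univ ≠ 0) (h : θ.Valid) (hc : θ.Compatible) :
    mdl.kld θ.toFactors = ENNReal.ofReal (θ.obj + mdl.logEvidence) ∧
      0 ≤ θ.obj + mdl.logEvidence := by
  obtain ⟨F, hF, hFQ, hlog⟩ := h.exists_density hJ hc
  have : IsProbabilityMeasure mdl.posterior := isProbabilityMeasure_normalized hJ
  have := h.isProb.prod
  have hm := h.hasMean_ellRatio
  have := klDiv_eq_of_withDensity (P := mdl.posterior) hF hFQ hlog hm.1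
  rwa [hm.2] at this

/-- The joint measure gives no mass to the event `s i = b` when `b` has prior probability zero.
Finite divergence means absolute continuity, which forces the same on the variational law. -/
lemma Valid.compatible_of_kld_ne_top (h : θ.Valid) (hk : mdl.kld θ.toFactors ≠ ⊤) :
    θ.Compatible := by
  have hac : θ.toFactors.prod ≪ mdl.jointMeasure :=
    (InformationTheory.klDiv_ne_top_iff.mp hk).1.trans Measure.smul_absolutelyContinuous
  have key : ∀ i (b : Bool), (if b then mdl.lam i else 1 - mdl.lam i) = 0 →
      (if b then θ.probs i else 1 - θ.probs i) ≤ 0 := fun i b hb => by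
    have hE : MeasurableSet {v : mdl.Latent | v.2.2.2.1 i = b} :=
      (measurableSet_singleton b).preimage (by fun_prop)
    have h0 : mdl.jointMeasure {v | v.2.2.2.1 i = b} = 0 := by
      rw [jointMeasure, withDensity_apply _ hE, setLIntegral_congr_fun (g := fun _ => 0) hE,
        lintegral_zero]
      rintro ⟨α, x, ρ, s, γ⟩ hv
      simp only [Set.mem_ofPred_eq] at hv
      have : (∏ i, if s i then mdl.lam i else 1 - mdl.lam i) = 0 :=
        Finset.prod_eq_zero (Finset.mem_univ i) (by rw [hv]; exact hb)
      simp [jointPDF, this]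
    have h1 := hac h0
    have h2 : θ.toFactors.prod {v | v.2.2.2.1 i = b} = bernoulliMeasure (θ.probs i) {b} := by
      rw [← ((h.evals i).comp h.isProb.proj_s).map_eq,
        Measure.map_apply ((h.evals i).comp h.isProb.proj_s).measurable (measurableSet_singleton b)]
      rfl
    rw [h2, bernoulliMeasure_eq_withDensity, withDensity_apply _ (measurableSet_singleton b)] at h1
    simpa using h1
  intro i
  have hp := h.probs_mem i
  refine ⟨fun hl => le_antisymm (by simpa using key i true (by simpa using hl)) hp.1, fun hl => ?_⟩
  have := key i false (by simp [hl])
  simp only [Bool.false_eq_true, if_false] at this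
  linarith [hp.2]

end Params

end Model

/-! ### Reordering the factors of a product law -/

section Reorder

variable {A B C : Type*} [MeasurableSpace A] [MeasurableSpace B] [MeasurableSpace C]
  {μ : Measure A} {ν : Measure B} {τ : Measure C} [IsProbabilityMeasure μ]
  [IsProbabilityMeasure ν]

lemma _root_.MeasureTheory.MeasurePreserving.prod_right {f : B → C}
    (hf : MeasurePreserving f ν τ) :
    MeasurePreserving (fun p : A × B => (p.1, f p.2)) (μ.prod ν) (μ.prod τ) :=
  (MeasurePreserving.id μ).prod hf

variable [IsProbabilityMeasure τ]

/-- Iterating this exchange inside the tail of the product moves any chosen factor to the front,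
which is the form required for one-block minimization. -/
lemma measurePreserving_prod_left_comm :
    MeasurePreserving (fun p : A × B × C => (p.2.1, (p.1, p.2.2)))
      (μ.prod (ν.prod τ)) (ν.prod (μ.prod τ)) :=
  (measurePreserving_prodAssoc ν μ τ).comp
    ((Measure.measurePreserving_swap.prod (MeasurePreserving.id τ)).comp
      (measurePreserving_prodAssoc μ ν τ).symm)

end Reorder

namespace Model

variable {mdl : Model M N K Q Tp Td}

namespace Factors.IsProb

variable {q : mdl.Factors}

lemma reorder_ρ (h : q.IsProb) :
    MeasurePreserving (fun p : (PathIdx K Q → ℝ) × (PathIdx K Q → ℂ) × (mdl.DataIdx → ℂ) ×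
      (PathIdx K Q → Bool) × ℝ => ((p.2.1, p.2.2.1, p.1, p.2.2.2) : mdl.Latent))
      (q.qρ.prod (q.qα.prod (q.qx.prod (q.qs.prod q.qγ)))) q.prod := by
  have := h.α; have := h.x; have := h.ρ; have := h.s; have := h.γ
  exact measurePreserving_prod_left_comm.prod_right.comp measurePreserving_prod_left_comm

lemma reorder_s (h : q.IsProb) :
    MeasurePreserving (fun p : (PathIdx K Q → Bool) × (PathIdx K Q → ℂ) × (mdl.DataIdx → ℂ) ×
      (PathIdx K Q → ℝ) × ℝ => ((p.2.1, p.2.2.1, p.2.2.2.1, p.1, p.2.2.2.2) : mdl.Latent))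
      (q.qs.prod (q.qα.prod (q.qx.prod (q.qρ.prod q.qγ)))) q.prod := by
  have := h.α; have := h.x; have := h.ρ; have := h.s; have := h.γ
  exact measurePreserving_prod_left_comm.prod_right.prod_right.comp
    (measurePreserving_prod_left_comm.prod_right.comp measurePreserving_prod_left_comm)

lemma reorder_γ (h : q.IsProb) :
    MeasurePreserving (fun p : ℝ × (PathIdx K Q → ℂ) × (mdl.DataIdx → ℂ) ×
      (PathIdx K Q → ℝ) × (PathIdx K Q → Bool) =>
        ((p.2.1, p.2.2.1, p.2.2.2.1, p.2.2.2.2, p.1) : mdl.Latent))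
      (q.qγ.prod (q.qα.prod (q.qx.prod (q.qρ.prod q.qs)))) q.prod := by
  have := h.α; have := h.x; have := h.ρ; have := h.s; have := h.γ
  exact (Measure.measurePreserving_swap.prod_right.prod_right.prod_right).comp
    (measurePreserving_prod_left_comm.prod_right.prod_right.comp
    (measurePreserving_prod_left_comm.prod_right.comp measurePreserving_prod_left_comm))

end Factors.IsProb

/-! ### Criterion for the optimality of one factor. -/

namespace Params

variable {θ : mdl.Params}

/-- If `θ` charges every support of positive prior probability, then the joint measure is absolutely
continuous with respect to the variational posterior. -/
lemma Valid.jointMeasure_absolutelyContinuous (h : θ.Valid)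
    (hs : ∀ i, (θ.probs i = 0 → mdl.lam i = 0) ∧ (θ.probs i = 1 → mdl.lam i = 1)) :
    mdl.jointMeasure ≪ θ.toFactors.prod := by
  rw [h.prod_eq_withDensity, jointMeasure]
  -- `gammaPDFReal` need not vanish at zero. Outside the null sets `ρ i = 0` and `γ = 0`, positivity
  -- of the joint density forces positive precisions, and there the variational density is positive
  -- too.
  have hρ0 : ∀ᵐ v ∂mdl.refMeasure, ∀ i, v.2.2.1 i ≠ 0 := by
    have h1 : Measure.QuasiMeasurePreserving (fun v : mdl.Latent => v.2.2.1) mdl.refMeasure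
        volume := Measure.quasiMeasurePreserving_fst.comp
      (Measure.quasiMeasurePreserving_snd.comp Measure.quasiMeasurePreserving_snd)
    refine ae_all_iff.mpr fun i => h1.ae (p := fun ρ : PathIdx K Q → ℝ => ρ i ≠ 0) ?_
    exact (Measure.quasiMeasurePreserving_eval
      (fun _ : PathIdx K Q => (volume : Measure ℝ)) i).ae (Measure.ae_ne volume (0 : ℝ))
  have hγ0 : ∀ᵐ v ∂mdl.refMeasure, v.2.2.2.2 ≠ 0 := by
    have h1 : Measure.QuasiMeasurePreserving (fun v : mdl.Latent => v.2.2.2.2) mdl.refMeasure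
        volume := Measure.quasiMeasurePreserving_snd.comp
      (Measure.quasiMeasurePreserving_snd.comp
      (Measure.quasiMeasurePreserving_snd.comp Measure.quasiMeasurePreserving_snd))
    exact h1.ae (Measure.ae_ne volume (0 : ℝ))
  refine Measure.AbsolutelyContinuous.mk fun E hE hE0 => ?_
  rw [withDensity_apply_eq_zero (by exact θ.measurable_pdf.ennreal_ofReal)] at hE0
  rw [withDensity_apply_eq_zero (by exact mdl.measurable_jointPDF.ennreal_ofReal)]
  refine measure_mono_null_ae ?_ hE0
  filter_upwards [hρ0, hγ0] with v hv1 hv2 hv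
  refine ⟨?_, hv.2⟩
  have hj : 0 < mdl.jointPDF v := by simpa using hv.1
  have hj' := hj.ne'
  obtain ⟨α, x, ρ, s, γ⟩ := v
  simp only at hv1 hv2
  rw [jointPDF] at hj'
  have p5 := left_ne_zero_of_mul hj'
  have p4 := left_ne_zero_of_mul p5
  have p3 := left_ne_zero_of_mul p4
  have p2 := left_ne_zero_of_mul p3
  have q1 := Finset.prod_ne_zero_iff.mp (left_ne_zero_of_mul p2)
  have q2 := Finset.prod_ne_zero_iff.mp (right_ne_zero_of_mul p2)
  have q5 := right_ne_zero_of_mul p5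
  have hγ : 0 < γ := by
    by_contra hneg
    exact q5 (if_neg fun h0 => hneg (lt_of_le_of_ne h0 hv2.symm))
  have hρ : ∀ i, 0 < ρ i := by
    intro i
    by_contra hneg
    refine q2 i (Finset.mem_univ i) ?_
    split_ifs <;> exact if_neg fun h0 => hneg (lt_of_le_of_ne h0 (hv1 i).symm)
  have := (h.log_pdf (v := (α, x, ρ, s, γ)) hρ (fun i => ?_) hγ).1
  · simpa using this
  · refine lt_of_le_of_ne (h.probs_nonneg i (s i)) fun h0 => q1 i (Finset.mem_univ i) ?_
    simp only at h0
    split_ifs at h0 ⊢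
    · exact (hs i).1 h0.symm
    · rw [(hs i).2 (by linarith), sub_self]

/-- The parameters with the prior support probabilities. -/
lemma Valid.with_lam (h : θ.Valid) : ({ θ with probs := mdl.lam } : mdl.Params).Valid :=
  { h with probs_mem := mdl.lam_mem }

/-- Passing to the prior support probabilities changes neither the law of `ρ` nor that of `γ`. This
supplies the absolute continuity required in these two blocks even if `θ` gives probability zero to
some admissible supports. -/
lemma Valid.jointMeasure_absolutelyContinuous_lam (h : θ.Valid) :
    mdl.jointMeasure ≪ ({ θ with probs := mdl.lam } : mdl.Params).toFactors.prod :=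
  h.with_lam.jointMeasure_absolutelyContinuous fun _ => ⟨id, id⟩

/-- A block of the variational posterior minimizes the divergence if the average of the logarithm of
the density over the other blocks is constant. -/
lemma Valid.kld_le_of_average [IsFiniteMeasure mdl.jointMeasure]
    (hJ : mdl.jointMeasure Set.univ ≠ 0) (h : θ.Valid) (hc : θ.Compatible)
    {X Z : Type} [MeasurableSpace X] [MeasurableSpace Z] {mk : X × Z → mdl.Latent}
    {pr : mdl.Latent → X} (hpr : Measurable pr) (hprmk : ∀ p, pr (mk p) = p.1)
    {r₀ r : Measure X} {κ : Measure Z} [IsProbabilityMeasure r₀] [IsProbabilityMeasure r]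
    [IsProbabilityMeasure κ] (hmk : MeasurePreserving mk (r₀.prod κ) θ.toFactors.prod)
    (hav : ∀ᵐ x ∂r₀, ∫ z, θ.ellRatio (mk (x, z)) ∂κ = θ.obj)
    (hP : mdl.jointMeasure.map pr ≪ r₀) {q : mdl.Factors}
    (hq : MeasurePreserving mk (r.prod κ) q.prod) :
    mdl.kld θ.toFactors ≤ mdl.kld q := by
  obtain ⟨F, hF, hFQ, hlog⟩ := h.exists_density hJ hc
  have : IsProbabilityMeasure mdl.posterior := isProbabilityMeasure_normalized hJ
  have hk := (h.kld_eq hJ hc).1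
  rw [Factors.kld_eq] at hk ⊢
  rw [Factors.kld_eq]
  rw [← hmk.map_eq] at hFQ hlog hk ⊢
  rw [← hq.map_eq]
  refine klDiv_prod_le_of_average_const hmk.measurable hpr hprmk hF hFQ hlog ?_ hk ?_
  · filter_upwards [hav] with x hx
    rw [hx]
  · exact (Measure.AbsolutelyContinuous.map Measure.smul_absolutelyContinuous hpr).trans hP

/-- The average over the other blocks with one block fixed at `x`. -/
lemma integral_ellRatio_mk {X Z : Type} [MeasurableSpace X] [MeasurableSingletonClass X]
    [MeasurableSpace Z] {mk : X × Z → mdl.Latent} {κ : Measure Z} [IsProbabilityMeasure κ] {x : X}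
    {q : mdl.Factors} (hq : q.HasMoments)
    (hmk : MeasurePreserving mk ((Measure.dirac x).prod κ) q.prod) :
    ∫ z, θ.ellRatio (mk (x, z)) ∂κ = θ.meanEll q := by
  have h := (hq.hasMean_ellRatio θ).comp hmk
  rw [← h.2, integral_prod _ h.1, integral_dirac]

/-! ### Optimality of the update of `ρ`. -/

section ρ

lemma Valid.updateρ (h : θ.Valid) : θ.updateρ.Valid where
  varα_pos := h.varα_pos
  varx_pos := h.varx_pos
  shapeρ_pos i := by
    have hp := h.probs_mem i
    have h1 := mul_nonneg hp.1 (mdl.a_pos i).le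
    have h2 := mul_nonneg (sub_nonneg.mpr hp.2) (mdl.abar_pos i).le
    change 0 < θ.probs i * mdl.a i + (1 - θ.probs i) * mdl.abar i + 1
    linarith
  rateρ_pos i := by
    have hp := h.probs_mem i
    have h1 := mul_nonneg hp.1 (mdl.b_pos i).le
    have h2 := mul_nonneg (sub_nonneg.mpr hp.2) (mdl.bbar_pos i).le
    have h3 := h.varα_pos i
    change 0 < θ.probs i * mdl.b i + (1 - θ.probs i) * mdl.bbar i + (‖θ.muα i‖ ^ 2 + θ.varα i)
    positivity
  probs_mem := h.probs_mem
  shapeγ_pos := h.shapeγ_pos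
  rateγ_pos := h.rateγ_pos

/-- The updated shape and rate are chosen so that the coefficients of `l` and of `m` vanish; the `+
1` in the shape absorbs the term `- l`, which comes from the normalization of `p(α ∣ ρ)`. One side
is used with `l = ln ρ`, `m = ρ`, the other with their means, so the averaged log ratio is constant
in `ρ`. -/
lemma gammaLog_updateρ (θ : mdl.Params) (i : PathIdx K Q) (l m l' m' : ℝ) :
    gammaLog (θ.updateρ.shapeρ i) (θ.updateρ.rateρ i) l m - l -
        (θ.probs i * gammaLog (mdl.a i) (mdl.b i) l m +
          (1 - θ.probs i) * gammaLog (mdl.abar i) (mdl.bbar i) l m) +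
        m * (‖θ.muα i‖ ^ 2 + θ.varα i) =
      gammaLog (θ.updateρ.shapeρ i) (θ.updateρ.rateρ i) l' m' - l' -
        (θ.probs i * gammaLog (mdl.a i) (mdl.b i) l' m' +
          (1 - θ.probs i) * gammaLog (mdl.abar i) (mdl.bbar i) l' m') +
        m' * (‖θ.muα i‖ ^ 2 + θ.varα i) := by
  simp only [gammaLog, Params.updateρ]
  ring

lemma Valid.kld_updateρ_le [IsFiniteMeasure mdl.jointMeasure]
    (hJ : mdl.jointMeasure Set.univ ≠ 0) (h : θ.Valid) (hc : θ.Compatible)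
    (r : Measure (PathIdx K Q → ℝ)) [IsProbabilityMeasure r] :
    mdl.kld θ.updateρ.toFactors ≤ mdl.kld { θ.toFactors with qρ := r } := by
  have hv := h.updateρ
  have hp := hv.isProb
  have := hp.α; have := hp.x; have := hp.ρ; have := hp.s; have := hp.γ
  have hr : ∀ r : Measure (PathIdx K Q → ℝ), IsProbabilityMeasure r →
      ({ θ.updateρ.toFactors with qρ := r } : mdl.Factors).IsProb := fun r h => { hp with ρ := h }
  refine hv.kld_le_of_average hJ hc (pr := fun v => v.2.2.1) (by fun_prop) ?_ hp.reorder_ρ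
    (ae_of_all _ fun ρ => ?_) ?_ (hr r inferInstance).reorder_ρ
  · exact fun _ => rfl
  -- A Dirac mass at `ρ` in place of `qρ` computes the average over the other factors. It has all
  -- the required moments, also for nonpositive `ρ`, where `ellRatio` is merely a formula.
  · have hm : ({ θ.updateρ.toFactors with qρ := Measure.dirac ρ } : mdl.Factors).HasMoments :=
      { hv.hasMoments with
        ρ := inferInstance
        int_ρ := fun i => integrable_dirac (by simp)
        int_log_ρ := fun i => integrable_dirac (by simp) }
    rw [integral_ellRatio_mk hm hm.toIsProb.reorder_ρ, ← hv.meanEll_self]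
    simp only [meanEll, integral_dirac, hv.integral_log_ρ, hv.integral_ρ]
    have e4 : ∀ i, ({ θ.updateρ.toFactors with qρ := Measure.dirac ρ } : mdl.Factors).activity i =
      θ.probs i := hv.activity_eq
    have e5 : ∀ i, θ.updateρ.toFactors.activity i = θ.probs i := hv.activity_eq
    have e6 : ∀ i, ∫ α, ‖α i‖ ^ 2 ∂θ.updateρ.toFactors.qα = ‖θ.muα i‖ ^ 2 + θ.varα i :=
      hv.integral_sq_norm_α
    rw [hv.integral_ellρ]
    simp_rw [e4, e5, e6]
    have key := Finset.sum_congr rfl fun i (_ : i ∈ Finset.univ) =>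
      gammaLog_updateρ θ i (Real.log (ρ i)) (ρ i) (θ.updateρ.meanLogρ i) (θ.updateρ.meanρ i)
    rw [Finset.sum_add_distrib, Finset.sum_add_distrib, Finset.sum_sub_distrib,
      Finset.sum_sub_distrib (g := fun i => θ.probs i * gammaLog (mdl.a i) (mdl.b i)
        (θ.updateρ.meanLogρ i) (θ.updateρ.meanρ i) + (1 - θ.probs i) *
        gammaLog (mdl.abar i) (mdl.bbar i) (θ.updateρ.meanLogρ i) (θ.updateρ.meanρ i))] at key
    simp only [ellρ, objρ]
    linarith
  -- The law of `ρ` is also a marginal of the product with the prior support probabilities.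
  · have h1 := (h.updateρ.with_lam.isProb.proj_ρ).map_eq
    rw [show θ.updateρ.toFactors.qρ = _ from h1.symm]
    exact h.updateρ.jointMeasure_absolutelyContinuous_lam.map (by fun_prop)

end ρ

end Params

end Model

namespace Model

variable {mdl : Model M N K Q Tp Td}

namespace Params

variable {θ : mdl.Params}

/-! ### Optimality of the update of `s`. -/

section s

lemma gammaWeight_pos (θ : mdl.Params) {a b : ℝ} (ha : 0 < a) (hb : 0 < b) (i : PathIdx K Q) :
    0 < θ.gammaWeight a b i := by
  have := Real.Gamma_pos_of_pos ha
  unfold gammaWeight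
  positivity

lemma log_gammaWeight (θ : mdl.Params) {a b : ℝ} (ha : 0 < a) (hb : 0 < b) (i : PathIdx K Q) :
    Real.log (θ.gammaWeight a b i) = gammaLog a b (θ.meanLogρ i) (θ.meanρ i) := by
  have := Real.Gamma_pos_of_pos ha
  rw [gammaWeight, Real.log_mul (by positivity) (by positivity), Real.log_div (by positivity)
    this.ne', Real.log_rpow hb, Real.log_exp, gammaLog]
  ring

/-- The normalization of the updated support probabilities. -/
def weightSum (θ : mdl.Params) (i : PathIdx K Q) : ℝ :=
  mdl.lam i * θ.gammaWeight (mdl.a i) (mdl.b i) i +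
    (1 - mdl.lam i) * θ.gammaWeight (mdl.abar i) (mdl.bbar i) i

lemma weightSum_pos (θ : mdl.Params) (i : PathIdx K Q) : 0 < θ.weightSum i := by
  have h1 := θ.gammaWeight_pos (mdl.a_pos i) (mdl.b_pos i) i
  have h2 := θ.gammaWeight_pos (mdl.abar_pos i) (mdl.bbar_pos i) i
  have hl := mdl.lam_mem i
  unfold weightSum
  rcases hl.1.lt_or_eq with h | h
  · have := mul_nonneg (sub_nonneg.mpr hl.2) h2.le
    positivity
  · rw [← h]; simpa using h2

lemma updateS_probs (θ : mdl.Params) (i : PathIdx K Q) :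
    θ.updateS.probs i = mdl.lam i * θ.gammaWeight (mdl.a i) (mdl.b i) i / θ.weightSum i := rfl

lemma one_sub_updateS_probs (θ : mdl.Params) (i : PathIdx K Q) :
    1 - θ.updateS.probs i =
      (1 - mdl.lam i) * θ.gammaWeight (mdl.abar i) (mdl.bbar i) i / θ.weightSum i := by
  have := (θ.weightSum_pos i).ne'
  rw [updateS_probs, eq_div_iff this, sub_mul, div_mul_cancel₀ _ this, weightSum]
  ring

lemma Valid.updateS (h : θ.Valid) : θ.updateS.Valid where
  varα_pos := h.varα_pos
  varx_pos := h.varx_pos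
  shapeρ_pos := h.shapeρ_pos
  rateρ_pos := h.rateρ_pos
  probs_mem i := by
    have h1 := θ.gammaWeight_pos (mdl.a_pos i) (mdl.b_pos i) i
    have h2 := θ.gammaWeight_pos (mdl.abar_pos i) (mdl.bbar_pos i) i
    have hl := mdl.lam_mem i
    constructor
    · rw [updateS_probs]
      exact div_nonneg (mul_nonneg hl.1 h1.le) (θ.weightSum_pos i).le
    · rw [← sub_nonneg, one_sub_updateS_probs]
      exact div_nonneg (mul_nonneg (sub_nonneg.mpr hl.2) h2.le) (θ.weightSum_pos i).le
  shapeγ_pos := h.shapeγ_pos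
  rateγ_pos := h.rateγ_pos

lemma updateS_probs_eq_zero_iff (θ : mdl.Params) (i : PathIdx K Q) :
    θ.updateS.probs i = 0 ↔ mdl.lam i = 0 := by
  have h1 := θ.gammaWeight_pos (mdl.a_pos i) (mdl.b_pos i) i
  rw [updateS_probs, div_eq_zero_iff, mul_eq_zero]
  simp [h1.ne', (θ.weightSum_pos i).ne']

lemma updateS_probs_eq_one_iff (θ : mdl.Params) (i : PathIdx K Q) :
    θ.updateS.probs i = 1 ↔ mdl.lam i = 1 := by
  have h2 := θ.gammaWeight_pos (mdl.abar_pos i) (mdl.bbar_pos i) i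
  rw [eq_comm, ← sub_eq_zero, one_sub_updateS_probs, div_eq_zero_iff, mul_eq_zero]
  simp only [h2.ne', (θ.weightSum_pos i).ne', or_false]
  rw [sub_eq_zero, eq_comm]

lemma compatible_updateS (θ : mdl.Params) : θ.updateS.Compatible := fun i =>
  ⟨(θ.updateS_probs_eq_zero_iff i).mpr, (θ.updateS_probs_eq_one_iff i).mpr⟩

/-- The new probability is prior times weight over the normalizer, and the logarithm of the weight
is the mean log density of `ρ`. What remains is the normalizer, which is the same for both values of
`s i`; this makes the averaged log ratio constant on the charged supports. -/
lemma log_updateS_probs (θ : mdl.Params) {i : PathIdx K Q} (hi : 0 < θ.updateS.probs i) :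
    Real.log (θ.updateS.probs i) - Real.log (mdl.lam i) -
      gammaLog (mdl.a i) (mdl.b i) (θ.meanLogρ i) (θ.meanρ i) = -Real.log (θ.weightSum i) := by
  have hl : mdl.lam i ≠ 0 := fun h => hi.ne' ((θ.updateS_probs_eq_zero_iff i).mpr h)
  rw [updateS_probs, Real.log_div (mul_ne_zero hl (θ.gammaWeight_pos (mdl.a_pos i)
    (mdl.b_pos i) i).ne') (θ.weightSum_pos i).ne', Real.log_mul hl (θ.gammaWeight_pos (mdl.a_pos i)
    (mdl.b_pos i) i).ne', log_gammaWeight _ (mdl.a_pos i) (mdl.b_pos i)]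
  ring

lemma log_one_sub_updateS_probs (θ : mdl.Params) {i : PathIdx K Q}
    (hi : 0 < 1 - θ.updateS.probs i) :
    Real.log (1 - θ.updateS.probs i) - Real.log (1 - mdl.lam i) -
      gammaLog (mdl.abar i) (mdl.bbar i) (θ.meanLogρ i) (θ.meanρ i) =
      -Real.log (θ.weightSum i) := by
  have hl : 1 - mdl.lam i ≠ 0 := fun h => by
    have := (θ.updateS_probs_eq_one_iff i).mpr (by linarith)
    linarith
  rw [one_sub_updateS_probs, Real.log_div (mul_ne_zero hl (θ.gammaWeight_pos (mdl.abar_pos i)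
    (mdl.bbar_pos i) i).ne') (θ.weightSum_pos i).ne', Real.log_mul hl
    (θ.gammaWeight_pos (mdl.abar_pos i) (mdl.bbar_pos i) i).ne',
    log_gammaWeight _ (mdl.abar_pos i) (mdl.bbar_pos i)]
  ring

lemma Valid.objs_updateS (h : θ.Valid) :
    θ.updateS.objs - θ.updateS.objsρ = ∑ i, -Real.log (θ.weightSum i) := by
  rw [objs, objsρ, ← Finset.sum_sub_distrib]
  refine Finset.sum_congr rfl fun i _ => ?_
  have hp := h.updateS.probs_mem i
  have h1 : θ.updateS.probs i * (Real.log (θ.updateS.probs i) - Real.log (mdl.lam i) -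
      gammaLog (mdl.a i) (mdl.b i) (θ.meanLogρ i) (θ.meanρ i)) =
      θ.updateS.probs i * -Real.log (θ.weightSum i) := by
    rcases hp.1.lt_or_eq with h0 | h0
    · rw [log_updateS_probs θ h0]
    · rw [← h0]; simp
  have h2 : (1 - θ.updateS.probs i) * (Real.log (1 - θ.updateS.probs i) -
      Real.log (1 - mdl.lam i) -
      gammaLog (mdl.abar i) (mdl.bbar i) (θ.meanLogρ i) (θ.meanρ i)) =
      (1 - θ.updateS.probs i) * -Real.log (θ.weightSum i) := by
    rcases (sub_nonneg.mpr hp.2).lt_or_eq with h0 | h0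
    · rw [log_one_sub_updateS_probs θ h0]
    · rw [← h0]; simp
  change _ - (θ.updateS.probs i * gammaLog (mdl.a i) (mdl.b i) (θ.meanLogρ i) (θ.meanρ i) +
    (1 - θ.updateS.probs i) * gammaLog (mdl.abar i) (mdl.bbar i) (θ.meanLogρ i) (θ.meanρ i)) = _
  linarith

lemma Valid.kld_updateS_le [IsFiniteMeasure mdl.jointMeasure]
    (hJ : mdl.jointMeasure Set.univ ≠ 0) (h : θ.Valid)
    (r : Measure (PathIdx K Q → Bool)) [IsProbabilityMeasure r] :
    mdl.kld θ.updateS.toFactors ≤ mdl.kld { θ.toFactors with qs := r } := by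
  have hv := h.updateS
  have hp := hv.isProb
  have := hp.α; have := hp.x; have := hp.ρ; have := hp.s; have := hp.γ
  have hr : ∀ r : Measure (PathIdx K Q → Bool), IsProbabilityMeasure r →
      ({ θ.updateS.toFactors with qs := r } : mdl.Factors).IsProb := fun r h => { hp with s := h }
  refine hv.kld_le_of_average hJ θ.compatible_updateS (pr := fun v => v.2.2.2.1) (by fun_prop) ?_
    hp.reorder_s ?_ ?_ (hr r inferInstance).reorder_s
  · exact fun _ => rfl
  -- Constancy holds only almost everywhere: where an updated probability is zero, its logarithm is
  -- a default value.
  · filter_upwards [hv.ae_s_pos] with s hs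
    have hm : ({ θ.updateS.toFactors with qs := Measure.dirac s } : mdl.Factors).HasMoments :=
      { hv.hasMoments with s := inferInstance }
    rw [integral_ellRatio_mk hm hm.toIsProb.reorder_s, ← hv.meanEll_self]
    simp only [meanEll, integral_dirac, hv.integral_log_ρ, hv.integral_ρ, hv.integral_ells,
      hv.activity_eq]
    have e4 : ∀ i, ({ θ.updateS.toFactors with qs := Measure.dirac s } : mdl.Factors).activity i =
      if s i then 1 else 0 := fun i => integral_dirac _ _
    simp_rw [e4]
    have key : θ.updateS.ells s - ∑ i, ((if s i then 1 else 0) *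
        gammaLog (mdl.a i) (mdl.b i) (θ.meanLogρ i) (θ.meanρ i) +
        (1 - if s i then 1 else 0) *
        gammaLog (mdl.abar i) (mdl.bbar i) (θ.meanLogρ i) (θ.meanρ i)) =
        ∑ i, -Real.log (θ.weightSum i) := by
      rw [ells, ← Finset.sum_sub_distrib]
      refine Finset.sum_congr rfl fun i _ => ?_
      have hi := hs i
      split_ifs at hi ⊢
      · rw [← log_updateS_probs θ hi]; ring
      · rw [← log_one_sub_updateS_probs θ hi]; ring
    have key2 := h.objs_updateS
    have e1 : ∀ i, θ.updateS.meanLogρ i = θ.meanLogρ i := fun _ => rfl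
    have e2 : ∀ i, θ.updateS.meanρ i = θ.meanρ i := fun _ => rfl
    rw [objsρ] at key2
    simp only [e1, e2] at key key2 ⊢
    linarith
  -- The updated probabilities are degenerate exactly where the prior ones are, so here the updated
  -- law itself dominates the joint measure.
  · have h1 := (hv.isProb.proj_s).map_eq
    rw [show θ.updateS.toFactors.qs = _ from h1.symm]
    exact (hv.jointMeasure_absolutelyContinuous fun i =>
      ⟨(θ.updateS_probs_eq_zero_iff i).mp, (θ.updateS_probs_eq_one_iff i).mp⟩).map (by fun_prop)

end s

/-! ### Optimality of the update of `γ`. -/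

section γ

lemma Valid.updateγ (h : θ.Valid) : θ.updateγ.Valid where
  varα_pos := h.varα_pos
  varx_pos := h.varx_pos
  shapeρ_pos := h.shapeρ_pos
  rateρ_pos := h.rateρ_pos
  probs_mem := h.probs_mem
  shapeγ_pos := by
    have := mdl.c_pos
    change 0 < mdl.c + ((Tp + Td) * M * N : ℕ)
    positivity
  rateγ_pos := add_pos_of_pos_of_nonneg mdl.d_pos (integral_nonneg fun _ => mdl.residual_nonneg _ _)

/-- As for `ρ`, the coefficients of `l` and `m` cancel: every complex scalar observation contributes
one power of `γ`, hence `numObs` in the shape, and the expected residual enters the rate. -/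
lemma gammaLog_updateγ (θ : mdl.Params) (l m l' m' : ℝ) :
    gammaLog θ.updateγ.shapeγ θ.updateγ.rateγ l m - gammaLog mdl.c mdl.d l m -
        mdl.numObs * (l - Real.log Real.pi) + m * θ.meanResidual =
      gammaLog θ.updateγ.shapeγ θ.updateγ.rateγ l' m' - gammaLog mdl.c mdl.d l' m' -
        mdl.numObs * (l' - Real.log Real.pi) + m' * θ.meanResidual := by
  have h1 : θ.updateγ.shapeγ = mdl.c + mdl.numObs := rfl
  have h2 : θ.updateγ.rateγ = mdl.d + θ.meanResidual := rfl
  rw [h1, h2, gammaLog, gammaLog, gammaLog, gammaLog]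
  ring

lemma Valid.meanEll_updateγ_dirac (h : θ.Valid) (γ : ℝ) :
    θ.updateγ.meanEll { θ.updateγ.toFactors with qγ := Measure.dirac γ } = θ.updateγ.obj := by
  have hv := h.updateγ
  have key := gammaLog_updateγ θ (Real.log γ) γ θ.updateγ.meanLogγ θ.updateγ.meanγ
  have e1 : ∀ i, ({ θ.updateγ.toFactors with qγ := Measure.dirac γ } : mdl.Factors).activity i =
    θ.updateγ.toFactors.activity i := fun i => by rw [Factors.activity, Factors.activity]
  have e2 : ∫ p, mdl.residual p.1 p.2 ∂(θ.updateγ.toFactors.qα.prod θ.updateγ.toFactors.qx) =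
    θ.meanResidual := rfl
  rw [← hv.meanEll_self, meanEll, meanEll]
  rw [hv.integral_ellγ]
  simp only [integral_dirac, hv.integral_γ, e1, e2, ellγ, objγ]
  linarith

lemma Valid.hasMoments_updateγ_dirac (h : θ.Valid) (γ : ℝ) :
    ({ θ.updateγ.toFactors with qγ := Measure.dirac γ } : mdl.Factors).HasMoments :=
  { h.updateγ.hasMoments with
    γ := inferInstance
    int_γ := integrable_dirac (by simp)
    int_log_γ := integrable_dirac (by simp) }

lemma Valid.jointMeasure_map_γ (h : θ.Valid) :
    mdl.jointMeasure.map (fun v => v.2.2.2.2) ≪ θ.toFactors.qγ := by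
  have h1 := (h.with_lam.isProb.proj_γ).map_eq
  rw [show θ.toFactors.qγ = _ from h1.symm]
  exact h.jointMeasure_absolutelyContinuous_lam.map (by fun_prop)

lemma Valid.kld_updateγ_le [IsFiniteMeasure mdl.jointMeasure]
    (hJ : mdl.jointMeasure Set.univ ≠ 0) (h : θ.Valid) (hc : θ.Compatible)
    (r : Measure ℝ) [IsProbabilityMeasure r] :
    mdl.kld θ.updateγ.toFactors ≤ mdl.kld { θ.toFactors with qγ := r } := by
  have hv := h.updateγ
  have hp := hv.isProb
  have := hp.α; have := hp.x; have := hp.ρ; have := hp.s; have := hp.γ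
  have hr : ∀ r : Measure ℝ, IsProbabilityMeasure r →
      ({ θ.updateγ.toFactors with qγ := r } : mdl.Factors).IsProb := fun r h => { hp with γ := h }
  refine hv.kld_le_of_average hJ hc (pr := fun v => v.2.2.2.2) (by fun_prop) ?_
    hp.reorder_γ (ae_of_all _ fun γ => ?_) ?_ (hr r inferInstance).reorder_γ
  · exact fun _ => rfl
  · have hm := h.hasMoments_updateγ_dirac γ
    rw [integral_ellRatio_mk hm hm.toIsProb.reorder_γ]
    exact h.meanEll_updateγ_dirac γ
  · exact hv.jointMeasure_map_γ

end γ

end Params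

end Model

/-! ### The evidence -/

lemma integrable_gammaPDFReal_mul_pow {a b : ℝ} (ha : 0 < a) (hb : 0 < b) (n : ℕ) :
    Integrable fun x => gammaPDFReal a b x * (|x| / Real.pi) ^ n := by
  have h1 : Integrable (fun x : ℝ => (|x| / Real.pi) ^ n) (gammaMeasure a b) := by
    refine ((integrable_exp_mul_log_gammaMeasure ha hb (t := n)
      (by positivity)).mul_const ((Real.pi ^ n)⁻¹)).congr ?_
    filter_upwards [ae_pos_gammaMeasure a b] with x hx
    rw [mul_comm (n : ℝ), Real.exp_mul, Real.exp_log hx, Real.rpow_natCast, abs_of_pos hx, div_pow,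
      div_eq_mul_inv]
  rw [gammaMeasure_eq_withDensity, integrable_withDensity_iff_integrable_smul' (by fun_prop)
    (ae_of_all _ fun _ => ENNReal.ofReal_lt_top)] at h1
  refine h1.congr (ae_of_all _ fun x => ?_)
  simp only [smul_eq_mul]
  rw [ENNReal.toReal_ofReal (gammaPDFReal_nonneg ha hb x)]

lemma cnPDF_one_div_le (mu y : ℂ) {r : ℝ} (hr : 0 ≤ r) : cnPDF mu (1 / r) y ≤ |r| / Real.pi := by
  have h1 : Real.exp (-(‖y - mu‖ ^ 2 / (1 / r))) ≤ 1 := Real.exp_le_one_iff.mpr (by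
    rw [neg_nonpos]; positivity)
  have h2 : (Real.pi * (1 / r))⁻¹ = r / Real.pi := by
    rw [mul_inv, one_div, inv_inv]; ring
  rw [cnPDF, h2, abs_of_nonneg hr]
  exact mul_le_of_le_one_right (by positivity) h1

/-- For positive precisions this is a probability density. If some precision is zero, `1 / 0 = 0`
makes the density vanish identically; the inequality covers both cases. -/
lemma lintegral_prod_cnPDF_one_div_le {ι : Type} [Fintype ι] (r : ι → ℝ) (hr : ∀ i, 0 ≤ r i) :
    ∫⁻ u : ι → ℂ, ENNReal.ofReal (∏ i, cnPDF 0 (1 / r i) (u i)) ≤ 1 := by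
  by_cases h : ∀ i, 0 < r i
  · have hv : ∀ i, 0 < 1 / r i := fun i => one_div_pos.mpr (h i)
    have := isProbabilityMeasure_cnVec 0 hv
    have h1 := measure_univ (μ := cnVec (0 : ι → ℂ) fun i => 1 / r i)
    rw [cnVec_eq_withDensity 0 hv, withDensity_apply _ MeasurableSet.univ, Measure.restrict_univ]
      at h1
    exact h1.le
  · push Not at h
    obtain ⟨i, hi⟩ := h
    have hi : r i = 0 := le_antisymm hi (hr i)
    have : ∀ u : ι → ℂ, ∏ i, cnPDF 0 (1 / r i) (u i) = 0 := fun u =>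
      Finset.prod_eq_zero (Finset.mem_univ i) (by simp [cnPDF, hi])
    simp only [this, ENNReal.ofReal_zero, lintegral_zero, zero_le]

namespace Model

variable {mdl : Model M N K Q Tp Td}

/-- An integrable function of `(x, ρ, s, γ)` which bounds the joint density without the factor
`p(α ∣ ρ)`. -/
def evidenceBound (mdl : Model M N K Q Tp Td)
    (w : (mdl.DataIdx → ℂ) × (PathIdx K Q → ℝ) × (PathIdx K Q → Bool) × ℝ) : ℝ :=
  (∏ j, cnPDF 0 (mdl.dataVar j) (w.1 j)) *
    ((∏ i, (gammaPDFReal (mdl.a i) (mdl.b i) (w.2.1 i) +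
      gammaPDFReal (mdl.abar i) (mdl.bbar i) (w.2.1 i))) *
    (1 * (gammaPDFReal mdl.c mdl.d w.2.2.2 * (|w.2.2.2| / Real.pi) ^ mdl.numObs)))

lemma integrable_evidenceBound (mdl : Model M N K Q Tp Td) :
    Integrable mdl.evidenceBound
      ((volume : Measure (mdl.DataIdx → ℂ)).prod
      ((volume : Measure (PathIdx K Q → ℝ)).prod
        ((Measure.count : Measure (PathIdx K Q → Bool)).prod (volume : Measure ℝ)))) := by
  have h1 : Integrable fun x : mdl.DataIdx → ℂ => ∏ j, cnPDF 0 (mdl.dataVar j) (x j) :=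
    Integrable.fintype_prod fun j => integrable_cnPDF _ (mdl.dataVar_pos j)
  have h2 : Integrable fun ρ : PathIdx K Q → ℝ => ∏ i, (gammaPDFReal (mdl.a i) (mdl.b i) (ρ i) +
      gammaPDFReal (mdl.abar i) (mdl.bbar i) (ρ i)) :=
    Integrable.fintype_prod (f := fun i r => gammaPDFReal (mdl.a i) (mdl.b i) r +
      gammaPDFReal (mdl.abar i) (mdl.bbar i) r) fun i =>
      (integrable_gammaPDFReal (mdl.a_pos i) (mdl.b_pos i)).add
        (integrable_gammaPDFReal (mdl.abar_pos i) (mdl.bbar_pos i))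
  have h3 : Integrable (fun _ : PathIdx K Q → Bool => (1 : ℝ)) Measure.count := Integrable.of_finite
  exact h1.mul_prod (h2.mul_prod (h3.mul_prod
    (integrable_gammaPDFReal_mul_pow mdl.c_pos mdl.d_pos mdl.numObs)))

lemma evidenceBound_nonneg (mdl : Model M N K Q Tp Td)
    (w : (mdl.DataIdx → ℂ) × (PathIdx K Q → ℝ) × (PathIdx K Q → Bool) × ℝ) :
    0 ≤ mdl.evidenceBound w := by
  have hx : ∀ j, 0 ≤ cnPDF 0 (mdl.dataVar j) (w.1 j) := fun j => cnPDF_nonneg (mdl.dataVar_pos j).le _ _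
  have h1 := fun i => gammaPDFReal_nonneg (mdl.a_pos i) (mdl.b_pos i) (w.2.1 i)
  have h2 := fun i => gammaPDFReal_nonneg (mdl.abar_pos i) (mdl.bbar_pos i) (w.2.1 i)
  have h3 := gammaPDFReal_nonneg mdl.c_pos mdl.d_pos w.2.2.2
  have hpi := Real.pi_pos
  exact mul_nonneg (Finset.prod_nonneg fun j _ => hx j)
    (mul_nonneg (Finset.prod_nonneg fun i _ => add_nonneg (h1 i) (h2 i)) (by positivity))

lemma evidenceBound_eq_zero (mdl : Model M N K Q Tp Td)
    {w : (mdl.DataIdx → ℂ) × (PathIdx K Q → ℝ) × (PathIdx K Q → Bool) × ℝ} {i : PathIdx K Q}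
    (hi : w.2.1 i < 0) : mdl.evidenceBound w = 0 := by
  have : ∏ i, (gammaPDFReal (mdl.a i) (mdl.b i) (w.2.1 i) +
      gammaPDFReal (mdl.abar i) (mdl.bbar i) (w.2.1 i)) = 0 :=
    Finset.prod_eq_zero (Finset.mem_univ i) (by simp [gammaPDFReal, hi.not_ge])
  simp [evidenceBound, this]

/-- The support probabilities are at most one, the Gamma density selected by `s` is at most the sum
of the two, and each likelihood factor is at most `γ / π`. The factor `p(α ∣ ρ)` is kept, since
after these bounds it alone provides integrability in `α`. -/
lemma jointPDF_le (mdl : Model M N K Q Tp Td) (v : mdl.Latent) :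
    mdl.jointPDF v ≤ (∏ i, cnPDF 0 (1 / v.2.2.1 i) (v.1 i)) * mdl.evidenceBound v.2 := by
  by_cases hρ : ∀ i, 0 ≤ v.2.2.1 i
  swap
  · push Not at hρ
    obtain ⟨i, hi⟩ := hρ
    rw [mdl.evidenceBound_eq_zero hi, mul_zero]
    obtain ⟨α, x, ρ, s, γ⟩ := v
    have : (∏ i, if s i then gammaPDFReal (mdl.a i) (mdl.b i) (ρ i)
        else gammaPDFReal (mdl.abar i) (mdl.bbar i) (ρ i)) = 0 :=
      Finset.prod_eq_zero (Finset.mem_univ i) (by simp [gammaPDFReal, hi.not_ge])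
    simp [jointPDF, this]
  by_cases hγ : 0 ≤ v.2.2.2.2
  swap
  · obtain ⟨α, x, ρ, s, γ⟩ := v
    have : gammaPDFReal mdl.c mdl.d γ = 0 := by simp [gammaPDFReal, hγ]
    simp [jointPDF, evidenceBound, this]
  obtain ⟨α, x, ρ, s, γ⟩ := v
  simp only at hρ hγ
  rw [jointPDF, evidenceBound]
  have hl := mdl.lam_mem
  have g1 := fun i => gammaPDFReal_nonneg (mdl.a_pos i) (mdl.b_pos i) (ρ i)
  have g2 := fun i => gammaPDFReal_nonneg (mdl.abar_pos i) (mdl.bbar_pos i) (ρ i)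
  have hs0 : 0 ≤ ∏ i, (if s i then mdl.lam i else 1 - mdl.lam i) :=
    Finset.prod_nonneg fun i _ => by
      split_ifs
      exacts [(hl i).1, sub_nonneg.mpr (hl i).2]
  have hs1 : ∏ i, (if s i then mdl.lam i else 1 - mdl.lam i) ≤ 1 :=
    Finset.prod_le_one (fun i _ => by
      split_ifs
      exacts [(hl i).1, sub_nonneg.mpr (hl i).2]) fun i _ => by
      split_ifs
      exacts [(hl i).2, by linarith [(hl i).1]]
  have hr0 : 0 ≤ ∏ i, (if s i then gammaPDFReal (mdl.a i) (mdl.b i) (ρ i)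
      else gammaPDFReal (mdl.abar i) (mdl.bbar i) (ρ i)) :=
    Finset.prod_nonneg fun i _ => by
      split_ifs
      exacts [g1 i, g2 i]
  have hr1 : ∏ i, (if s i then gammaPDFReal (mdl.a i) (mdl.b i) (ρ i)
      else gammaPDFReal (mdl.abar i) (mdl.bbar i) (ρ i)) ≤
      ∏ i, (gammaPDFReal (mdl.a i) (mdl.b i) (ρ i) +
        gammaPDFReal (mdl.abar i) (mdl.bbar i) (ρ i)) :=
    Finset.prod_le_prod (fun i _ => by
      split_ifs
      exacts [g1 i, g2 i]) fun i _ => by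
      split_ifs
      exacts [le_add_of_nonneg_right (g2 i), le_add_of_nonneg_left (g1 i)]
  have hα : 0 ≤ ∏ i, cnPDF 0 (1 / ρ i) (α i) :=
    Finset.prod_nonneg fun i _ => cnPDF_nonneg (one_div_nonneg.mpr (hρ i)) _ _
  have hx : 0 ≤ ∏ j, cnPDF 0 (mdl.dataVar j) (x j) :=
    Finset.prod_nonneg fun j _ => cnPDF_nonneg (mdl.dataVar_pos j).le _ _
  have hg := gammaPDFReal_nonneg mdl.c_pos mdl.d_pos γ
  have hn : ∀ o, 0 ≤ cnPDF ((mdl.A x *ᵥ α) o) (1 / γ) (mdl.y o) := fun o =>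
    cnPDF_nonneg (one_div_nonneg.mpr hγ) _ _
  have hn1 : ∏ o, cnPDF ((mdl.A x *ᵥ α) o) (1 / γ) (mdl.y o) ≤ (|γ| / Real.pi) ^ mdl.numObs := by
    rw [← mdl.card_obsIdx, ← Finset.card_univ, ← Finset.prod_const]
    exact Finset.prod_le_prod (fun o _ => hn o) fun o _ => cnPDF_one_div_le _ _ hγ
  have hn0 := Finset.prod_nonneg fun o (_ : o ∈ Finset.univ) => hn o
  refine (mul_le_mul (mul_le_mul_of_nonneg_right (mul_le_mul_of_nonneg_right
    (mul_le_mul_of_nonneg_right (mul_le_mul hs1 hr1 hr0 zero_le_one) hα) hx) hg) hn1 hn0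
    (mul_nonneg (mul_nonneg (mul_nonneg (mul_nonneg zero_le_one (hr0.trans hr1)) hα) hx)
      hg)).trans_eq ?_
  ring

instance (mdl : Model M N K Q Tp Td) : IsFiniteMeasure mdl.jointMeasure := by
  refine ⟨?_⟩
  have hm : Measurable fun v : mdl.Latent =>
      ENNReal.ofReal (∏ i, cnPDF 0 (1 / v.2.2.1 i) (v.1 i)) := by
    unfold cnPDF; fun_prop
  have hb : AEMeasurable (fun v : mdl.Latent => ENNReal.ofReal (mdl.evidenceBound v.2))
      mdl.refMeasure := by
    have := mdl.integrable_evidenceBound.aestronglyMeasurable.comp_snd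
      (μ := (volume : Measure (PathIdx K Q → ℂ)))
    exact this.aemeasurable.ennreal_ofReal
  rw [jointMeasure, withDensity_apply _ MeasurableSet.univ, Measure.restrict_univ]
  calc ∫⁻ v, ENNReal.ofReal (mdl.jointPDF v) ∂mdl.refMeasure
      ≤ ∫⁻ v, ENNReal.ofReal (∏ i, cnPDF 0 (1 / v.2.2.1 i) (v.1 i)) *
          ENNReal.ofReal (mdl.evidenceBound v.2) ∂mdl.refMeasure := by
        refine lintegral_mono fun v => ?_
        rw [← ENNReal.ofReal_mul' (mdl.evidenceBound_nonneg _)]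
        exact ENNReal.ofReal_le_ofReal (mdl.jointPDF_le v)
    _ ≤ ∫⁻ w, ENNReal.ofReal (mdl.evidenceBound w) ∂((volume : Measure (mdl.DataIdx → ℂ)).prod
      ((volume : Measure (PathIdx K Q → ℝ)).prod
        ((Measure.count : Measure (PathIdx K Q → Bool)).prod (volume : Measure ℝ)))) := by
        -- Integrating over `α` first removes `p(α ∣ ρ)`, whose total mass is at most one for
        -- nonnegative precisions; for the others the bound is zero.
        rw [refMeasure, lintegral_prod_symm _ (by exact hm.aemeasurable.mul hb)]
        refine lintegral_mono fun w => ?_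
        by_cases hw : ∀ i, 0 ≤ w.2.1 i
        · simp only
          rw [lintegral_mul_const' _ _ ENNReal.ofReal_ne_top]
          exact mul_le_of_le_one_left' (lintegral_prod_cnPDF_one_div_le _ hw)
        · push Not at hw
          obtain ⟨i, hi⟩ := hw
          simp [mdl.evidenceBound_eq_zero hi]
    _ < ⊤ := mdl.integrable_evidenceBound.lintegral_lt_top

/-- A variational law with the prior support probabilities is compatible, hence has a density with
respect to the joint measure; a probability law has no density with respect to the zero measure. -/
lemma jointMeasure_univ_ne_zero (mdl : Model M N K Q Tp Td) :
    mdl.jointMeasure Set.univ ≠ 0 := by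
  intro h0
  let θ : mdl.Params := ⟨0, 1, 0, 1, 1, 1, mdl.lam, 1, 1⟩
  have h : θ.Valid := ⟨fun _ => one_pos, fun _ => one_pos, fun _ => one_pos, fun _ => one_pos,
    mdl.lam_mem, one_pos, one_pos⟩
  have hc : θ.Compatible := fun i => ⟨id, id⟩
  have := h.isProb.prod
  have h1 := h.prod_eq_withDensity_jointMeasure hc
  rw [Measure.measure_univ_eq_zero.mp h0, withDensity_zero_left] at h1
  exact IsProbabilityMeasure.ne_zero _ h1

end Model

/-! ### Descent of the Armijo gradient method -/

section Quadratic

variable {ι : Type} [Fintype ι] {W : Matrix ι ι ℂ}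

lemma re_star_dotProduct_mulVec_comm (hW : W.IsHermitian) (u v : ι → ℂ) :
    (star u ⬝ᵥ (W *ᵥ v)).re = (star v ⬝ᵥ (W *ᵥ u)).re := by
  have h : star u ⬝ᵥ (W *ᵥ v) = star (star v ⬝ᵥ (W *ᵥ u)) := by
    rw [Matrix.star_dotProduct, Matrix.star_mulVec, hW.eq, Matrix.dotProduct_mulVec]
  rw [h]; rfl

lemma re_star_dotProduct_self (u : ι → ℂ) : (star u ⬝ᵥ u).re = ∑ i, ‖u i‖ ^ 2 := by
  simp only [dotProduct, Pi.star_apply, Complex.re_sum, Complex.sq_norm, Complex.normSq_apply,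
    Complex.star_def, Complex.mul_re, Complex.conj_re, Complex.conj_im]
  exact Finset.sum_congr rfl fun i _ => by ring

lemma quadObj_add (hW : W.IsHermitian) (b u d : ι → ℂ) :
    quadObj W b (u + d) =
      quadObj W b u + 2 * (star d ⬝ᵥ quadGrad W b u).re + (star d ⬝ᵥ (W *ᵥ d)).re := by
  have := re_star_dotProduct_mulVec_comm hW u d
  simp only [quadObj, quadGrad, star_add, Matrix.mulVec_add, add_dotProduct, dotProduct_add,
    dotProduct_sub, Complex.add_re, Complex.sub_re, this]
  ring

lemma quadObj_sub_smul (hW : W.IsHermitian) (b u g : ι → ℂ) (e : ℝ) :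
    quadObj W b (u - e • g) =
      quadObj W b u - 2 * e * (star g ⬝ᵥ quadGrad W b u).re +
        e ^ 2 * (star g ⬝ᵥ (W *ᵥ g)).re := by
  have h : u - e • g = u + (-e) • g := by rw [neg_smul, sub_eq_add_neg]
  rw [h, quadObj_add hW]
  simp only [star_smul, star_trivial, Matrix.mulVec_smul, smul_dotProduct, dotProduct_smul,
    Complex.smul_re, smul_eq_mul]
  ring

variable {lo hi : ℝ}

/-- With `d = w - u`, the change of the objective is at least `2 Re(dᴴ g) + lo ‖d‖²`, and completing
the square bounds this below by `-‖g‖² / lo`. -/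
lemma quadObj_sub_le (hW : W.IsHermitian) (hlo : 0 < lo)
    (hWlo : ∀ u, lo * ∑ i, ‖u i‖ ^ 2 ≤ (star u ⬝ᵥ (W *ᵥ u)).re) (b u w : ι → ℂ) :
    quadObj W b u - quadObj W b w ≤ (∑ i, ‖quadGrad W b u i‖ ^ 2) / lo := by
  have h := quadObj_add hW b u (w - u)
  rw [add_sub_cancel] at h
  have h1 := hWlo (w - u)
  set g := quadGrad W b u
  set d := w - u
  have h2 : 0 ≤ 2 * (star d ⬝ᵥ g).re + lo * (∑ i, ‖d i‖ ^ 2) + (∑ i, ‖g i‖ ^ 2) / lo := by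
    have h3 : 0 ≤ (∑ i, ‖((lo : ℂ) • d + g) i‖ ^ 2) / lo := by positivity
    rw [← re_star_dotProduct_self] at h3 ⊢
    rw [← re_star_dotProduct_self]
    refine h3.trans_eq ?_
    have h4 : (star g ⬝ᵥ d).re = (star d ⬝ᵥ g).re := by
      rw [Matrix.star_dotProduct, Complex.star_def, Complex.conj_re]
    simp only [star_add, star_smul, add_dotProduct, dotProduct_add, smul_dotProduct,
      dotProduct_smul, smul_eq_mul, Complex.star_def, Complex.conj_ofReal, Complex.add_re,
      Complex.re_ofReal_mul, h4]
    field_simp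
    ring
  linarith

/-- A parallelogram identity: it turns suboptimality with respect to the midpoint into a bound of
the distance, without bringing in the minimizer. The scalar `-(1 / 2)` writes the midpoint in the
form of `quadObj_sub_smul`. -/
lemma quadObj_midpoint (hW : W.IsHermitian) (b u w : ι → ℂ) :
    (star (w - u) ⬝ᵥ (W *ᵥ (w - u))).re =
      2 * (quadObj W b u + quadObj W b w - 2 * quadObj W b (u - (-(1 / 2) : ℝ) • (w - u))) := by
  rw [quadObj_sub_smul hW]
  have h := quadObj_add hW b u (w - u)
  rw [add_sub_cancel] at h
  rw [h]
  ring

variable (arm : ArmijoRule)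

/-- A lower bound of the Armijo step sizes for quadratic objectives of curvature at most `hi`. -/
def ArmijoRule.minStep (hi : ℝ) : ℝ := min arm.init (arm.shrink * (2 * (1 - arm.slope) / hi))

lemma ArmijoRule.minStep_pos (hhi : 0 < hi) : 0 < arm.minStep hi :=
  lt_min arm.init_pos (mul_pos arm.shrink_mem.1
    (div_pos (mul_pos two_pos (sub_pos.mpr arm.slope_mem.2)) hhi))

/-- The decrease along `-g` is `2 e ‖g‖² - e² gᴴ W g`; for `e * hi ≤ 2 (1 - slope)` the second term
costs at most the fraction `1 - slope` of the first. -/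
lemma ArmijoRule.decrease_of_le (hW : W.IsHermitian)
    (hWhi : ∀ u, (star u ⬝ᵥ (W *ᵥ u)).re ≤ hi * ∑ i, ‖u i‖ ^ 2) (b u : ι → ℂ) {e : ℝ} (he : 0 ≤ e)
    (h : e * hi ≤ 2 * (1 - arm.slope)) :
    quadObj W b (u - e • quadGrad W b u) ≤
      quadObj W b u - arm.slope * e * (2 * ∑ i, ‖quadGrad W b u i‖ ^ 2) := by
  rw [quadObj_sub_smul hW, re_star_dotProduct_self]
  have h1 := hWhi (quadGrad W b u)
  set n := ∑ i, ‖quadGrad W b u i‖ ^ 2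
  have hn : 0 ≤ n := Finset.sum_nonneg fun _ _ => by positivity
  have h2 := mul_le_mul_of_nonneg_left h1 (sq_nonneg e)
  have h3 := mul_le_mul_of_nonneg_right h (mul_nonneg he hn)
  nlinarith

lemma ArmijoRule.step_spec (hW : W.IsHermitian) (hhi : 0 < hi)
    (hWhi : ∀ u, (star u ⬝ᵥ (W *ᵥ u)).re ≤ hi * ∑ i, ‖u i‖ ^ 2) (b u : ι → ℂ) :
    arm.minStep hi ≤ arm.step W b u ∧
    quadObj W b (gradStep arm W b u) ≤
      quadObj W b u - arm.slope * arm.step W b u * (2 * ∑ i, ‖quadGrad W b u i‖ ^ 2) := by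
  have hs := arm.shrink_mem
  have hsl := arm.slope_mem
  have hin := arm.init_pos
  set P := {m : ℕ | quadObj W b (u - (arm.init * arm.shrink ^ m) • quadGrad W b u) ≤
      quadObj W b u -
        arm.slope * (arm.init * arm.shrink ^ m) * (2 * ∑ i, ‖quadGrad W b u i‖ ^ 2)} with hP
  have hstep : arm.step W b u = arm.init * arm.shrink ^ sInf P := rfl
  have hmem : ∀ m : ℕ, arm.init * arm.shrink ^ m * hi ≤ 2 * (1 - arm.slope) → m ∈ P := fun m hm =>
    arm.decrease_of_le hW hWhi b u (mul_nonneg hin.le (pow_nonneg hs.1.le _)) hm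
  -- Nonemptiness matters: `sInf ∅ = 0` would select a step that fails the Armijo test.
  have hne : P.Nonempty := by
    have h0 : 0 < 2 * (1 - arm.slope) / (arm.init * hi) :=
      div_pos (mul_pos two_pos (sub_pos.mpr hsl.2)) (mul_pos hin hhi)
    obtain ⟨m, hm⟩ := exists_pow_lt_of_lt_one h0 hs.2
    refine ⟨m, hmem m ?_⟩
    rw [lt_div_iff₀ (mul_pos hin hhi)] at hm
    linarith
  refine ⟨?_, ?_⟩
  · rw [hstep]
    rcases Nat.eq_zero_or_pos (sInf P) with h0 | h0
    · rw [h0, pow_zero, mul_one]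
      exact min_le_left _ _
    -- The preceding trial step was rejected, so it exceeds `2 (1 - slope) / hi`, and the accepted
    -- one is smaller by a single factor `shrink`.
    · have h1 : sInf P - 1 ∉ P := Nat.notMem_of_lt_sInf (by omega)
      have h2 : 2 * (1 - arm.slope) < arm.init * arm.shrink ^ (sInf P - 1) * hi := by
        by_contra hcon
        exact h1 (hmem _ (not_lt.mp hcon))
      have h3 : arm.shrink ^ sInf P = arm.shrink * arm.shrink ^ (sInf P - 1) := by
        rw [← pow_succ']; congr 1; omega
      rw [h3]
      refine (min_le_right _ _).trans ?_
      rw [mul_left_comm]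
      refine mul_le_mul_of_nonneg_left ?_ hs.1.le
      rw [div_le_iff₀ hhi]
      exact h2.le
  · have := Nat.sInf_mem hne
    exact this

variable [DecidableEq ι]

/-- The decrease of the objective by the gradient steps from the robust starting point controls both
the suboptimality of the previous mean and the distance to it; the constant depends only on bounds of
the curvature. -/
lemma ArmijoRule.exists_descent_const (hlo : 0 < lo) (hhi : 0 < hi) :
    ∃ C : ℝ, 0 < C ∧ ∀ (W : Matrix ι ι ℂ) (b u : ι → ℂ) (S : Finset ι) (B : ℕ), W.IsHermitian →
      (∀ u, lo * ∑ i, ‖u i‖ ^ 2 ≤ (star u ⬝ᵥ (W *ᵥ u)).re) →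
      (∀ u, (star u ⬝ᵥ (W *ᵥ u)).re ≤ hi * ∑ i, ‖u i‖ ^ 2) → 1 ≤ B →
      ∀ u', u' = (gradStep arm W b)^[B] (robustInit W b S u) →
      quadObj W b u' ≤ quadObj W b u ∧
      (∀ w, quadObj W b u - quadObj W b w ≤ C * (quadObj W b u - quadObj W b u')) ∧
      ∑ i, ‖(u' - u) i‖ ^ 2 ≤ C * (quadObj W b u - quadObj W b u') := by
  have hs := arm.slope_mem.1
  have hm := arm.minStep_pos hhi
  -- One step from `u₀` gains at least `2 * slope * minStep * ‖g‖²`, and `‖g‖²` is at least `lo`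
  -- times the suboptimality of `u₀`; so the gain is at least `c` times that suboptimality.
  set c := 2 * arm.slope * arm.minStep hi * lo with hc
  have hcpos : 0 < c := by positivity
  -- The factor `1 + 1 / c` serves the suboptimality, and `4 / lo` converts it into a squared
  -- distance; the product dominates both constants.
  refine ⟨(1 + 1 / c) * (1 + 4 / lo), by positivity, ?_⟩
  intro W b u S B hW hWlo hWhi hB u' hu'
  have hstep : ∀ v, quadObj W b (gradStep arm W b v) ≤
      quadObj W b v - 2 * arm.slope * arm.minStep hi * ∑ i, ‖quadGrad W b v i‖ ^ 2 := fun v => by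
    obtain ⟨h1, h2⟩ := arm.step_spec hW hhi hWhi b v
    have hn : 0 ≤ ∑ i, ‖quadGrad W b v i‖ ^ 2 := Finset.sum_nonneg fun _ _ => by positivity
    have := mul_le_mul_of_nonneg_left h1 (mul_nonneg hs.le hn)
    linarith
  have hdec : ∀ v, quadObj W b (gradStep arm W b v) ≤ quadObj W b v := fun v => by
    have hn : 0 ≤ ∑ i, ‖quadGrad W b v i‖ ^ 2 := Finset.sum_nonneg fun _ _ => by positivity
    have : 0 ≤ 2 * arm.slope * arm.minStep hi * ∑ i, ‖quadGrad W b v i‖ ^ 2 := by positivity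
    linarith [hstep v]
  have hiter : ∀ (n : ℕ) v, quadObj W b ((gradStep arm W b)^[n] v) ≤ quadObj W b v := fun n => by
    induction n with
    | zero => exact fun v => le_rfl
    | succ n ih => exact fun v => (ih _).trans (hdec v)
  set u₀ := robustInit W b S u with hu₀
  have h0 : quadObj W b u₀ ≤ quadObj W b u := by
    rw [hu₀, robustInit]
    split_ifs with h
    exacts [le_rfl, (not_le.mp h).le]
  obtain ⟨n, rfl⟩ : ∃ n, B = n + 1 := ⟨B - 1, by omega⟩
  have h1 : quadObj W b u' ≤ quadObj W b (gradStep arm W b u₀) := by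
    rw [hu', Function.iterate_succ_apply]; exact hiter n _
  have h2 := hstep u₀
  have h3 : quadObj W b u' ≤ quadObj W b u := h1.trans ((hdec u₀).trans h0)
  have hδ : 0 ≤ quadObj W b u - quadObj W b u' := sub_nonneg.mpr h3
  -- Split at `u₀`: the drop from `u` to `u₀` is at most the total decrease, and the suboptimality
  -- of `u₀` is at most `1 / c` times it.
  have key : ∀ w, quadObj W b u - quadObj W b w ≤
      (1 + 1 / c) * (quadObj W b u - quadObj W b u') := fun w => by
    have h4 := quadObj_sub_le hW hlo hWlo b u₀ w
    have h5 : (∑ i, ‖quadGrad W b u₀ i‖ ^ 2) / lo ≤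
        1 / c * (quadObj W b u - quadObj W b u') := by
      rw [div_le_iff₀ hlo, one_div, ← div_eq_inv_mul, div_mul_eq_mul_div, le_div_iff₀ hcpos, hc]
      have : 2 * arm.slope * arm.minStep hi * ∑ i, ‖quadGrad W b u₀ i‖ ^ 2 ≤
        quadObj W b u - quadObj W b u' := by linarith
      nlinarith
    have h6 : (1 + 1 / c) * (quadObj W b u - quadObj W b u') =
      (quadObj W b u - quadObj W b u') + 1 / c * (quadObj W b u - quadObj W b u') := by ring
    have h7 := h1.trans (hdec u₀)
    by_cases h8 : quadObj W b u₀ - quadObj W b w ≤ 0 <;> linarith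
  have hle : (1 + 1 / c) * (quadObj W b u - quadObj W b u') ≤
      (1 + 1 / c) * (1 + 4 / lo) * (quadObj W b u - quadObj W b u') := by
    refine mul_le_mul_of_nonneg_right (le_mul_of_one_le_right (by positivity) ?_) hδ
    have : 0 < 4 / lo := by positivity
    linarith
  refine ⟨h3, fun w => (key w).trans hle, ?_⟩
  -- Since `u'` is no worse than `u`, the midpoint identity bounds the curvature term by four times
  -- the suboptimality of `u` with respect to the midpoint.
  have h9 := hWlo (u' - u)
  rw [quadObj_midpoint hW b] at h9
  have h10 := key (u - (-(1 / 2) : ℝ) • (u' - u))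
  have h11 : lo * ∑ i, ‖(u' - u) i‖ ^ 2 ≤
      4 * ((1 + 1 / c) * (quadObj W b u - quadObj W b u')) := by linarith
  have h12 : ∑ i, ‖(u' - u) i‖ ^ 2 ≤
      4 / lo * ((1 + 1 / c) * (quadObj W b u - quadObj W b u')) := by
    rw [div_mul_eq_mul_div, le_div_iff₀ hlo]; linarith
  have h13 : 0 ≤ (1 + 1 / c) * (quadObj W b u - quadObj W b u') := by positivity
  nlinarith

end Quadratic

/-! ### Expected Gram matrices -/

section Expect

variable {Ω m n : Type} [MeasurableSpace Ω] [Fintype m] {P : Measure Ω}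

lemma isHermitian_expect_conjTranspose_mul (G : Ω → Matrix m n ℂ) :
    (expect P fun ω => (G ω)ᴴ * G ω).IsHermitian := by
  refine Matrix.IsHermitian.ext fun i j => ?_
  simp only [expect, Matrix.of_apply]
  rw [Complex.star_def, ← integral_conj]
  refine integral_congr_ae (ae_of_all _ fun ω => ?_)
  have := (Matrix.isHermitian_conjTranspose_mul_self (G ω)).apply i j
  exact this

variable [Fintype n]

lemma star_dotProduct_expect_mulVec {F : Ω → Matrix n n ℂ}
    (hF : ∀ i j, Integrable (fun ω => F ω i j) P) (u : n → ℂ) :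
    HasMean (fun ω => star u ⬝ᵥ (F ω *ᵥ u)) P (star u ⬝ᵥ (expect P F *ᵥ u)) := by
  have h1 : ∀ i j, HasMean (fun ω => F ω i j) P (expect P F i j) := fun i j => (hF i j).hasMean
  exact HasMean.sum fun i => (HasMean.sum fun j => (h1 i j).mul_const (u j)).const_mul _

lemma re_star_dotProduct_expect_mulVec_nonneg {G : Ω → Matrix m n ℂ}
    (hG : ∀ i j, MemLp (fun ω => G ω i j) 2 P) (u : n → ℂ) :
    0 ≤ (star u ⬝ᵥ ((expect P fun ω => (G ω)ᴴ * G ω) *ᵥ u)).re := by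
  rw [← (star_dotProduct_expect_mulVec (integrable_conjTranspose_mul hG) u).re.2]
  refine integral_nonneg fun ω => ?_
  have : star u ⬝ᵥ (((G ω)ᴴ * G ω) *ᵥ u) = star (G ω *ᵥ u) ⬝ᵥ (G ω *ᵥ u) := by
    rw [← Matrix.mulVec_mulVec, Matrix.dotProduct_mulVec, ← Matrix.star_mulVec]
  rw [this, re_star_dotProduct_self]
  positivity

end Expect

/-! ### Curvature bounds and the objective of a Gaussian factor. -/

section Curvature

lemma isHermitian_diagonal_add_smul {ι : Type} [DecidableEq ι] {E : Matrix ι ι ℂ} (hE : E.IsHermitian) (r : ι → ℝ) (g : ℝ) :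
    (Matrix.diagonal (fun i => (r i : ℂ)) + (g : ℂ) • E).IsHermitian := by
  refine Matrix.IsHermitian.add (Matrix.isHermitian_diagonal_of_self_adjoint _ ?_) ?_
  · ext i; simp
  · rw [Matrix.IsHermitian, Matrix.conjTranspose_smul, hE.eq]; simp

variable {ι : Type} [Fintype ι]

/-- A crude constant suffices; being continuous in `W`, it gives a curvature bound that is uniform
along convergent parameters. -/
lemma re_star_dotProduct_mulVec_le (W : Matrix ι ι ℂ) (u : ι → ℂ) :
    (star u ⬝ᵥ (W *ᵥ u)).re ≤ (∑ i, ∑ j, ‖W i j‖) * ∑ i, ‖u i‖ ^ 2 := by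
  have hu : ∀ i, ‖u i‖ ^ 2 ≤ ∑ k, ‖u k‖ ^ 2 := fun i =>
    Finset.single_le_sum (f := fun k => ‖u k‖ ^ 2) (fun _ _ => by positivity) (Finset.mem_univ i)
  generalize ∑ k, ‖u k‖ ^ 2 = n at hu ⊢
  simp only [dotProduct, Matrix.mulVec, Complex.re_sum, Finset.mul_sum, Finset.sum_mul]
  refine Finset.sum_le_sum fun i _ => Finset.sum_le_sum fun j _ => ?_
  refine (Complex.re_le_norm _).trans ?_
  simp only [norm_mul, Pi.star_apply, norm_star]
  have : ‖u i‖ * ‖u j‖ ≤ n := by nlinarith [hu i, hu j, sq_nonneg (‖u i‖ - ‖u j‖)]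
  nlinarith [mul_le_mul_of_nonneg_left this (norm_nonneg (W i j))]

/-- This is `log t ≤ t - 1` at `t = v * w`, the reason why the optimal variance is the reciprocal of
the diagonal entry. -/
lemma neg_log_add_mul_ge {w v : ℝ} (hw : 0 < w) (hv : 0 < v) :
    -Real.log w⁻¹ + w⁻¹ * w ≤ -Real.log v + v * w := by
  have h := Real.log_le_sub_one_of_pos (mul_pos hv hw)
  rw [Real.log_mul hv.ne' hw.ne'] at h
  rw [inv_mul_cancel₀ hw.ne', Real.log_inv]
  linarith

/-- The objective of a Gaussian factor with mean `u` and variances `v`. -/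
def gaussObj (W : Matrix ι ι ℂ) (b u : ι → ℂ) (v : ι → ℝ) : ℝ :=
  quadObj W b u + ∑ i, (-Real.log (v i) + v i * (W i i).re)

lemma sum_neg_log_add_mul_ge {w v : ι → ℝ} (hw : ∀ i, 0 < w i) (hv : ∀ i, 0 < v i) :
    ∑ i, (-Real.log (w i)⁻¹ + (w i)⁻¹ * w i) ≤ ∑ i, (-Real.log (v i) + v i * w i) :=
  Finset.sum_le_sum fun i _ => neg_log_add_mul_ge (hw i) (hv i)

lemma gaussObj_le_gaussObj {W : Matrix ι ι ℂ} (hW : ∀ i, 0 < (W i i).re) {b u u' : ι → ℂ}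
    {v : ι → ℝ} (hv : ∀ i, 0 < v i) (h : quadObj W b u' ≤ quadObj W b u) :
    gaussObj W b u' (fun i => (W i i).re⁻¹) ≤ gaussObj W b u v :=
  add_le_add h (sum_neg_log_add_mul_ge hW hv)

variable [DecidableEq ι]

lemma re_star_dotProduct_diagonal_add_smul (E : Matrix ι ι ℂ) (r : ι → ℝ) (g : ℝ) (u : ι → ℂ) :
    (star u ⬝ᵥ ((Matrix.diagonal (fun i => (r i : ℂ)) + (g : ℂ) • E) *ᵥ u)).re =
      ∑ i, r i * ‖u i‖ ^ 2 + g * (star u ⬝ᵥ (E *ᵥ u)).re := by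
  rw [Matrix.add_mulVec, dotProduct_add, Complex.add_re, Matrix.smul_mulVec, dotProduct_smul,
    smul_eq_mul, Complex.re_ofReal_mul]
  congr 1
  simp only [dotProduct, Matrix.mulVec_diagonal, Complex.re_sum]
  refine Finset.sum_congr rfl fun i _ => ?_
  simp only [Pi.star_apply, Complex.sq_norm, Complex.normSq_apply,
    Complex.star_def, Complex.mul_re, Complex.mul_im, Complex.conj_re, Complex.conj_im,
    Complex.ofReal_re, Complex.ofReal_im]
  ring

lemma diag_pos_of_curvature {W : Matrix ι ι ℂ} {lo : ℝ}
    (hW : ∀ u, lo * ∑ i, ‖u i‖ ^ 2 ≤ (star u ⬝ᵥ (W *ᵥ u)).re) (i : ι) : lo ≤ (W i i).re := by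
  have h := hW (Pi.single i 1)
  have h1 : ∑ k, ‖(Pi.single i 1 : ι → ℂ) k‖ ^ 2 = 1 := by
    rw [Finset.sum_eq_single i] <;> simp +contextual
  rw [h1] at h
  simpa [← Pi.single_star] using h

lemma isUnit_det_of_curvature {W : Matrix ι ι ℂ} {lo : ℝ} (hlo : 0 < lo)
    (hW : ∀ u, lo * ∑ i, ‖u i‖ ^ 2 ≤ (star u ⬝ᵥ (W *ᵥ u)).re) : IsUnit W.det := by
  rw [isUnit_iff_ne_zero]
  intro h0
  obtain ⟨u, hu, hWu⟩ := Matrix.exists_mulVec_eq_zero_iff.mpr h0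
  have h := hW u
  rw [hWu, dotProduct_zero, Complex.zero_re] at h
  obtain ⟨i, hi⟩ := Function.ne_iff.mp hu
  have h1 : 0 < ‖u i‖ ^ 2 := by have := norm_pos_iff.mpr hi; positivity
  have h2 : ‖u i‖ ^ 2 ≤ ∑ k, ‖u k‖ ^ 2 :=
    Finset.single_le_sum (f := fun k => ‖u k‖ ^ 2) (fun _ _ => by positivity) (Finset.mem_univ i)
  nlinarith

lemma quadObj_inv_mulVec_le {W : Matrix ι ι ℂ} (hH : W.IsHermitian) {lo : ℝ} (hlo : 0 < lo)
    (hW : ∀ u, lo * ∑ i, ‖u i‖ ^ 2 ≤ (star u ⬝ᵥ (W *ᵥ u)).re) (b w : ι → ℂ) :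
    quadObj W b (W⁻¹ *ᵥ b) ≤ quadObj W b w := by
  have h := quadObj_sub_le hH hlo hW b (W⁻¹ *ᵥ b) w
  have h1 : quadGrad W b (W⁻¹ *ᵥ b) = 0 := by
    rw [quadGrad, Matrix.mulVec_mulVec, Matrix.mul_nonsing_inv _ (isUnit_det_of_curvature hlo hW),
      Matrix.one_mulVec, sub_self]
  rw [h1] at h
  simp at h
  linarith

end Curvature

namespace Model

variable {mdl : Model M N K Q Tp Td}

namespace Params

variable {θ : mdl.Params}

lemma Valid.meanρ_pos (h : θ.Valid) (i : PathIdx K Q) : 0 < θ.meanρ i :=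
  div_pos (h.shapeρ_pos i) (h.rateρ_pos i)

lemma Valid.meanγ_pos (h : θ.Valid) : 0 < θ.meanγ := div_pos h.shapeγ_pos h.rateγ_pos

/-! ### The objective as a function of the channel factor -/

lemma isHermitian_Wα (θ : mdl.Params) : θ.Wα.IsHermitian :=
  isHermitian_diagonal_add_smul (isHermitian_expect_conjTranspose_mul _) _ _

/-- The expected Gram matrix is positive semidefinite, so the mean precisions alone bound the
curvature from below. -/
lemma Valid.Wα_ge (h : θ.Valid) {lo : ℝ} (hlo : ∀ i, lo ≤ θ.meanρ i) (u : PathIdx K Q → ℂ) :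
    lo * ∑ i, ‖u i‖ ^ 2 ≤ (star u ⬝ᵥ (θ.Wα *ᵥ u)).re := by
  have := h.isProb.x
  rw [Wα, re_star_dotProduct_diagonal_add_smul, Finset.mul_sum]
  have h1 := re_star_dotProduct_expect_mulVec_nonneg (memLp_A h.hasMoments.memLp_x) u
  have h2 := mul_nonneg h.meanγ_pos.le h1
  have h3 : ∑ i, lo * ‖u i‖ ^ 2 ≤ ∑ i, θ.meanρ i * ‖u i‖ ^ 2 :=
    Finset.sum_le_sum fun i _ => mul_le_mul_of_nonneg_right (hlo i) (by positivity)
  linarith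

/-- The terms of the objective that do not depend on the law of `α`. -/
def objRestα (θ : mdl.Params) : ℝ :=
  ∑ j, (Real.log (mdl.dataVar j) - Real.log (θ.varx j) +
      (‖θ.mux j‖ ^ 2 + θ.varx j) / mdl.dataVar j - 1) +
    θ.objρ + θ.objs + θ.objγ - θ.objsρ + θ.meanγ * ∑ o, ‖mdl.y o‖ ^ 2 - ∑ _i : PathIdx K Q, 1

/-- Since the covariance is diagonal, the variances enter the expected residual only through the
diagonal of the expected Gram matrix. Together with the terms in `⟨ρ⟩` this assembles `Wα`, and mean
and variances separate. -/
lemma Valid.obj_eq_gaussObj_α (h : θ.Valid) :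
    θ.obj = gaussObj θ.Wα θ.bα θ.muα θ.varα + θ.objRestα := by
  have := h.isProb.x
  have := h.isProb.α
  have h1 : θ.meanResidual = _ := integral_sum_sq_norm_sub_mulVec (P := θ.toFactors.qx)
    (P' := θ.toFactors.qα) (U := id) (G := mdl.A) (memLp_A h.hasMoments.memLp_x)
    h.hasMoments.memLp_α (integral_eval_cnVec _ h.varα_pos)
    (integral_star_mul_eval_cnVec _ h.varα_pos) mdl.y
  have h2 : (star θ.muα ⬝ᵥ θ.bα).re = θ.meanγ *
      (star θ.muα ⬝ᵥ ((expect θ.toFactors.qx fun x => (mdl.A x)ᴴ) *ᵥ mdl.y)).re := by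
    rw [bα, dotProduct_smul, smul_eq_mul, Complex.re_ofReal_mul]
  have h3 : ∀ i, (θ.Wα i i).re = θ.meanρ i + θ.meanγ *
      (expect θ.toFactors.qx (fun x => (mdl.A x)ᴴ * mdl.A x) i i).re := fun i => by
    simp [Wα]
  have h4 : (star θ.muα ⬝ᵥ (θ.Wα *ᵥ θ.muα)).re = _ :=
    re_star_dotProduct_diagonal_add_smul _ θ.meanρ θ.meanγ θ.muα
  have h5 : ∀ E : PathIdx K Q → ℝ, ∑ i, θ.varα i * (θ.meanρ i + θ.meanγ * E i) =
      ∑ i, θ.meanρ i * θ.varα i + θ.meanγ * ∑ i, θ.varα i * E i := fun E => by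
    rw [Finset.mul_sum, ← Finset.sum_add_distrib]
    exact Finset.sum_congr rfl fun i _ => by ring
  rw [obj, objRestα, gaussObj, quadObj, h1, h2, h4]
  simp only [h3, Finset.sum_add_distrib, h5]
  simp only [mul_add, Finset.sum_add_distrib, Finset.sum_sub_distrib]
  ring

end Params

end Model

namespace Model

variable {mdl : Model M N K Q Tp Td}

/-! ### The objective as a function of the data factor -/

/-- The squared residual of the pilot observations. -/
def pilotResidual (mdl : Model M N K Q Tp Td) (α : PathIdx K Q → ℂ) : ℝ :=
  ∑ t : Fin Tp, ∑ p : Fin N × Fin M, ‖mdl.y (Sum.inl t, p) - (mdl.A 0 *ᵥ α) (Sum.inl t, p)‖ ^ 2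

/-- The squared residual of the data observations in the slot `τ`. -/
def slotResidual (mdl : Model M N K Q Tp Td) (τ : Fin Td × Fin N) (α : PathIdx K Q → ℂ)
    (x : mdl.DataIdx → ℂ) : ℝ :=
  ∑ m, ‖mdl.y (Sum.inr τ.1, τ.2, m) - (mdl.Psi τ α *ᵥ fun k => x ⟨τ, k⟩) m‖ ^ 2

lemma continuous_pilotResidual (mdl : Model M N K Q Tp Td) : Continuous mdl.pilotResidual := by
  unfold pilotResidual Matrix.mulVec dotProduct
  fun_prop

/-- The data part of the model is bilinear, so the same observation can be read as linear in `α` or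
in `x`; inactive users contribute nothing. -/
lemma A_mulVec_inr (mdl : Model M N K Q Tp Td) (x : mdl.DataIdx → ℂ) (α : PathIdx K Q → ℂ)
    (τ : Fin Td × Fin N) (m : Fin M) :
    (mdl.A x *ᵥ α) (Sum.inr τ.1, τ.2, m) = (mdl.Psi τ α *ᵥ fun k => x ⟨τ, k⟩) m := by
  obtain ⟨t, n⟩ := τ
  simp only [Matrix.mulVec, dotProduct, A, Psi, Matrix.of_apply, Fintype.sum_prod_type,
    Finset.sum_mul]
  rw [← Finset.sum_subset (Finset.subset_univ (mdl.users t n)), ← Finset.sum_coe_sort]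
  · refine Finset.sum_congr rfl fun k _ => Finset.sum_congr rfl fun q _ => ?_
    rw [dif_pos k.2]
    ring
  · intro k _ hk
    exact Finset.sum_eq_zero fun q _ => by rw [dif_neg hk, zero_mul]

lemma residual_eq (mdl : Model M N K Q Tp Td) (α : PathIdx K Q → ℂ) (x : mdl.DataIdx → ℂ) :
    mdl.residual α x = mdl.pilotResidual α + ∑ τ, mdl.slotResidual τ α x := by
  rw [residual, Fintype.sum_prod_type, Fintype.sum_sum_type]
  congr 1
  rw [Fintype.sum_prod_type]
  refine Finset.sum_congr rfl fun t _ => ?_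
  rw [Fintype.sum_prod_type]
  refine Finset.sum_congr rfl fun n _ => Finset.sum_congr rfl fun m _ => ?_
  rw [← mdl.A_mulVec_inr x α (t, n) m]

namespace Params

variable {θ : mdl.Params}

lemma isHermitian_Wx (θ : mdl.Params) (τ : Fin Td × Fin N) : (θ.Wx τ).IsHermitian := by
  have := isHermitian_diagonal_add_smul (isHermitian_expect_conjTranspose_mul
    (P := θ.toFactors.qα) (mdl.Psi τ)) (fun k => (mdl.dataVar ⟨τ, k⟩)⁻¹) θ.meanγ
  simpa only [Wx, Complex.ofReal_inv] using this

lemma re_star_dotProduct_Wx (θ : mdl.Params) (τ : Fin Td × Fin N)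
    (u : {k : Fin K // k ∈ mdl.users τ.1 τ.2} → ℂ) :
    (star u ⬝ᵥ (θ.Wx τ *ᵥ u)).re = ∑ k, (mdl.dataVar ⟨τ, k⟩)⁻¹ * ‖u k‖ ^ 2 + θ.meanγ *
      (star u ⬝ᵥ ((expect θ.toFactors.qα fun α => (mdl.Psi τ α)ᴴ * mdl.Psi τ α) *ᵥ u)).re := by
  have := re_star_dotProduct_diagonal_add_smul
    (expect θ.toFactors.qα fun α => (mdl.Psi τ α)ᴴ * mdl.Psi τ α)
    (fun k => (mdl.dataVar ⟨τ, k⟩)⁻¹) θ.meanγ u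
  simpa only [Wx, Complex.ofReal_inv] using this

lemma exists_pos_le {ι : Type} [Finite ι] {f : ι → ℝ} (hf : ∀ i, 0 < f i) :
    ∃ lo, 0 < lo ∧ ∀ i, lo ≤ f i := by
  rcases isEmpty_or_nonempty ι with h | h
  · exact ⟨1, one_pos, fun i => h.elim i⟩
  · obtain ⟨i, hi⟩ := Finite.exists_min f
    exact ⟨f i, hf i, hi⟩

lemma Valid.exists_Wx_ge (h : θ.Valid) (τ : Fin Td × Fin N) :
    ∃ lo, 0 < lo ∧ ∀ u, lo * ∑ i, ‖u i‖ ^ 2 ≤ (star u ⬝ᵥ (θ.Wx τ *ᵥ u)).re := by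
  obtain ⟨lo, hlo, hle⟩ := exists_pos_le
    (f := fun k : {k : Fin K // k ∈ mdl.users τ.1 τ.2} => (mdl.dataVar ⟨τ, k⟩)⁻¹)
    fun k => inv_pos.mpr (mdl.dataVar_pos _)
  refine ⟨lo, hlo, fun u => ?_⟩
  rw [re_star_dotProduct_Wx, Finset.mul_sum]
  have h1 := re_star_dotProduct_expect_mulVec_nonneg (memLp_Psi h.hasMoments.memLp_α τ) u
  have h2 := mul_nonneg h.meanγ_pos.le h1
  have h3 := Finset.sum_le_sum fun k (_ : k ∈ Finset.univ) =>
    mul_le_mul_of_nonneg_right (hle k) (sq_nonneg ‖u k‖)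
  linarith

/-- The expected squared residual of the data observations in the slot `τ`. -/
def meanSlotResidual (θ : mdl.Params) (τ : Fin Td × Fin N) : ℝ :=
  ∑ m, ‖mdl.y (Sum.inr τ.1, τ.2, m)‖ ^ 2 -
      2 * (star (fun k => θ.mux ⟨τ, k⟩) ⬝ᵥ ((expect θ.toFactors.qα fun α => (mdl.Psi τ α)ᴴ) *ᵥ
        fun m => mdl.y (Sum.inr τ.1, τ.2, m))).re +
    (star (fun k => θ.mux ⟨τ, k⟩) ⬝ᵥ ((expect θ.toFactors.qα fun α =>
      (mdl.Psi τ α)ᴴ * mdl.Psi τ α) *ᵥ fun k => θ.mux ⟨τ, k⟩)).re +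
    ∑ k, θ.varx ⟨τ, k⟩ *
      (expect θ.toFactors.qα (fun α => (mdl.Psi τ α)ᴴ * mdl.Psi τ α) k k).re

lemma Valid.hasMean_slotResidual (h : θ.Valid) (τ : Fin Td × Fin N) :
    HasMean (fun p => mdl.slotResidual τ p.1 p.2) (θ.toFactors.qα.prod θ.toFactors.qx)
      (θ.meanSlotResidual τ) := by
  have := h.isProb.α
  have := h.isProb.x
  have hm := h.hasMoments
  have hU : ∀ k : {k : Fin K // k ∈ mdl.users τ.1 τ.2},
      MemLp (fun x : mdl.DataIdx → ℂ => x ⟨τ, k⟩) 2 θ.toFactors.qx := fun k => hm.memLp_x _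
  have hmu : ∀ k : {k : Fin K // k ∈ mdl.users τ.1 τ.2},
      ∫ x : mdl.DataIdx → ℂ, x ⟨τ, k⟩ ∂θ.toFactors.qx = θ.mux ⟨τ, k⟩ := fun k =>
    integral_eval_cnVec θ.mux h.varx_pos ⟨τ, k⟩
  have hv : ∀ k l : {k : Fin K // k ∈ mdl.users τ.1 τ.2},
      ∫ x : mdl.DataIdx → ℂ, star (x ⟨τ, k⟩) * x ⟨τ, l⟩ ∂θ.toFactors.qx =
        star (θ.mux ⟨τ, k⟩) * θ.mux ⟨τ, l⟩ + if k = l then (θ.varx ⟨τ, k⟩ : ℂ) else 0 := fun k l => by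
    refine (integral_star_mul_eval_cnVec θ.mux h.varx_pos ⟨τ, k⟩ ⟨τ, l⟩).trans ?_
    congr 2
    simp
  have h1 : ∀ m, Integrable (fun p : (mdl.DataIdx → ℂ) × (PathIdx K Q → ℂ) =>
      ‖mdl.y (Sum.inr τ.1, τ.2, m) - (mdl.Psi τ p.2 *ᵥ fun k => p.1 ⟨τ, k⟩) m‖ ^ 2)
      (θ.toFactors.qx.prod θ.toFactors.qα) :=
    integrable_sq_norm_sub_mulVec (P := θ.toFactors.qα) (G := mdl.Psi τ)
      (U := fun x : mdl.DataIdx → ℂ => fun k => x ⟨τ, k⟩) (memLp_Psi hm.memLp_α τ) hU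
      fun m => mdl.y (Sum.inr τ.1, τ.2, m)
  have h2 := integral_sum_sq_norm_sub_mulVec (P := θ.toFactors.qα) (P' := θ.toFactors.qx)
    (G := mdl.Psi τ) (U := fun x : mdl.DataIdx → ℂ => fun k => x ⟨τ, k⟩) (memLp_Psi hm.memLp_α τ) hU
    hmu hv fun m => mdl.y (Sum.inr τ.1, τ.2, m)
  have h3 : HasMean (fun p : (mdl.DataIdx → ℂ) × (PathIdx K Q → ℂ) => mdl.slotResidual τ p.2 p.1)
      (θ.toFactors.qx.prod θ.toFactors.qα) (θ.meanSlotResidual τ) :=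
    ⟨by unfold slotResidual; exact integrable_finsetSum _ fun m _ => h1 m,
      by unfold slotResidual meanSlotResidual; exact h2⟩
  -- The bilinear formula lists the random vector first. Here the vector is `x` and the matrix
  -- depends on `α`, so the factors are swapped back.
  have h4 := h3.comp (Measure.measurePreserving_swap (μ := θ.toFactors.qα) (ν := θ.toFactors.qx))
  simp only [Prod.fst_swap, Prod.snd_swap] at h4
  exact h4

lemma Valid.meanResidual_eq (h : θ.Valid) :
    θ.meanResidual = ∫ α, mdl.pilotResidual α ∂θ.toFactors.qα + ∑ τ, θ.meanSlotResidual τ := by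
  have := h.isProb.α
  have := h.isProb.x
  have h1 : HasMean (fun p : (PathIdx K Q → ℂ) × (mdl.DataIdx → ℂ) => mdl.residual p.1 p.2)
      (θ.toFactors.qα.prod θ.toFactors.qx) θ.meanResidual :=
    h.hasMoments.integrable_residual.hasMean
  have h2 := h1.sub (HasMean.sum h.hasMean_slotResidual)
  simp only [mdl.residual_eq, add_sub_cancel_right] at h2
  have h3 := (measurePreserving_fst (μ := θ.toFactors.qα)
    (ν := θ.toFactors.qx)).integral_comp_of_aestronglyMeasurable
    mdl.continuous_pilotResidual.aestronglyMeasurable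
  rw [← h3, h2.2, sub_add_cancel]

/-- The terms of the objective that do not depend on the law of `x`. -/
def objRestx (θ : mdl.Params) : ℝ :=
  ∑ i, (-Real.log (θ.varα i) - 1) + ∑ j, (Real.log (mdl.dataVar j) - 1) +
    θ.objρ + θ.objs + θ.objγ - θ.objsρ + ∑ i, θ.meanρ i * (‖θ.muα i‖ ^ 2 + θ.varα i) +
    θ.meanγ * (∫ α, mdl.pilotResidual α ∂θ.toFactors.qα +
      ∑ τ : Fin Td × Fin N, ∑ m, ‖mdl.y (Sum.inr τ.1, τ.2, m)‖ ^ 2)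

/-- Each data residual involves the symbols of one slot only, so the objective decouples over the
slots; the prior variances contribute the diagonal part of `Wx`. -/
lemma Valid.obj_eq_gaussObj_x (h : θ.Valid) :
    θ.obj = ∑ τ, gaussObj (θ.Wx τ) (θ.bx τ) (fun k => θ.mux ⟨τ, k⟩) (fun k => θ.varx ⟨τ, k⟩) +
      θ.objRestx := by
  have h2 : ∀ τ, (star (fun k => θ.mux ⟨τ, k⟩) ⬝ᵥ θ.bx τ).re = θ.meanγ *
      (star (fun k => θ.mux ⟨τ, k⟩) ⬝ᵥ ((expect θ.toFactors.qα fun α => (mdl.Psi τ α)ᴴ) *ᵥ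
        fun m => mdl.y (Sum.inr τ.1, τ.2, m))).re := fun τ => by
    rw [bx, dotProduct_smul, smul_eq_mul, Complex.re_ofReal_mul]
  have h3 : ∀ τ k, (θ.Wx τ k k).re = (mdl.dataVar ⟨τ, k⟩)⁻¹ + θ.meanγ *
      (expect θ.toFactors.qα (fun α => (mdl.Psi τ α)ᴴ * mdl.Psi τ α) k k).re := fun τ k => by
    simp [Wx, ← Complex.ofReal_inv]
  have h4 : ∑ j, (Real.log (mdl.dataVar j) - Real.log (θ.varx j) +
      (‖θ.mux j‖ ^ 2 + θ.varx j) / mdl.dataVar j - 1) = ∑ j, (Real.log (mdl.dataVar j) - 1) +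
      ∑ τ : Fin Td × Fin N, ∑ k, (-Real.log (θ.varx ⟨τ, k⟩) +
        (mdl.dataVar ⟨τ, k⟩)⁻¹ * ‖θ.mux ⟨τ, k⟩‖ ^ 2 +
        θ.varx ⟨τ, k⟩ * (mdl.dataVar ⟨τ, k⟩)⁻¹) := by
    rw [← Fintype.sum_sigma', ← Finset.sum_add_distrib]
    exact Finset.sum_congr rfl fun j _ => by ring
  have h5 : ∀ τ, gaussObj (θ.Wx τ) (θ.bx τ) (fun k => θ.mux ⟨τ, k⟩) (fun k => θ.varx ⟨τ, k⟩) =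
      ∑ k, (-Real.log (θ.varx ⟨τ, k⟩) + (mdl.dataVar ⟨τ, k⟩)⁻¹ * ‖θ.mux ⟨τ, k⟩‖ ^ 2 +
        θ.varx ⟨τ, k⟩ * (mdl.dataVar ⟨τ, k⟩)⁻¹) +
      θ.meanγ * (θ.meanSlotResidual τ - ∑ m, ‖mdl.y (Sum.inr τ.1, τ.2, m)‖ ^ 2) := fun τ => by
    have h6 : ∀ E : {k : Fin K // k ∈ mdl.users τ.1 τ.2} → ℝ,
        ∑ k, (-Real.log (θ.varx ⟨τ, k⟩) +
          θ.varx ⟨τ, k⟩ * ((mdl.dataVar ⟨τ, k⟩)⁻¹ + θ.meanγ * E k)) =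
        ∑ k, -Real.log (θ.varx ⟨τ, k⟩) + ∑ k, θ.varx ⟨τ, k⟩ * (mdl.dataVar ⟨τ, k⟩)⁻¹ +
          θ.meanγ * ∑ k, θ.varx ⟨τ, k⟩ * E k := fun E => by
      rw [Finset.mul_sum, ← Finset.sum_add_distrib, ← Finset.sum_add_distrib]
      exact Finset.sum_congr rfl fun k _ => by ring
    rw [gaussObj, quadObj, h2, re_star_dotProduct_Wx, meanSlotResidual]
    simp only [h3, h6]
    rw [Finset.sum_add_distrib, Finset.sum_add_distrib]
    ring
  rw [obj, objRestx, h.meanResidual_eq, h4]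
  have h7 : ∑ τ, gaussObj (θ.Wx τ) (θ.bx τ) (fun k => θ.mux ⟨τ, k⟩) (fun k => θ.varx ⟨τ, k⟩) =
      ∑ τ : Fin Td × Fin N, ∑ k, (-Real.log (θ.varx ⟨τ, k⟩) +
        (mdl.dataVar ⟨τ, k⟩)⁻¹ * ‖θ.mux ⟨τ, k⟩‖ ^ 2 +
        θ.varx ⟨τ, k⟩ * (mdl.dataVar ⟨τ, k⟩)⁻¹) + θ.meanγ * (∑ τ, θ.meanSlotResidual τ -
        ∑ τ : Fin Td × Fin N, ∑ m, ‖mdl.y (Sum.inr τ.1, τ.2, m)‖ ^ 2) := by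
    rw [← Finset.sum_sub_distrib, Finset.mul_sum, ← Finset.sum_add_distrib]
    exact Finset.sum_congr rfl fun τ _ => h5 τ
  rw [h7]
  ring

end Params

end Model

namespace Model

variable {mdl : Model M N K Q Tp Td}

namespace Params

variable {θ θ' : mdl.Params}

/-! ### Descent of the updates -/

lemma Valid.kld_le_iff (h : θ.Valid) (hc : θ.Compatible) (h' : θ'.Valid) (hc' : θ'.Compatible) :
    mdl.kld θ.toFactors ≤ mdl.kld θ'.toFactors ↔ θ.obj ≤ θ'.obj := by
  rw [(h.kld_eq mdl.jointMeasure_univ_ne_zero hc).1,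
    (h'.kld_eq mdl.jointMeasure_univ_ne_zero hc').1,
    ENNReal.ofReal_le_ofReal_iff (h'.kld_eq mdl.jointMeasure_univ_ne_zero hc').2]
  exact add_le_add_iff_right _

lemma Valid.diag_Wα_pos (h : θ.Valid) (i : PathIdx K Q) : 0 < (θ.Wα i i).re := by
  obtain ⟨lo, hlo, hle⟩ := exists_pos_le h.meanρ_pos
  exact hlo.trans_le (diag_pos_of_curvature (h.Wα_ge hle) i)

lemma Valid.diag_Wx_pos (h : θ.Valid) (τ : Fin Td × Fin N)
    (k : {k : Fin K // k ∈ mdl.users τ.1 τ.2}) : 0 < (θ.Wx τ k k).re := by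
  obtain ⟨lo, hlo, hle⟩ := h.exists_Wx_ge τ
  exact hlo.trans_le (diag_pos_of_curvature hle k)

lemma Valid.withα (h : θ.Valid) (u : PathIdx K Q → ℂ) {v : PathIdx K Q → ℝ} (hv : ∀ i, 0 < v i) :
    ({ θ with muα := u, varα := v } : mdl.Params).Valid :=
  ⟨hv, h.varx_pos, h.shapeρ_pos, h.rateρ_pos, h.probs_mem, h.shapeγ_pos, h.rateγ_pos⟩

lemma Valid.withx (h : θ.Valid) (u : mdl.DataIdx → ℂ) {v : mdl.DataIdx → ℝ} (hv : ∀ i, 0 < v i) :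
    ({ θ with mux := u, varx := v } : mdl.Params).Valid :=
  ⟨h.varα_pos, hv, h.shapeρ_pos, h.rateρ_pos, h.probs_mem, h.shapeγ_pos, h.rateγ_pos⟩

lemma Valid.withρ (h : θ.Valid) {u v : PathIdx K Q → ℝ} (hu : ∀ i, 0 < u i) (hv : ∀ i, 0 < v i) :
    ({ θ with shapeρ := u, rateρ := v } : mdl.Params).Valid :=
  ⟨h.varα_pos, h.varx_pos, hu, hv, h.probs_mem, h.shapeγ_pos, h.rateγ_pos⟩

lemma Valid.updateα (h : θ.Valid) (arm : ArmijoRule) (B : ℕ) (S : Finset (PathIdx K Q)) :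
    (θ.updateα arm B S).Valid :=
  h.withα _ fun i => inv_pos.mpr (h.diag_Wα_pos i)

lemma Valid.updateX (h : θ.Valid) : θ.updateX.Valid :=
  h.withx _ fun j => inv_pos.mpr (h.diag_Wx_pos j.1 j.2)

lemma Valid.iteration (h : θ.Valid) (arm : ArmijoRule) (B : ℕ) (S : Finset (PathIdx K Q)) :
    (θ.iteration arm B S).Valid :=
  (h.updateα arm B S).updateρ.updateS.updateX.updateγ

lemma Valid.obj_withα (h : θ.Valid) (u : PathIdx K Q → ℂ) {v : PathIdx K Q → ℝ}
    (hv : ∀ i, 0 < v i) :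
    ({ θ with muα := u, varα := v } : mdl.Params).obj =
      gaussObj θ.Wα θ.bα u v + θ.objRestα :=
  (h.withα u hv).obj_eq_gaussObj_α

lemma Valid.obj_withx (h : θ.Valid) (u : mdl.DataIdx → ℂ) {v : mdl.DataIdx → ℝ}
    (hv : ∀ i, 0 < v i) :
    ({ θ with mux := u, varx := v } : mdl.Params).obj =
      ∑ τ, gaussObj (θ.Wx τ) (θ.bx τ) (fun k => u ⟨τ, k⟩) (fun k => v ⟨τ, k⟩) + θ.objRestx :=
  (h.withx u hv).obj_eq_gaussObj_x

lemma Valid.exists_Wα_bounds (h : θ.Valid) : ∃ lo hi, 0 < lo ∧ 0 < hi ∧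
    (∀ u, lo * ∑ i, ‖u i‖ ^ 2 ≤ (star u ⬝ᵥ (θ.Wα *ᵥ u)).re) ∧
    ∀ u, (star u ⬝ᵥ (θ.Wα *ᵥ u)).re ≤ hi * ∑ i, ‖u i‖ ^ 2 := by
  obtain ⟨lo, hlo, hle⟩ := exists_pos_le h.meanρ_pos
  refine ⟨lo, ∑ i, ∑ j, ‖θ.Wα i j‖ + 1, hlo, by positivity, h.Wα_ge hle, fun u => ?_⟩
  refine (re_star_dotProduct_mulVec_le θ.Wα u).trans ?_
  have : 0 ≤ ∑ i, ‖u i‖ ^ 2 := by positivity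
  nlinarith

lemma Valid.obj_updateα_le (h : θ.Valid) (arm : ArmijoRule) {B : ℕ} (hB : 1 ≤ B)
    (S : Finset (PathIdx K Q)) : (θ.updateα arm B S).obj ≤ θ.obj := by
  obtain ⟨lo, hi, hlo, hhi, h1, h2⟩ := h.exists_Wα_bounds
  obtain ⟨C, -, hC⟩ := arm.exists_descent_const (ι := PathIdx K Q) hlo hhi
  have h3 := (hC θ.Wα θ.bα θ.muα S B θ.isHermitian_Wα h1 h2 hB _ rfl).1
  rw [h.obj_eq_gaussObj_α]
  refine (h.obj_withα _ fun i => inv_pos.mpr (h.diag_Wα_pos i)).trans_le ?_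
  exact add_le_add_left (gaussObj_le_gaussObj h.diag_Wα_pos h.varα_pos h3) _

lemma Valid.obj_updateX_le_withx (h : θ.Valid) (u : mdl.DataIdx → ℂ) {v : mdl.DataIdx → ℝ}
    (hv : ∀ j, 0 < v j) :
    θ.updateX.obj ≤ ({ θ with mux := u, varx := v } : mdl.Params).obj := by
  rw [h.obj_withx u hv]
  refine (h.obj_withx _ fun j => inv_pos.mpr (h.diag_Wx_pos j.1 j.2)).trans_le ?_
  refine add_le_add_left (Finset.sum_le_sum fun τ _ => ?_) _
  obtain ⟨lo, hlo, hle⟩ := h.exists_Wx_ge τ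
  exact gaussObj_le_gaussObj (h.diag_Wx_pos τ) (fun k => hv _)
    (quadObj_inv_mulVec_le (θ.isHermitian_Wx τ) hlo hle _ _)

lemma Valid.obj_updateX_le (h : θ.Valid) : θ.updateX.obj ≤ θ.obj :=
  h.obj_updateX_le_withx θ.mux h.varx_pos

lemma Valid.obj_updateρ_le_withρ (h : θ.Valid) (hc : θ.Compatible) {u v : PathIdx K Q → ℝ}
    (hu : ∀ i, 0 < u i) (hv : ∀ i, 0 < v i) :
    θ.updateρ.obj ≤ ({ θ with shapeρ := u, rateρ := v } : mdl.Params).obj := by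
  have h' := h.withρ hu hv
  have := h'.isProb.ρ
  exact (h.updateρ.kld_le_iff hc h' hc).mp
    (h.kld_updateρ_le mdl.jointMeasure_univ_ne_zero hc
      ({ θ with shapeρ := u, rateρ := v } : mdl.Params).toFactors.qρ)

lemma Valid.obj_updateρ_le (h : θ.Valid) (hc : θ.Compatible) : θ.updateρ.obj ≤ θ.obj :=
  h.obj_updateρ_le_withρ hc h.shapeρ_pos h.rateρ_pos

lemma Valid.obj_updateS_le (h : θ.Valid) (hc : θ.Compatible) : θ.updateS.obj ≤ θ.obj := by
  have := h.isProb.s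
  exact (h.updateS.kld_le_iff θ.compatible_updateS h hc).mp
    (h.kld_updateS_le mdl.jointMeasure_univ_ne_zero θ.toFactors.qs)

lemma Valid.obj_updateγ_le (h : θ.Valid) (hc : θ.Compatible) : θ.updateγ.obj ≤ θ.obj := by
  have := h.isProb.γ
  exact (h.updateγ.kld_le_iff hc h hc).mp
    (h.kld_updateγ_le mdl.jointMeasure_univ_ne_zero hc θ.toFactors.qγ)

lemma compatible_iteration (θ : mdl.Params) (arm : ArmijoRule) (B : ℕ)
    (S : Finset (PathIdx K Q)) : (θ.iteration arm B S).Compatible :=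
  (θ.updateα arm B S).updateρ.compatible_updateS

/-- The objective after one iteration is at most the objective after its steps `α`, `ρ`, `s`. -/
lemma Valid.obj_iteration_le_updateS (h : θ.Valid) (arm : ArmijoRule) (B : ℕ)
    (S : Finset (PathIdx K Q)) :
    (θ.iteration arm B S).obj ≤ (θ.updateα arm B S).updateρ.updateS.updateX.obj :=
  (h.updateα arm B S).updateρ.updateS.updateX.obj_updateγ_le
    (θ.updateα arm B S).updateρ.compatible_updateS

lemma Valid.obj_iteration_le_updateρ (h : θ.Valid) (hc : θ.Compatible) (arm : ArmijoRule) (B : ℕ)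
    (S : Finset (PathIdx K Q)) :
    (θ.iteration arm B S).obj ≤ (θ.updateα arm B S).updateρ.obj :=
  (h.obj_iteration_le_updateS arm B S).trans
    (((h.updateα arm B S).updateρ.updateS.obj_updateX_le).trans
      ((h.updateα arm B S).updateρ.obj_updateS_le hc))

lemma Valid.obj_iteration_le (h : θ.Valid) (hc : θ.Compatible) (arm : ArmijoRule) {B : ℕ}
    (hB : 1 ≤ B) (S : Finset (PathIdx K Q)) : (θ.iteration arm B S).obj ≤ θ.obj :=
  (h.obj_iteration_le_updateρ hc arm B S).trans
    (((h.updateα arm B S).obj_updateρ_le hc).trans (h.obj_updateα_le arm hB S))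

lemma Valid.kld_iteration_le (h : θ.Valid) (arm : ArmijoRule) {B : ℕ}
    (hB : 1 ≤ B) (S : Finset (PathIdx K Q)) :
    mdl.kld (θ.iteration arm B S).toFactors ≤ mdl.kld θ.toFactors := by
  by_cases hk : mdl.kld θ.toFactors = ⊤
  -- The initial parameters may be incompatible with the prior; then `obj` does not represent the
  -- divergence, but the latter is infinite.
  · rw [hk]; exact le_top
  · have hc := h.compatible_of_kld_ne_top hk
    exact ((h.iteration arm B S).kld_le_iff (θ.compatible_iteration arm B S) h hc).mpr
      (h.obj_iteration_le hc arm hB S)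

end Params

lemma iterates_valid {θ₀ : mdl.Params} (h : θ₀.Valid) (arm : ArmijoRule) (B : ℕ)
    (S : ℕ → Finset (PathIdx K Q)) : ∀ t, (mdl.iterates arm B S θ₀ t).Valid
  | 0 => h
  | t + 1 => (iterates_valid h arm B S t).iteration arm B (S t)

lemma antitone_kld_iterates {θ₀ : mdl.Params} (h : θ₀.Valid) (arm : ArmijoRule) {B : ℕ}
    (hB : 1 ≤ B) (S : ℕ → Finset (PathIdx K Q)) :
    Antitone fun t => mdl.kld (mdl.iterates arm B S θ₀ t).toFactors :=
  antitone_nat_of_succ_le fun t => (iterates_valid h arm B S t).kld_iteration_le arm hB (S t)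

end Model

/-! ### Continuity of the moments -/

/-- Complex differentiability on the right half-plane gives analyticity, hence a continuous
derivative; this is what the continuity of `psi` rests on. -/
lemma analyticAt_Gamma_of_pos {x : ℝ} (hx : 0 < x) : AnalyticAt ℝ Real.Gamma x := by
  have hU : IsOpen {s : ℂ | 0 < s.re} := isOpen_lt continuous_const Complex.continuous_re
  have hd : DifferentiableOn ℂ Complex.Gamma {s : ℂ | 0 < s.re} := fun s hs =>
    (Complex.differentiableAt_Gamma s fun m h => by
      have h1 : 0 < s.re := hs
      rw [h] at h1
      simp at h1
      linarith [(Nat.cast_nonneg m : (0 : ℝ) ≤ m)]).differentiableWithinAt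
  exact (hd.analyticAt (hU.mem_nhds (by simpa using hx : (x : ℂ) ∈ {s : ℂ | 0 < s.re}))).re_ofReal

lemma continuousOn_log_Gamma : ContinuousOn (fun x => Real.log (Real.Gamma x)) (Set.Ioi 0) :=
  fun _ hx => ((analyticAt_Gamma_of_pos hx).continuousAt.log
    (Real.Gamma_pos_of_pos hx).ne').continuousWithinAt

lemma continuousOn_psi : ContinuousOn psi (Set.Ioi 0) := by
  have h : ContinuousOn (fun x => deriv Real.Gamma x / Real.Gamma x) (Set.Ioi 0) := fun x hx =>
    ((analyticAt_Gamma_of_pos hx).deriv.continuousAt.div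
      (analyticAt_Gamma_of_pos hx).continuousAt (Real.Gamma_pos_of_pos hx).ne').continuousWithinAt
  exact h.congr fun x hx => psi_eq hx

/-! ### Moments of affine functions of a Gaussian vector. -/

section Affine

lemma hasMean_affine_cnVec {ι : Type} [Fintype ι] {mu : ι → ℂ} {v : ι → ℝ} (hv : ∀ j, 0 < v j) (a : ℂ) (c : ι → ℂ) :
    HasMean (fun x : ι → ℂ => a + ∑ j, c j * x j) (cnVec mu v) (a + ∑ j, c j * mu j) := by
  have := isProbabilityMeasure_cnVec mu hv
  exact (HasMean.const a).add (HasMean.sum fun j => HasMean.const_mul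
    ⟨(memLp_eval_cnVec mu hv j).integrable one_le_two, integral_eval_cnVec mu hv j⟩ (c j))

variable {ι m n : Type} [Fintype ι] [DecidableEq ι]

/-- The difference quotient of an affine matrix-valued function along the coordinate `j`. -/
def slopeMatrix (G : (ι → ℂ) → Matrix m n ℂ) (j : ι) : Matrix m n ℂ := G (Pi.single j 1) - G 0

/-- A matrix-valued function whose entries are affine functions. -/
def IsAffineMatrix (G : (ι → ℂ) → Matrix m n ℂ) : Prop :=
  ∀ x o i, G x o i = G 0 o i + ∑ j, slopeMatrix G j o i * x j

/-- The expectation of `Gᴴ G` under the complex Gaussian law with mean `mu` and variances `v`, for an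
affine matrix-valued function `G`. -/
def affineGram [Fintype m] (G : (ι → ℂ) → Matrix m n ℂ) (mu : ι → ℂ) (v : ι → ℝ) : Matrix n n ℂ :=
  (G mu)ᴴ * G mu + ∑ j, (v j : ℂ) • ((slopeMatrix G j)ᴴ * slopeMatrix G j)

lemma continuous_affineGram [Fintype m] {G : (ι → ℂ) → Matrix m n ℂ} (hG : Continuous G)
    {X : Type*} [TopologicalSpace X] {mu : X → ι → ℂ} {v : X → ι → ℝ} (hmu : Continuous mu)
    (hv : Continuous v) : Continuous fun x => affineGram G (mu x) (v x) := by
  have h : Continuous fun x => G (mu x) := hG.comp hmu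
  refine (h.matrix_conjTranspose.matrix_mul h).add (continuous_finsetSum _ fun j _ => ?_)
  have hvj : Continuous fun x => (v x j : ℂ) := by fun_prop
  exact hvj.smul continuous_const

variable {mu : ι → ℂ} {v : ι → ℝ}

lemma hasMean_star_affine_mul_affine_cnVec (hv : ∀ j, 0 < v j) (a a' : ℂ) (c c' : ι → ℂ) :
    HasMean (fun x : ι → ℂ => star (a + ∑ j, c j * x j) * (a' + ∑ j, c' j * x j)) (cnVec mu v)
      (star (a + ∑ j, c j * mu j) * (a' + ∑ j, c' j * mu j) +
        ∑ j, (v j : ℂ) * (star (c j) * c' j)) := by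
  have := isProbabilityMeasure_cnVec mu hv
  have h1 := (hasMean_affine_cnVec (mu := mu) hv a c).star.mul_const a'
  have h2 := (hasMean_affine_cnVec (mu := mu) hv 0 c').const_mul (star a)
  have h3 := HasMean.sum fun i => HasMean.sum fun j =>
    (HasMean.const_mul ⟨integrable_star_mul_eval_cnVec mu hv i j,
      integral_star_mul_eval_cnVec mu hv i j⟩ (star (c i) * c' j))
  have key : ∀ x : ι → ℂ, star (a + ∑ j, c j * x j) * (a' + ∑ j, c' j * x j) =
      star (a + ∑ j, c j * x j) * a' + star a * (0 + ∑ j, c' j * x j) +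
        ∑ i, ∑ j, star (c i) * c' j * (star (x i) * x j) := fun x => by
    have : ∑ i, ∑ j, star (c i) * c' j * (star (x i) * x j) =
        star (∑ j, c j * x j) * ∑ j, c' j * x j := by
      rw [star_sum, Finset.sum_mul_sum]
      refine Finset.sum_congr rfl fun i _ => Finset.sum_congr rfl fun j _ => ?_
      rw [star_mul']; ring
    rw [this, star_add]; ring
  refine ((h1.add h2).add h3).congr key ?_
  rw [key mu]
  simp only [mul_add, Finset.sum_add_distrib, mul_ite, mul_zero, Finset.sum_ite_eq,
    Finset.mem_univ, if_true]
  rw [add_assoc]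
  congr 2
  exact Finset.sum_congr rfl fun j _ => by ring

lemma IsAffineMatrix.expect_conjTranspose {G : (ι → ℂ) → Matrix m n ℂ} (hG : IsAffineMatrix G)
    (hv : ∀ j, 0 < v j) : expect (cnVec mu v) (fun x => (G x)ᴴ) = (G mu)ᴴ := by
  ext i o
  have h := (hasMean_affine_cnVec (mu := mu) hv (G 0 o i) fun j => slopeMatrix G j o i).star
  have hG' : ∀ x o i, G 0 o i + ∑ j, slopeMatrix G j o i * x j = G x o i := fun x o i =>
    (hG x o i).symm
  simp only [hG'] at h
  exact h.2

/-- The right-hand side is polynomial in `mu` and `v` and continuous for all `v`. It replaces the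
integral in passages to the limit, where the limiting variances are not yet known to be positive. -/
lemma IsAffineMatrix.expect_gram [Fintype m] {G : (ι → ℂ) → Matrix m n ℂ} (hG : IsAffineMatrix G)
    (hv : ∀ j, 0 < v j) :
    expect (cnVec mu v) (fun x => (G x)ᴴ * G x) = affineGram G mu v := by
  ext i i'
  have h := HasMean.sum fun o => hasMean_star_affine_mul_affine_cnVec (mu := mu) hv
    (G 0 o i) (G 0 o i') (fun j => slopeMatrix G j o i) (fun j => slopeMatrix G j o i')
  have hG' : ∀ x o i, G 0 o i + ∑ j, slopeMatrix G j o i * x j = G x o i := fun x o i =>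
    (hG x o i).symm
  simp only [hG'] at h
  refine h.2.trans ?_
  simp only [affineGram, Matrix.add_apply, Matrix.mul_apply, Matrix.conjTranspose_apply,
    Matrix.sum_apply, Matrix.smul_apply, smul_eq_mul, Finset.sum_add_distrib, Finset.mul_sum]
  congr 1
  exact Finset.sum_comm

end Affine

namespace Model

variable {mdl : Model M N K Q Tp Td}

lemma isAffineMatrix_A (mdl : Model M N K Q Tp Td) : IsAffineMatrix mdl.A := by
  intro x o i
  rcases o with ⟨t | t, n, m⟩
  · simp [slopeMatrix, A]
  · by_cases h : i.1 ∈ mdl.users t n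
    · have h1 : ∀ j : mdl.DataIdx, (Pi.single j 1 : mdl.DataIdx → ℂ) ⟨(t, n), ⟨i.1, h⟩⟩ =
          if (⟨(t, n), ⟨i.1, h⟩⟩ : mdl.DataIdx) = j then 1 else 0 := fun j => by
        rw [Pi.single_apply]
      simp only [slopeMatrix, A, Matrix.of_apply, Matrix.sub_apply, h, dite_true, h1,
        Pi.zero_apply, zero_mul, sub_zero, zero_add, ite_mul, one_mul, Finset.sum_ite_eq,
        Finset.mem_univ, if_true]
      ring
    · simp [slopeMatrix, A, h]

namespace Params

variable {θ : mdl.Params}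

lemma Valid.expect_A (h : θ.Valid) :
    expect θ.toFactors.qx (fun x => (mdl.A x)ᴴ) = (mdl.A θ.mux)ᴴ :=
  mdl.isAffineMatrix_A.expect_conjTranspose h.varx_pos

lemma Valid.expect_gram_A (h : θ.Valid) :
    expect θ.toFactors.qx (fun x => (mdl.A x)ᴴ * mdl.A x) = affineGram mdl.A θ.mux θ.varx :=
  mdl.isAffineMatrix_A.expect_gram h.varx_pos

/-- The polynomial expression of the expected squared residual. -/
def polyResidual (θ : mdl.Params) : ℝ :=
  ∑ o, ‖mdl.y o‖ ^ 2 - 2 * (star θ.muα ⬝ᵥ ((mdl.A θ.mux)ᴴ *ᵥ mdl.y)).re +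
    (star θ.muα ⬝ᵥ (affineGram mdl.A θ.mux θ.varx *ᵥ θ.muα)).re +
    ∑ i, θ.varα i * (affineGram mdl.A θ.mux θ.varx i i).re

lemma Valid.meanResidual_eq_poly (h : θ.Valid) : θ.meanResidual = θ.polyResidual := by
  have := h.isProb.x
  have := h.isProb.α
  have h1 : θ.meanResidual = _ := integral_sum_sq_norm_sub_mulVec (P := θ.toFactors.qx)
    (P' := θ.toFactors.qα) (U := id) (G := mdl.A) (memLp_A h.hasMoments.memLp_x)
    h.hasMoments.memLp_α (integral_eval_cnVec _ h.varα_pos)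
    (integral_star_mul_eval_cnVec _ h.varα_pos) mdl.y
  rw [h1, h.expect_A, h.expect_gram_A, polyResidual]

end Params

end Model

lemma continuous_gammaLog_comp {X : Type*} [TopologicalSpace X] {a b l m : X → ℝ}
    (ha : Continuous a) (ha' : ∀ x, 0 < a x) (hb : Continuous b) (hb' : ∀ x, 0 < b x)
    (hl : Continuous l) (hm : Continuous m) :
    Continuous fun x => gammaLog (a x) (b x) (l x) (m x) :=
  (((ha.mul (hb.log fun x => (hb' x).ne')).sub (continuousOn_log_Gamma.comp_continuous ha ha')).add
    ((ha.sub continuous_const).mul hl)).sub (hb.mul hm)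

lemma continuous_quadObj_comp {X : Type*} {κ : Type} [Fintype κ] [TopologicalSpace X]
    {W : X → Matrix κ κ ℂ} {b u : X → κ → ℂ} (hW : Continuous W) (hb : Continuous b)
    (hu : Continuous u) : Continuous fun x => quadObj (W x) (b x) (u x) :=
  (Complex.continuous_re.comp (hu.star.dotProduct (hW.matrix_mulVec hu))).sub
    (continuous_const.mul (Complex.continuous_re.comp (hu.star.dotProduct hb)))

namespace Model

variable {mdl : Model M N K Q Tp Td}

namespace Params

/-! ### Continuity in the parameters -/

lemma continuous_toTuple : Continuous (toTuple : mdl.Params → _) := continuous_induced_dom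

lemma continuous_muα : Continuous (muα : mdl.Params → _) := continuous_toTuple.fst

lemma continuous_varα : Continuous (varα : mdl.Params → _) := continuous_toTuple.snd.fst

lemma continuous_mux : Continuous (mux : mdl.Params → _) := continuous_toTuple.snd.snd.fst

lemma continuous_varx : Continuous (varx : mdl.Params → _) := continuous_toTuple.snd.snd.snd.fst

lemma continuous_shapeρ : Continuous (shapeρ : mdl.Params → _) :=
  continuous_toTuple.snd.snd.snd.snd.fst

lemma continuous_rateρ : Continuous (rateρ : mdl.Params → _) :=
  continuous_toTuple.snd.snd.snd.snd.snd.fst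

lemma continuous_probs : Continuous (probs : mdl.Params → _) :=
  continuous_toTuple.snd.snd.snd.snd.snd.snd.fst

lemma continuous_shapeγ : Continuous (shapeγ : mdl.Params → _) :=
  continuous_toTuple.snd.snd.snd.snd.snd.snd.snd.fst

lemma continuous_rateγ : Continuous (rateγ : mdl.Params → _) :=
  continuous_toTuple.snd.snd.snd.snd.snd.snd.snd.snd

lemma tendsto_mk {X : Type*} {l : Filter X} {f : X → mdl.Params} {θ : mdl.Params}
    (h1 : Tendsto (fun x => (f x).muα) l (𝓝 θ.muα))
    (h2 : Tendsto (fun x => (f x).varα) l (𝓝 θ.varα))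
    (h3 : Tendsto (fun x => (f x).mux) l (𝓝 θ.mux))
    (h4 : Tendsto (fun x => (f x).varx) l (𝓝 θ.varx))
    (h5 : Tendsto (fun x => (f x).shapeρ) l (𝓝 θ.shapeρ))
    (h6 : Tendsto (fun x => (f x).rateρ) l (𝓝 θ.rateρ))
    (h7 : Tendsto (fun x => (f x).probs) l (𝓝 θ.probs))
    (h8 : Tendsto (fun x => (f x).shapeγ) l (𝓝 θ.shapeγ))
    (h9 : Tendsto (fun x => (f x).rateγ) l (𝓝 θ.rateγ)) : Tendsto f l (𝓝 θ) := by
  rw [nhds_induced, tendsto_comap_iff]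
  exact h1.prodMk_nhds (h2.prodMk_nhds (h3.prodMk_nhds (h4.prodMk_nhds (h5.prodMk_nhds
    (h6.prodMk_nhds (h7.prodMk_nhds (h8.prodMk_nhds h9)))))))

/-- All shapes and rates are positive. -/
def HasPosRates (θ : mdl.Params) : Prop :=
  (∀ i, 0 < θ.shapeρ i) ∧ (∀ i, 0 < θ.rateρ i) ∧ 0 < θ.shapeγ ∧ 0 < θ.rateγ

/-- The parameters with positive shapes and rates. -/
def PosRates (mdl : Model M N K Q Tp Td) : Type := {θ : mdl.Params // θ.HasPosRates}

instance : TopologicalSpace (PosRates mdl) := instTopologicalSpaceSubtype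

namespace PosRates

lemma continuous_val : Continuous fun θ : PosRates mdl => θ.1 := continuous_subtype_val

lemma continuous_meanρ (i : PathIdx K Q) : Continuous fun θ : PosRates mdl => θ.1.meanρ i :=
  ((continuous_apply i).comp (continuous_shapeρ.comp continuous_val)).div
    ((continuous_apply i).comp (continuous_rateρ.comp continuous_val)) fun θ => (θ.2.2.1 i).ne'

lemma continuous_meanLogρ (i : PathIdx K Q) : Continuous fun θ : PosRates mdl => θ.1.meanLogρ i :=
  (continuousOn_psi.comp_continuous
    ((continuous_apply i).comp (continuous_shapeρ.comp continuous_val)) fun θ => θ.2.1 i).sub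
    (((continuous_apply i).comp (continuous_rateρ.comp continuous_val)).log
      fun θ => (θ.2.2.1 i).ne')

lemma continuous_meanγ : Continuous fun θ : PosRates mdl => θ.1.meanγ :=
  (continuous_shapeγ.comp continuous_val).div (continuous_rateγ.comp continuous_val)
    fun θ => θ.2.2.2.2.ne'

lemma continuous_meanLogγ : Continuous fun θ : PosRates mdl => θ.1.meanLogγ :=
  (continuousOn_psi.comp_continuous (continuous_shapeγ.comp continuous_val)
    fun θ => θ.2.2.2.1).sub
    ((continuous_rateγ.comp continuous_val).log fun θ => θ.2.2.2.2.ne')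

lemma continuous_objρ : Continuous fun θ : PosRates mdl => θ.1.objρ :=
  continuous_finsetSum _ fun i _ => (continuous_gammaLog_comp
    ((continuous_apply i).comp (continuous_shapeρ.comp continuous_val)) (fun θ => θ.2.1 i)
    ((continuous_apply i).comp (continuous_rateρ.comp continuous_val)) (fun θ => θ.2.2.1 i)
    (continuous_meanLogρ i) (continuous_meanρ i)).sub (continuous_meanLogρ i)

lemma continuous_probs_apply (i : PathIdx K Q) : Continuous fun θ : PosRates mdl => θ.1.probs i :=
  (continuous_apply i).comp (continuous_probs.comp continuous_val)

lemma continuous_objs : Continuous fun θ : PosRates mdl => θ.1.objs := by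
  refine continuous_finsetSum _ fun i _ => ?_
  have h := continuous_probs_apply (mdl := mdl) i
  have h' := (continuous_const (y := (1 : ℝ))).sub h
  -- Regrouping produces `p * log p`, which is continuous also at zero, whereas `Real.log` is not.
  simp only [mul_sub (_ : ℝ) (Real.log _)]
  exact ((Real.continuous_mul_log.comp h).sub (h.mul continuous_const)).add
    ((Real.continuous_mul_log.comp h').sub (h'.mul continuous_const))

lemma continuous_objsρ : Continuous fun θ : PosRates mdl => θ.1.objsρ := by
  refine continuous_finsetSum _ fun i _ => ?_
  have h := continuous_probs_apply (mdl := mdl) i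
  exact (h.mul (continuous_gammaLog_comp continuous_const (fun _ => mdl.a_pos i) continuous_const
    (fun _ => mdl.b_pos i) (continuous_meanLogρ i) (continuous_meanρ i))).add
    ((continuous_const.sub h).mul (continuous_gammaLog_comp continuous_const
    (fun _ => mdl.abar_pos i) continuous_const (fun _ => mdl.bbar_pos i) (continuous_meanLogρ i)
    (continuous_meanρ i)))

lemma continuous_objγ : Continuous fun θ : PosRates mdl => θ.1.objγ :=
  ((continuous_gammaLog_comp (continuous_shapeγ.comp continuous_val) (fun θ => θ.2.2.2.1)
    (continuous_rateγ.comp continuous_val) (fun θ => θ.2.2.2.2) continuous_meanLogγ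
    continuous_meanγ).sub (continuous_gammaLog_comp continuous_const (fun _ => mdl.c_pos)
    continuous_const (fun _ => mdl.d_pos) continuous_meanLogγ continuous_meanγ)).sub
    (continuous_const.mul (continuous_meanLogγ.sub continuous_const))

end PosRates

lemma continuous_gram_A :
    Continuous fun θ : mdl.Params => affineGram mdl.A θ.mux θ.varx :=
  continuous_affineGram mdl.continuous_A continuous_mux continuous_varx

lemma continuous_polyResidual : Continuous fun θ : mdl.Params => θ.polyResidual := by
  have hA : Continuous fun θ : mdl.Params => (mdl.A θ.mux)ᴴ :=
    (mdl.continuous_A.comp continuous_mux).matrix_conjTranspose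
  have hm := continuous_muα (mdl := mdl)
  refine Continuous.add (Continuous.add (Continuous.sub continuous_const
    (continuous_const.mul (Complex.continuous_re.comp (hm.star.dotProduct
      (hA.matrix_mulVec continuous_const))))) (Complex.continuous_re.comp (hm.star.dotProduct
      (continuous_gram_A.matrix_mulVec hm)))) (continuous_finsetSum _ fun i _ => ?_)
  exact ((continuous_apply i).comp continuous_varα).mul
    (Complex.continuous_re.comp (continuous_gram_A.matrix_elem i i))

/-- The objective without the logarithms of the variances, as a function that is continuous also at
parameters with vanishing variances. -/
def objCore (θ : mdl.Params) : ℝ :=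
  ∑ j, (Real.log (mdl.dataVar j) + (‖θ.mux j‖ ^ 2 + θ.varx j) / mdl.dataVar j - 1) -
    ∑ _i : PathIdx K Q, 1 + θ.objρ + θ.objs + θ.objγ - θ.objsρ +
    ∑ i, θ.meanρ i * (‖θ.muα i‖ ^ 2 + θ.varα i) + θ.meanγ * θ.polyResidual

lemma Valid.obj_eq_objCore {θ : mdl.Params} (h : θ.Valid) :
    θ.obj = θ.objCore - ∑ i, Real.log (θ.varα i) - ∑ j, Real.log (θ.varx j) := by
  rw [obj, objCore, h.meanResidual_eq_poly]
  simp only [Finset.sum_sub_distrib, Finset.sum_add_distrib, Finset.sum_neg_distrib]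
  ring

lemma PosRates.continuous_objCore : Continuous fun θ : PosRates mdl => θ.1.objCore := by
  have hx : ∀ j, Continuous fun θ : PosRates mdl => θ.1.mux j := fun j =>
    (continuous_apply j).comp (continuous_mux.comp continuous_val)
  have hv : ∀ j, Continuous fun θ : PosRates mdl => θ.1.varx j := fun j =>
    (continuous_apply j).comp (continuous_varx.comp continuous_val)
  have ha : ∀ j, Continuous fun θ : PosRates mdl => θ.1.muα j := fun j =>
    (continuous_apply j).comp (continuous_muα.comp continuous_val)
  have hw : ∀ j, Continuous fun θ : PosRates mdl => θ.1.varα j := fun j =>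
    (continuous_apply j).comp (continuous_varα.comp continuous_val)
  have h1 := continuous_objρ (mdl := mdl)
  have h2 := continuous_objs (mdl := mdl)
  have h3 := continuous_objγ (mdl := mdl)
  have h4 := continuous_objsρ (mdl := mdl)
  have h5 := continuous_meanγ (mdl := mdl)
  have h6 := (continuous_polyResidual (mdl := mdl)).comp continuous_val
  have h7 := continuous_meanρ (mdl := mdl)
  unfold objCore
  refine Continuous.add (Continuous.add (((Continuous.add (Continuous.sub
    (continuous_finsetSum _ fun j _ => ?_) continuous_const) h1).add h2).add h3 |>.sub h4)
    (continuous_finsetSum _ fun i _ => (h7 i).mul (((ha i).norm.pow 2).add (hw i)))) (h5.mul h6)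
  exact (continuous_const.add ((((hx j).norm.pow 2).add (hv j)).div_const _)).sub continuous_const

/-! ### The matrices of the Gaussian updates -/

/-- The polynomial expression of `Wα`. -/
def polyWα (θ : mdl.Params) : Matrix (PathIdx K Q) (PathIdx K Q) ℂ :=
  Matrix.diagonal (fun i => (θ.meanρ i : ℂ)) + (θ.meanγ : ℂ) • affineGram mdl.A θ.mux θ.varx

/-- The polynomial expression of `bα`. -/
def polybα (θ : mdl.Params) : PathIdx K Q → ℂ :=
  (θ.meanγ : ℂ) • ((mdl.A θ.mux)ᴴ *ᵥ mdl.y)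

section

variable {θ : mdl.Params}

lemma Valid.Wα_eq (h : θ.Valid) : θ.Wα = θ.polyWα := by rw [Wα, polyWα, h.expect_gram_A]

lemma Valid.bα_eq (h : θ.Valid) : θ.bα = θ.polybα := by rw [bα, polybα, h.expect_A]

end

namespace PosRates

lemma continuous_ofReal_meanγ : Continuous fun θ : PosRates mdl => (θ.1.meanγ : ℂ) :=
  Complex.continuous_ofReal.comp continuous_meanγ

lemma continuous_polyWα : Continuous fun θ : PosRates mdl => θ.1.polyWα :=
  (Continuous.matrix_diagonal (continuous_pi fun i =>
    Complex.continuous_ofReal.comp (continuous_meanρ i))).add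
    (continuous_ofReal_meanγ.smul (continuous_gram_A.comp continuous_val))

lemma continuous_polybα : Continuous fun θ : PosRates mdl => θ.1.polybα :=
  continuous_ofReal_meanγ.smul ((mdl.continuous_A.comp
    (continuous_mux.comp continuous_val)).matrix_conjTranspose.matrix_mulVec continuous_const)

lemma continuous_gammaWeight (a b : ℝ) (i : PathIdx K Q) :
    Continuous fun θ : PosRates mdl => θ.1.gammaWeight a b i :=
  continuous_const.mul (((continuous_const.mul (continuous_meanLogρ i)).sub
    (continuous_const.mul (continuous_meanρ i))).rexp)

lemma continuous_updateS_probs (i : PathIdx K Q) :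
    Continuous fun θ : PosRates mdl => θ.1.updateS.probs i :=
  (continuous_const.mul (continuous_gammaWeight _ _ i)).div
    ((continuous_const.mul (continuous_gammaWeight _ _ i)).add
      (continuous_const.mul (continuous_gammaWeight _ _ i))) fun θ => (θ.1.weightSum_pos i).ne'

end PosRates

end Params

end Model

/-- The inequality `log t ≤ t - 1` is strict for `t ≠ 1`, so the optimal variance is unique. -/
lemma eq_inv_of_neg_log_add_mul_le {w v : ℝ} (hw : 0 < w) (hv : 0 < v)
    (h : -Real.log v + v * w ≤ -Real.log w⁻¹ + w⁻¹ * w) : v = w⁻¹ := by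
  by_contra hne
  have h1 : v * w ≠ 1 := fun h1 => hne (eq_inv_of_mul_eq_one_left h1)
  have h2 := Real.log_lt_sub_one_of_pos (mul_pos hv hw) h1
  rw [Real.log_mul hv.ne' hw.ne'] at h2
  rw [inv_mul_cancel₀ hw.ne', Real.log_inv] at h
  linarith

namespace Model

variable {mdl : Model M N K Q Tp Td}

namespace Params

variable {θ : mdl.Params}

/-! ### Properties of the iterates -/

/-- Valid parameters whose factors of `s` and `γ` are optimal for the other factors, and whose laws of
`ρ` satisfy the bounds that every update of `ρ` guarantees. -/
structure IsUpdated (θ : mdl.Params) : Prop extends θ.Valid where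
  one_le_shapeρ : ∀ i, 1 ≤ θ.shapeρ i
  min_le_rateρ : ∀ i, min (mdl.b i) (mdl.bbar i) ≤ θ.rateρ i
  updateS_eq : θ.updateS = θ
  updateγ_eq : θ.updateγ = θ

lemma IsUpdated.compatible (h : θ.IsUpdated) : θ.Compatible := by
  have := θ.compatible_updateS
  rwa [h.updateS_eq] at this

lemma Valid.isUpdated_iteration (h : θ.Valid) (arm : ArmijoRule) (B : ℕ)
    (S : Finset (PathIdx K Q)) : (θ.iteration arm B S).IsUpdated where
  toValid := h.iteration arm B S
  one_le_shapeρ i := by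
    have hp := h.probs_mem i
    have h1 := mul_nonneg hp.1 (mdl.a_pos i).le
    have h2 := mul_nonneg (sub_nonneg.mpr hp.2) (mdl.abar_pos i).le
    change 1 ≤ θ.probs i * mdl.a i + (1 - θ.probs i) * mdl.abar i + 1
    linarith
  min_le_rateρ i := by
    have hp := h.probs_mem i
    have hv := (h.updateα arm B S).varα_pos i
    have h1 := mul_le_mul_of_nonneg_left (min_le_left (mdl.b i) (mdl.bbar i)) hp.1
    have h2 := mul_le_mul_of_nonneg_left (min_le_right (mdl.b i) (mdl.bbar i))
      (sub_nonneg.mpr hp.2)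
    have h3 := sq_nonneg ‖(θ.updateα arm B S).muα i‖
    change min (mdl.b i) (mdl.bbar i) ≤ θ.probs i * mdl.b i + (1 - θ.probs i) * mdl.bbar i +
      (‖(θ.updateα arm B S).muα i‖ ^ 2 + (θ.updateα arm B S).varα i)
    linarith
  -- The step in `s` is followed only by those in `x` and `γ`, which leave untouched the law of `ρ`
  -- that determines it; the step in `γ` comes last.
  updateS_eq := Params.ext rfl rfl rfl rfl rfl rfl rfl rfl rfl
  updateγ_eq := Params.ext rfl rfl rfl rfl rfl rfl rfl rfl rfl

/-! ### Limits of the iterates -/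

section Limit

variable {Θ : ℕ → mdl.Params}

lemma tendsto_apply {ι : Type*} {f : mdl.Params → ι → ℝ} (hf : Continuous f)
    (hlim : Tendsto Θ atTop (𝓝 θ)) (i : ι) :
    Tendsto (fun j => f (Θ j) i) atTop (𝓝 (f θ i)) := by
  have h : Continuous fun θ => f θ i := (continuous_apply i).comp hf
  exact (h.tendsto θ).comp hlim

lemma tendsto_comp {E : Type*} [TopologicalSpace E] {f : mdl.Params → E}
    (hf : Continuous fun θ : PosRates mdl => f θ.1) (hΘ : ∀ j, (Θ j).HasPosRates)
    (h : θ.HasPosRates) (hlim : Tendsto Θ atTop (𝓝 θ)) :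
    Tendsto (fun j => f (Θ j)) atTop (𝓝 (f θ)) := by
  have hP : Tendsto (fun j => (⟨Θ j, hΘ j⟩ : PosRates mdl)) atTop (𝓝 ⟨θ, h⟩) :=
    Topology.IsInducing.subtypeVal.tendsto_nhds_iff.mpr hlim
  exact (hf.tendsto ⟨θ, h⟩).comp hP

lemma Valid.hasPosRates (h : θ.Valid) : θ.HasPosRates :=
  ⟨h.shapeρ_pos, h.rateρ_pos, h.shapeγ_pos, h.rateγ_pos⟩

lemma tendsto_obj (hΘ : ∀ j, (Θ j).Valid) (h : θ.Valid) (hlim : Tendsto Θ atTop (𝓝 θ)) :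
    Tendsto (fun j => (Θ j).obj) atTop (𝓝 θ.obj) := by
  have h1 : Tendsto (fun j => (Θ j).objCore) atTop (𝓝 θ.objCore) :=
    tendsto_comp (f := objCore) PosRates.continuous_objCore (fun j => (hΘ j).hasPosRates)
      h.hasPosRates hlim
  have h2 : ∀ i, Tendsto (fun j => (Θ j).varα i) atTop (𝓝 (θ.varα i)) := fun i =>
    tendsto_apply continuous_varα hlim i
  have h3 : ∀ i, Tendsto (fun j => (Θ j).varx i) atTop (𝓝 (θ.varx i)) := fun i =>
    tendsto_apply continuous_varx hlim i
  simp only [fun j => (hΘ j).obj_eq_objCore, h.obj_eq_objCore]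
  exact (h1.sub (tendsto_finsetSum _ fun i _ => (h2 i).log (h.varα_pos i).ne')).sub
    (tendsto_finsetSum _ fun i _ => (h3 i).log (h.varx_pos i).ne')

/-- A bound on `obj` bounds the sum of all `v - log v`. These terms are nonnegative, so each of them
is bounded by the sum, which keeps each variance away from zero. -/
lemma Valid.exp_neg_le_var (h : θ.Valid) {C : ℝ} (hC : θ.obj ≤ C) :
    (∀ i, Real.exp (-(C - θ.objCore + ∑ i, θ.varα i + ∑ j, θ.varx j)) ≤ θ.varα i) ∧
    ∀ j, Real.exp (-(C - θ.objCore + ∑ i, θ.varα i + ∑ j, θ.varx j)) ≤ θ.varx j := by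
  have h1 := h.obj_eq_objCore
  have hg : ∀ {v : ℝ}, 0 < v → 0 ≤ v - Real.log v := fun hv => by
    linarith [Real.log_le_sub_one_of_pos hv]
  have h2 : ∑ i, (θ.varα i - Real.log (θ.varα i)) + ∑ j, (θ.varx j - Real.log (θ.varx j)) ≤
      C - θ.objCore + ∑ i, θ.varα i + ∑ j, θ.varx j := by
    rw [Finset.sum_sub_distrib, Finset.sum_sub_distrib]; linarith
  have h3 : 0 ≤ ∑ i, (θ.varα i - Real.log (θ.varα i)) :=
    Finset.sum_nonneg fun i _ => hg (h.varα_pos i)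
  have h4 : 0 ≤ ∑ j, (θ.varx j - Real.log (θ.varx j)) :=
    Finset.sum_nonneg fun i _ => hg (h.varx_pos i)
  refine ⟨fun i => ?_, fun j => ?_⟩
  · have h5 := Finset.single_le_sum (f := fun i => θ.varα i - Real.log (θ.varα i))
      (fun i _ => hg (h.varα_pos i)) (Finset.mem_univ i)
    rw [← Real.le_log_iff_exp_le (h.varα_pos i)]
    linarith [h.varα_pos i]
  · have h5 := Finset.single_le_sum (f := fun j => θ.varx j - Real.log (θ.varx j))
      (fun j _ => hg (h.varx_pos j)) (Finset.mem_univ j)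
    rw [← Real.le_log_iff_exp_le (h.varx_pos j)]
    linarith [h.varx_pos j]

/-- Strict positivity is not closed under limits, so every part of it needs a uniform bound: the
update rules give it for the laws of `ρ` and `γ`, the bounded objective gives it for the variances.
The fixed-point equations of `s` and `γ` pass to the limit by continuity. -/
lemma isUpdated_of_tendsto (hΘ : ∀ j, (Θ j).IsUpdated) (hlim : Tendsto Θ atTop (𝓝 θ)) {C : ℝ}
    (hC : ∀ j, (Θ j).obj ≤ C) : θ.IsUpdated := by
  have l2 : ∀ i, Tendsto (fun j => (Θ j).varα i) atTop (𝓝 (θ.varα i)) := fun i =>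
    tendsto_apply continuous_varα hlim i
  have l4 : ∀ i, Tendsto (fun j => (Θ j).varx i) atTop (𝓝 (θ.varx i)) := fun i =>
    tendsto_apply continuous_varx hlim i
  have l5 : ∀ i, Tendsto (fun j => (Θ j).shapeρ i) atTop (𝓝 (θ.shapeρ i)) := fun i =>
    tendsto_apply continuous_shapeρ hlim i
  have l6 : ∀ i, Tendsto (fun j => (Θ j).rateρ i) atTop (𝓝 (θ.rateρ i)) := fun i =>
    tendsto_apply continuous_rateρ hlim i
  have l7 : ∀ i, Tendsto (fun j => (Θ j).probs i) atTop (𝓝 (θ.probs i)) := fun i =>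
    tendsto_apply continuous_probs hlim i
  have l8 : Tendsto (fun j => (Θ j).shapeγ) atTop (𝓝 θ.shapeγ) :=
    (continuous_shapeγ.tendsto _).comp hlim
  have l9 : Tendsto (fun j => (Θ j).rateγ) atTop (𝓝 θ.rateγ) :=
    (continuous_rateγ.tendsto _).comp hlim
  have s5 : ∀ i, 1 ≤ θ.shapeρ i := fun i => ge_of_tendsto' (l5 i) fun j => (hΘ j).one_le_shapeρ i
  have s6 : ∀ i, min (mdl.b i) (mdl.bbar i) ≤ θ.rateρ i := fun i =>
    ge_of_tendsto' (l6 i) fun j => (hΘ j).min_le_rateρ i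
  have e8 : ∀ j, (Θ j).shapeγ = mdl.c + mdl.numObs := fun j => by
    conv_lhs => rw [← (hΘ j).updateγ_eq]
    rfl
  have e9 : ∀ j, (Θ j).rateγ = mdl.d + (Θ j).polyResidual := fun j => by
    conv_lhs => rw [← (hΘ j).updateγ_eq]
    rw [← (hΘ j).meanResidual_eq_poly]
    rfl
  have t8 : θ.shapeγ = mdl.c + mdl.numObs :=
    tendsto_nhds_unique l8 (by simp only [e8]; exact tendsto_const_nhds)
  have t9 : θ.rateγ = mdl.d + θ.polyResidual := tendsto_nhds_unique l9 (by
    simp only [e9]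
    exact tendsto_const_nhds.add ((continuous_polyResidual.tendsto _).comp hlim))
  have p5 : ∀ i, 0 < θ.shapeρ i := fun i => one_pos.trans_le (s5 i)
  have p6 : ∀ i, 0 < θ.rateρ i := fun i => (lt_min (mdl.b_pos i) (mdl.bbar_pos i)).trans_le (s6 i)
  have p8 : 0 < θ.shapeγ := by rw [t8]; have := mdl.c_pos; positivity
  have p9 : 0 < θ.rateγ := by
    refine mdl.d_pos.trans_le (ge_of_tendsto' l9 fun j => ?_)
    rw [e9, ← (hΘ j).meanResidual_eq_poly, le_add_iff_nonneg_right]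
    exact integral_nonneg fun p => mdl.residual_nonneg _ _
  have hP : θ.HasPosRates := ⟨p5, p6, p8, p9⟩
  have hcore : Tendsto (fun j => (Θ j).objCore) atTop (𝓝 θ.objCore) :=
    tendsto_comp (f := objCore) PosRates.continuous_objCore (fun j => (hΘ j).hasPosRates) hP hlim
  -- The lower bound of the variances converges to a positive number, because `objCore` is
  -- continuous even where variances vanish.
  have hexp : Tendsto (fun j => Real.exp (-(C - (Θ j).objCore + ∑ i, (Θ j).varα i +
      ∑ i, (Θ j).varx i))) atTop
      (𝓝 (Real.exp (-(C - θ.objCore + ∑ i, θ.varα i + ∑ i, θ.varx i)))) :=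
    (Real.continuous_exp.tendsto _).comp (((tendsto_const_nhds.sub hcore).add
      (tendsto_finsetSum _ fun i _ => l2 i)).add (tendsto_finsetSum _ fun i _ => l4 i)).neg
  have hv : θ.Valid :=
    { varα_pos := fun i => (Real.exp_pos _).trans_le (le_of_tendsto_of_tendsto' hexp (l2 i)
        fun j => ((hΘ j).exp_neg_le_var (hC j)).1 i)
      varx_pos := fun i => (Real.exp_pos _).trans_le (le_of_tendsto_of_tendsto' hexp (l4 i)
        fun j => ((hΘ j).exp_neg_le_var (hC j)).2 i)
      shapeρ_pos := p5
      rateρ_pos := p6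
      probs_mem := fun i => ⟨ge_of_tendsto' (l7 i) fun j => ((hΘ j).probs_mem i).1,
        le_of_tendsto' (l7 i) fun j => ((hΘ j).probs_mem i).2⟩
      shapeγ_pos := p8
      rateγ_pos := p9 }
  refine ⟨hv, s5, s6, Params.ext rfl rfl rfl rfl rfl rfl (funext fun i => ?_) rfl rfl,
    Params.ext rfl rfl rfl rfl rfl rfl rfl t8.symm ?_⟩
  · have h1 : Tendsto (fun j => (Θ j).updateS.probs i) atTop (𝓝 (θ.updateS.probs i)) :=
      tendsto_comp (f := fun θ => θ.updateS.probs i) (PosRates.continuous_updateS_probs i)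
        (fun j => (hΘ j).hasPosRates) hP hlim
    simp only [(hΘ _).updateS_eq] at h1
    exact tendsto_nhds_unique h1 (l7 i)
  · rw [t9, ← hv.meanResidual_eq_poly]
    rfl

end Limit

end Params

end Model

lemma tendsto_of_sum_sq_norm_sub_le {ι : Type} [Fintype ι] {f g : ℕ → ι → ℂ} {a : ι → ℂ}
    {r : ℕ → ℝ} (hg : Tendsto g atTop (𝓝 a)) (hr : Tendsto r atTop (𝓝 0))
    (h : ∀ᶠ j in atTop, ∑ i, ‖(f j - g j) i‖ ^ 2 ≤ r j) : Tendsto f atTop (𝓝 a) := by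
  rw [tendsto_pi_nhds]
  intro i
  have h1 : Tendsto (fun j => ‖(f j - g j) i‖ ^ 2) atTop (𝓝 0) := by
    refine squeeze_zero' (Eventually.of_forall fun j => by positivity) ?_ hr
    filter_upwards [h] with j hj
    exact (Finset.single_le_sum (f := fun i => ‖(f j - g j) i‖ ^ 2)
      (fun _ _ => by positivity) (Finset.mem_univ i)).trans hj
  have h2 : Tendsto (fun j => ‖(f j - g j) i‖) atTop (𝓝 0) := by
    have := (Real.continuous_sqrt.tendsto 0).comp h1
    rw [Real.sqrt_zero] at this
    exact this.congr fun j => Real.sqrt_sq (norm_nonneg _)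
  have h3 := (tendsto_zero_iff_norm_tendsto_zero.mpr h2).add (tendsto_pi_nhds.mp hg i)
  rw [zero_add] at h3
  exact h3.congr fun j => by simp

/-! ### Stationarity of the limit points. -/

namespace Model

variable {mdl : Model M N K Q Tp Td}

namespace Params

variable {θ : mdl.Params}

/-- The new variances are optimal, so their part of the objective can only add to the decrease
caused by the mean. -/
lemma Valid.quadObj_sub_le (h : θ.Valid) (arm : ArmijoRule) (B : ℕ) (S : Finset (PathIdx K Q)) :
    quadObj θ.Wα θ.bα θ.muα - quadObj θ.Wα θ.bα (θ.updateα arm B S).muα ≤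
      θ.obj - (θ.updateα arm B S).obj := by
  have h1 := sum_neg_log_add_mul_ge h.diag_Wα_pos h.varα_pos
  have h2 : (θ.updateα arm B S).obj = _ :=
    h.obj_withα (θ.updateα arm B S).muα fun i => inv_pos.mpr (h.diag_Wα_pos i)
  rw [h2, h.obj_eq_gaussObj_α, gaussObj, gaussObj]
  linarith

lemma Valid.varα_eq_of_obj_le (h : θ.Valid)
    (hle : θ.obj ≤ ({ θ with varα := fun i => (θ.Wα i i).re⁻¹ } : mdl.Params).obj) :
    θ.varα = fun i => (θ.Wα i i).re⁻¹ := by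
  have h2 : ({ θ with varα := fun i => (θ.Wα i i).re⁻¹ } : mdl.Params).obj = _ :=
    h.obj_withα θ.muα fun i => inv_pos.mpr (h.diag_Wα_pos i)
  rw [h2, h.obj_eq_gaussObj_α, gaussObj, gaussObj] at hle
  have h3 : ∑ i, (-Real.log (θ.varα i) + θ.varα i * (θ.Wα i i).re) ≤
      ∑ i, (-Real.log ((θ.Wα i i).re⁻¹) + (θ.Wα i i).re⁻¹ * (θ.Wα i i).re) := by linarith
  have h4 := fun i (_ : i ∈ Finset.univ) => neg_log_add_mul_ge (h.diag_Wα_pos i) (h.varα_pos i)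
  -- Equality of the sums, with inequalities termwise, forces equality in every term.
  have h5 := (Finset.sum_eq_sum_iff_of_le h4).mp (le_antisymm (Finset.sum_le_sum h4) h3)
  funext i
  exact eq_inv_of_neg_log_add_mul_le (h.diag_Wα_pos i) (h.varα_pos i)
    (h5 i (Finset.mem_univ i)).ge

/-- `Wx` and `bx` depend only on the laws of `α` and `γ`, so the gain from changing `x` is not
affected by the steps in `ρ` and `s`. Thus convergence of those intermediate updates need not be
known. -/
lemma Valid.obj_updateS_sub_withx (h : θ.Valid) (u : mdl.DataIdx → ℂ) {v : mdl.DataIdx → ℝ}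
    (hv : ∀ j, 0 < v j) :
    θ.updateρ.updateS.obj -
        ({ θ.updateρ.updateS with mux := u, varx := v } : mdl.Params).obj =
      θ.obj - ({ θ with mux := u, varx := v } : mdl.Params).obj := by
  have h' := h.updateρ.updateS
  have hW : ∀ τ, θ.updateρ.updateS.Wx τ = θ.Wx τ := fun _ => rfl
  have hb : ∀ τ, θ.updateρ.updateS.bx τ = θ.bx τ := fun _ => rfl
  have hm : θ.updateρ.updateS.mux = θ.mux := rfl
  have hx : θ.updateρ.updateS.varx = θ.varx := rfl
  rw [h.obj_withx u hv, h.obj_eq_gaussObj_x, h'.obj_withx u hv, h'.obj_eq_gaussObj_x,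
    add_sub_add_right_eq_sub, add_sub_add_right_eq_sub]
  simp only [hW, hb, hm, hx]

lemma toFactors_withα (θ : mdl.Params) (u : PathIdx K Q → ℂ) (v : PathIdx K Q → ℝ) :
    ({ θ with muα := u, varα := v } : mdl.Params).toFactors =
      { θ.toFactors with qα := cnVec u v } := rfl

lemma toFactors_withx (θ : mdl.Params) (u : mdl.DataIdx → ℂ) (v : mdl.DataIdx → ℝ) :
    ({ θ with mux := u, varx := v } : mdl.Params).toFactors =
      { θ.toFactors with qx := cnVec u v } := rfl

section Limit

variable {Θ : ℕ → mdl.Params} {arm : ArmijoRule} {B : ℕ} {S : ℕ → Finset (PathIdx K Q)}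

lemma tendsto_withα (hlim : Tendsto Θ atTop (𝓝 θ)) {u : ℕ → PathIdx K Q → ℂ}
    {v : ℕ → PathIdx K Q → ℝ} {u' : PathIdx K Q → ℂ} {v' : PathIdx K Q → ℝ}
    (hu : Tendsto u atTop (𝓝 u')) (hv : Tendsto v atTop (𝓝 v')) :
    Tendsto (fun j => ({ Θ j with muα := u j, varα := v j } : mdl.Params)) atTop
      (𝓝 { θ with muα := u', varα := v' }) := by
  have m3 := (continuous_mux.tendsto θ).comp hlim
  have m4 := (continuous_varx.tendsto θ).comp hlim
  have m5 := (continuous_shapeρ.tendsto θ).comp hlim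
  have m6 := (continuous_rateρ.tendsto θ).comp hlim
  have m7 := (continuous_probs.tendsto θ).comp hlim
  have m8 := (continuous_shapeγ.tendsto θ).comp hlim
  have m9 := (continuous_rateγ.tendsto θ).comp hlim
  exact tendsto_mk hu hv m3 m4 m5 m6 m7 m8 m9

lemma tendsto_withx (hlim : Tendsto Θ atTop (𝓝 θ)) (u : mdl.DataIdx → ℂ) (v : mdl.DataIdx → ℝ) :
    Tendsto (fun j => ({ Θ j with mux := u, varx := v } : mdl.Params)) atTop
      (𝓝 { θ with mux := u, varx := v }) := by
  have m1 := (continuous_muα.tendsto θ).comp hlim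
  have m2 := (continuous_varα.tendsto θ).comp hlim
  have m5 := (continuous_shapeρ.tendsto θ).comp hlim
  have m6 := (continuous_rateρ.tendsto θ).comp hlim
  have m7 := (continuous_probs.tendsto θ).comp hlim
  have m8 := (continuous_shapeγ.tendsto θ).comp hlim
  have m9 := (continuous_rateγ.tendsto θ).comp hlim
  exact tendsto_mk m1 m2 tendsto_const_nhds tendsto_const_nhds m5 m6 m7 m8 m9

lemma tendsto_withρ (hlim : Tendsto Θ atTop (𝓝 θ)) (u v : PathIdx K Q → ℝ) :
    Tendsto (fun j => ({ Θ j with shapeρ := u, rateρ := v } : mdl.Params)) atTop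
      (𝓝 { θ with shapeρ := u, rateρ := v }) := by
  have m1 := (continuous_muα.tendsto θ).comp hlim
  have m2 := (continuous_varα.tendsto θ).comp hlim
  have m3 := (continuous_mux.tendsto θ).comp hlim
  have m4 := (continuous_varx.tendsto θ).comp hlim
  have m7 := (continuous_probs.tendsto θ).comp hlim
  have m8 := (continuous_shapeγ.tendsto θ).comp hlim
  have m9 := (continuous_rateγ.tendsto θ).comp hlim
  exact tendsto_mk m1 m2 m3 m4 tendsto_const_nhds tendsto_const_nhds m7 m8 m9

/-- One pair of curvature bounds for a whole tail of the sequence makes the descent constant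
independent of `j`. -/
lemma exists_uniform_Wα_bounds (hΘ : ∀ j, (Θ j).Valid) (h : θ.Valid)
    (hlim : Tendsto Θ atTop (𝓝 θ)) : ∃ lo hi, 0 < lo ∧ 0 < hi ∧ ∀ᶠ j in atTop,
      (∀ u, lo * ∑ i, ‖u i‖ ^ 2 ≤ (star u ⬝ᵥ ((Θ j).Wα *ᵥ u)).re) ∧
      ∀ u, (star u ⬝ᵥ ((Θ j).Wα *ᵥ u)).re ≤ hi * ∑ i, ‖u i‖ ^ 2 := by
  obtain ⟨lo, hlo, hle⟩ := exists_pos_le h.meanρ_pos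
  have hp := fun j => (hΘ j).hasPosRates
  have h1 : ∀ i, ∀ᶠ j in atTop, lo / 2 ≤ (Θ j).meanρ i := fun i =>
    (tendsto_comp (f := fun θ => θ.meanρ i) (PosRates.continuous_meanρ i) hp h.hasPosRates
      hlim).eventually_const_le (by linarith [hle i])
  have hc : Continuous fun θ : PosRates mdl => ∑ i, ∑ k, ‖θ.1.polyWα i k‖ :=
    continuous_finsetSum _ fun i _ => continuous_finsetSum _ fun k _ =>
      (PosRates.continuous_polyWα.matrix_elem i k).norm
  have h2 : ∀ᶠ j in atTop, ∑ i, ∑ k, ‖(Θ j).polyWα i k‖ ≤ ∑ i, ∑ k, ‖θ.polyWα i k‖ + 1 :=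
    (tendsto_comp (f := fun θ => ∑ i, ∑ k, ‖θ.polyWα i k‖) hc hp h.hasPosRates
      hlim).eventually_le_const (lt_add_one _)
  refine ⟨lo / 2, ∑ i, ∑ k, ‖θ.polyWα i k‖ + 1, by positivity, by positivity, ?_⟩
  filter_upwards [eventually_all.mpr h1, h2] with j hj1 hj2
  refine ⟨(hΘ j).Wα_ge hj1, fun u => (re_star_dotProduct_mulVec_le (Θ j).Wα u).trans ?_⟩
  rw [(hΘ j).Wα_eq]
  exact mul_le_mul_of_nonneg_right hj2 (by positivity)

/-- The limit of parameters along which one iteration decreases the objective by amounts that tend to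
zero is a fixed point of the update of the variances of `α`, its mean of `α` is optimal, and the
update of `α` is continuous there. -/
lemma tendsto_updateα (hΘ : ∀ j, (Θ j).Valid) (h : θ.Valid)
    (hlim : Tendsto Θ atTop (𝓝 θ)) (hB : 1 ≤ B)
    (hgap : Tendsto (fun j => (Θ j).obj - ((Θ j).updateα arm B (S j)).obj) atTop (𝓝 0)) :
    Tendsto (fun j => (Θ j).updateα arm B (S j)) atTop (𝓝 θ) ∧
      (∀ w, quadObj θ.Wα θ.bα θ.muα ≤ quadObj θ.Wα θ.bα w) ∧
      θ.varα = fun i => (θ.Wα i i).re⁻¹ := by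
  obtain ⟨lo, hi, hlo, hhi, hbd⟩ := exists_uniform_Wα_bounds hΘ h hlim
  obtain ⟨C, hC, hdesc⟩ := arm.exists_descent_const (ι := PathIdx K Q) hlo hhi
  have hp := fun j => (hΘ j).hasPosRates
  have hmuα : Tendsto (fun j => (Θ j).muα) atTop (𝓝 θ.muα) := (continuous_muα.tendsto θ).comp hlim
  have hCgap : Tendsto (fun j => C * ((Θ j).obj - ((Θ j).updateα arm B (S j)).obj)) atTop (𝓝 0) := by
    have := hgap.const_mul C
    rwa [mul_zero] at this
  -- Since `C` does not depend on `j` or on the support estimates, both right-hand sides tend to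
  -- zero with the decrease.
  have key : ∀ᶠ j in atTop,
      (∀ w, quadObj (Θ j).Wα (Θ j).bα (Θ j).muα - quadObj (Θ j).Wα (Θ j).bα w ≤
        C * ((Θ j).obj - ((Θ j).updateα arm B (S j)).obj)) ∧
      ∑ i, ‖(((Θ j).updateα arm B (S j)).muα - (Θ j).muα) i‖ ^ 2 ≤
        C * ((Θ j).obj - ((Θ j).updateα arm B (S j)).obj) := by
    filter_upwards [hbd] with j hj
    obtain ⟨-, h2, h3⟩ := hdesc (Θ j).Wα (Θ j).bα (Θ j).muα (S j) B (Θ j).isHermitian_Wα hj.1 hj.2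
      hB ((Θ j).updateα arm B (S j)).muα rfl
    have h4 := mul_le_mul_of_nonneg_left ((hΘ j).quadObj_sub_le arm B (S j)) hC.le
    exact ⟨fun w => (h2 w).trans h4, h3.trans h4⟩
  have hopt : ∀ w, quadObj θ.Wα θ.bα θ.muα ≤ quadObj θ.Wα θ.bα w := fun w => by
    have hc : Continuous fun θ : PosRates mdl =>
        quadObj θ.1.polyWα θ.1.polybα θ.1.muα - quadObj θ.1.polyWα θ.1.polybα w :=
      (continuous_quadObj_comp PosRates.continuous_polyWα PosRates.continuous_polybα
        (continuous_muα.comp PosRates.continuous_val)).sub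
      (continuous_quadObj_comp PosRates.continuous_polyWα PosRates.continuous_polybα
        continuous_const)
    have h1 := tendsto_comp (f := fun θ => quadObj θ.polyWα θ.polybα θ.muα -
      quadObj θ.polyWα θ.polybα w) hc hp h.hasPosRates hlim
    rw [h.Wα_eq, h.bα_eq, ← sub_nonpos]
    refine le_of_tendsto_of_tendsto h1 hCgap ?_
    filter_upwards [key] with j hj
    have := hj.1 w
    rwa [(hΘ j).Wα_eq, (hΘ j).bα_eq] at this
  have hmu' : Tendsto (fun j => ((Θ j).updateα arm B (S j)).muα) atTop (𝓝 θ.muα) :=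
    tendsto_of_sum_sq_norm_sub_le hmuα hCgap (key.mono fun j hj => hj.2)
  have hvar : Tendsto (fun j => ((Θ j).updateα arm B (S j)).varα) atTop
      (𝓝 fun i => (θ.Wα i i).re⁻¹) := by
    refine tendsto_pi_nhds.mpr fun i => ?_
    have hc : Continuous fun θ : PosRates mdl => (θ.1.polyWα i i).re :=
      Complex.continuous_re.comp (PosRates.continuous_polyWα.matrix_elem i i)
    have h1 := tendsto_comp (f := fun θ => (θ.polyWα i i).re) hc hp h.hasPosRates hlim
    have h2 := h.diag_Wα_pos i
    simp only [updateα, fun j => (hΘ j).Wα_eq]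
    rw [h.Wα_eq] at h2 ⊢
    exact h1.inv₀ h2.ne'
  have hlim' : Tendsto (fun j => (Θ j).updateα arm B (S j)) atTop
      (𝓝 ({ θ with varα := fun i => (θ.Wα i i).re⁻¹ } : mdl.Params)) :=
    tendsto_withα hlim hmu' hvar
  -- The objective before and after the step converges to its values at `θ` and at `θ` with optimal
  -- variances. The decrease tends to zero, so the two values agree, and uniqueness of the optimal
  -- variances identifies `θ.varα`.
  have hobj := (tendsto_obj hΘ h hlim).sub (tendsto_obj (fun j => (hΘ j).updateα arm B (S j))
    (h.withα θ.muα fun i => inv_pos.mpr (h.diag_Wα_pos i)) hlim')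
  have hvarα := h.varα_eq_of_obj_le (sub_eq_zero.mp (tendsto_nhds_unique hobj hgap)).le
  refine ⟨?_, hopt, hvarα⟩
  rw [← hvarα] at hlim'
  exact hlim'

/-- The limit of updated parameters along which one iteration decreases the objective by amounts that
tend to zero is a stationary solution. -/
lemma isStationary_of_tendsto (hΘ : ∀ j, (Θ j).Valid) (h : θ.IsUpdated)
    (hc : ∀ j, (Θ j).Compatible) (hlim : Tendsto Θ atTop (𝓝 θ)) (hB : 1 ≤ B)
    (hgap : Tendsto (fun j => (Θ j).obj - ((Θ j).iteration arm B (S j)).obj) atTop (𝓝 0)) :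
    mdl.IsStationary θ.toFactors := by
  have h1 : ∀ j, ((Θ j).updateα arm B (S j)).Valid := fun j => (hΘ j).updateα arm B (S j)
  have g0 : ∀ j, ((Θ j).updateα arm B (S j)).obj ≤ (Θ j).obj := fun j =>
    (hΘ j).obj_updateα_le arm hB (S j)
  have g1 : ∀ j, ((Θ j).updateα arm B (S j)).updateρ.obj ≤ ((Θ j).updateα arm B (S j)).obj :=
    fun j => (h1 j).obj_updateρ_le (hc j)
  have g2 : ∀ j, ((Θ j).updateα arm B (S j)).updateρ.updateS.obj ≤
      ((Θ j).updateα arm B (S j)).updateρ.obj := fun j => (h1 j).updateρ.obj_updateS_le (hc j)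
  have g3 : ∀ j, ((Θ j).iteration arm B (S j)).obj ≤ ((Θ j).updateα arm B (S j)).updateρ.obj :=
    fun j => (hΘ j).obj_iteration_le_updateρ (hc j) arm B (S j)
  have g4 : ∀ j, ((Θ j).iteration arm B (S j)).obj ≤
      ((Θ j).updateα arm B (S j)).updateρ.updateS.updateX.obj :=
    fun j => (hΘ j).obj_iteration_le_updateS arm B (S j)
  -- No later step raises the objective, so the decrease of the step in `α` is at most that of the
  -- whole iteration.
  have hgapα : Tendsto (fun j => (Θ j).obj - ((Θ j).updateα arm B (S j)).obj) atTop (𝓝 0) :=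
    squeeze_zero (fun j => sub_nonneg.mpr (g0 j)) (fun j => by linarith [g1 j, g3 j]) hgap
  obtain ⟨hlim', hopt, hvar⟩ := tendsto_updateα hΘ h.toValid hlim hB hgapα
  have hobj := tendsto_obj h1 h.toValid hlim'
  have hle : ∀ {θ' : mdl.Params}, θ'.Valid → θ'.Compatible → θ.obj ≤ θ'.obj →
      mdl.kld θ.toFactors ≤ mdl.kld θ'.toFactors := fun hv' hc' =>
    (h.kld_le_iff h.compatible hv' hc').mpr
  have hJ := mdl.jointMeasure_univ_ne_zero
  refine ⟨⟨⟨_, _, h.varα_pos, rfl⟩, ⟨_, _, h.varx_pos, rfl⟩, h.isProb.ρ, h.isProb.s, h.isProb.γ⟩,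
    fun u v hv => ?_, fun u v hv => ?_, fun r hr => ?_, fun r hr => ?_, fun r hr => ?_⟩
  · rw [← toFactors_withα]
    refine hle (h.withα u hv) h.compatible ?_
    rw [h.obj_withα u hv, h.obj_eq_gaussObj_α, hvar]
    exact add_le_add_left (gaussObj_le_gaussObj h.diag_Wα_pos hv (hopt u)) _
  · rw [← toFactors_withx]
    refine hle (h.withx u hv) h.compatible ?_
    -- The competitor is the same for all `j`, so continuity of `obj` is enough and no continuity of
    -- the update of `x` is used.
    have hlimx : Tendsto (fun j =>
        ({ (Θ j).updateα arm B (S j) with mux := u, varx := v } : mdl.Params)) atTop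
        (𝓝 ({ θ with mux := u, varx := v } : mdl.Params)) :=
      tendsto_withx hlim' u v
    have hobjx := tendsto_obj (fun j => (h1 j).withx u hv) (h.withx u hv) hlimx
    rw [← sub_nonpos]
    refine le_of_tendsto_of_tendsto' (hobj.sub hobjx) hgap fun j => ?_
    rw [← (h1 j).obj_updateS_sub_withx u hv]
    linarith [(h1 j).updateρ.updateS.obj_updateX_le_withx u hv, g0 j, g1 j, g2 j, g4 j]
  -- It suffices to compare with the exact minimizer at `θ`. Its shapes and rates, fixed in `j`, are
  -- competitors for the update of `ρ` along the sequence.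
  · refine le_trans ?_ (h.kld_updateρ_le hJ h.compatible r)
    refine hle h.updateρ h.compatible ?_
    have hlimρ : Tendsto (fun j => ({ (Θ j).updateα arm B (S j) with
        shapeρ := θ.updateρ.shapeρ, rateρ := θ.updateρ.rateρ } : mdl.Params)) atTop
        (𝓝 θ.updateρ) :=
      tendsto_withρ hlim' θ.updateρ.shapeρ θ.updateρ.rateρ
    have hv := h.updateρ
    have hobjρ := tendsto_obj (fun j => (h1 j).withρ hv.shapeρ_pos hv.rateρ_pos) hv hlimρ
    rw [← sub_nonpos]
    refine le_of_tendsto_of_tendsto' (hobj.sub hobjρ) hgap fun j => ?_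
    linarith [(h1 j).obj_updateρ_le_withρ (hc j) hv.shapeρ_pos hv.rateρ_pos, g0 j, g3 j]
  · have := h.kld_updateS_le hJ r
    rwa [h.updateS_eq] at this
  · have := h.kld_updateγ_le hJ h.compatible r
    rwa [h.updateγ_eq] at this

end Limit

end Params

/-- The limit of a convergent subsequence of the iterates is a stationary solution. -/
lemma isStationary_of_tendsto_iterates {θ₀ : mdl.Params} (h : θ₀.Valid) (arm : ArmijoRule) {B : ℕ}
    (hB : 1 ≤ B) (S : ℕ → Finset (PathIdx K Q)) {θ : mdl.Params} {φ : ℕ → ℕ} (hφ : StrictMono φ)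
    (hlim : Tendsto (fun j => mdl.iterates arm B S θ₀ (φ j)) atTop (𝓝 θ)) :
    mdl.IsStationary θ.toFactors := by
  have hv := iterates_valid h arm B S
  have hu : ∀ t, (mdl.iterates arm B S θ₀ (t + 1)).IsUpdated := fun t =>
    (hv t).isUpdated_iteration arm B (S t)
  have hanti : Antitone fun t => (mdl.iterates arm B S θ₀ (t + 1)).obj :=
    antitone_nat_of_succ_le fun t => (hu t).obj_iteration_le (hu t).compatible arm hB (S (t + 1))
  -- Dropping the first term ensures `φ (j + 1) ≥ 1`, so only iterates produced by an iteration
  -- occur; the initial parameters may have infinite divergence.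
  set ψ : ℕ → ℕ := fun j => φ (j + 1) - 1 with hψ
  have hψ' : ∀ j, ψ j + 1 = φ (j + 1) := fun j => by
    have := hφ.le_apply (x := j + 1)
    simp only [hψ]
    omega
  have hψt : Tendsto ψ atTop atTop := by
    refine tendsto_atTop_mono (fun j => ?_) tendsto_id
    have := hφ.le_apply (x := j + 1)
    simp only [hψ, id]
    omega
  have hlim' : Tendsto (fun j => mdl.iterates arm B S θ₀ (ψ j + 1)) atTop (𝓝 θ) := by
    simp only [hψ']
    exact hlim.comp (tendsto_add_atTop_nat 1)
  have hθ : θ.IsUpdated := Params.isUpdated_of_tendsto (fun j => hu (ψ j)) hlim'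
    fun j => hanti (Nat.zero_le (ψ j))
  have h1 := Params.tendsto_obj (fun j => (hu (ψ j)).toValid) hθ.toValid hlim'
  -- A monotone sequence converges as soon as a subsequence does. This also controls the iterates
  -- directly after those of the subsequence, which need not belong to it.
  have h2 : Tendsto (fun t => (mdl.iterates arm B S θ₀ (t + 1)).obj) atTop (𝓝 θ.obj) :=
    (tendsto_iff_tendsto_subseq_of_antitone hanti hψt).mpr h1
  have h3 := h1.sub (h2.comp ((tendsto_add_atTop_nat 1).comp hψt))
  rw [sub_self] at h3
  exact Params.isStationary_of_tendsto (S := fun j => S (ψ j + 1)) (fun j => (hu (ψ j)).toValid) hθ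
    (fun j => (hu (ψ j)).compatible) hlim' hB h3

end Model

end BiSVBI

end

theorem theorem1 {M N K Q Tp Td : ℕ} (mdl : BiSVBI.Model M N K Q Tp Td)
    (arm : BiSVBI.ArmijoRule) (B : ℕ) (hB : 1 ≤ B)
    (S : ℕ → Finset (BiSVBI.PathIdx K Q))
    (θ₀ : mdl.Params) (hθ₀ : θ₀.Valid) :
    Antitone (fun t : ℕ => mdl.kld (mdl.iterates arm B S θ₀ t).toFactors) ∧
    ∀ (θ : mdl.Params) (φ : ℕ → ℕ), StrictMono φ →
      Tendsto (fun j : ℕ => mdl.iterates arm B S θ₀ (φ j)) atTop (𝓝 θ) →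
      mdl.IsStationary θ.toFactors :=
  ⟨BiSVBI.Model.antitone_kld_iterates hθ₀ arm hB S, fun _ _ hφ hlim =>
    BiSVBI.Model.isStationary_of_tendsto_iterates hθ₀ arm hB S hφ hlim⟩
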